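/- **Setting.** Let $M$ be a smooth (Hausdorff) $n$-manifold with a smooth Riemannian metric $g$ and two smooth, torsion-free affine connections $\nabla,\nabla^*$ of zero curvature that are dual with respect to $g$: $v\langle X,Y\rangle=\langle\nabla_vX,Y\rangle+\langle X,\nabla^*_vY\rangle$ (a dually flat statistical manifold). The Monge–Ampère operator is $\varphi\mapsto\det\mathrm{Hess}\,\varphi$. **Statement.** Every $x\in M$ has an open neighbourhood $U$ with two smooth coordinate systems $\eta:U\to V\subset\mathbb R^n$, $\eta^*:U\to V^*\subset\mathbb R^n$ (diffeomorphisms onto $V$, $V^*$) and functions $\psi:V\to\mathbb R$, $\psi^*:V^*\to\mathbb R$ such that the following hold. 1. *(Dual coordinates and potentials.)* The coordinate vector fields $\partial_i=\partial/\partial\eta^i$ are $\nabla$-parallel, the fields $\partial^i=\partial/\partial\eta^*_i$ are $\nabla^*$-parallel, and $g(\partial_i,\partial^j)=\delta_i^j$. With $g_{ij}=g(\partial_i,\partial_j)$ and $(g^{ij})=(g_{ij})^{-1}$, one has on $U$ $$g_{ij}=\partial_i\partial_j\psi(\eta),\quad g^{ij}=\partial^i\partial^j\psi^*(\eta^*),\quad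 \eta^*=\nabla\psi(\eta),\quad \eta=\nabla\psi^*(\eta^*),\quad \psi(\eta)+\psi^*(\eta^*)=\langle\eta,\eta^*\rangle .$$ 2. *(Pair of Monge–Ampère equations.)* $V$ and $V^*$ are bounded, open, convex, with strictly convex closures; $\psi,\psi^*$ are smooth and strictly convex; and $\det\mathrm{Hess}\,\psi=\det(g_{ij})>0$ on $V$, $\det\mathrm{Hess}\,\psi^*=\det(g(\partial^i,\partial^j))>0$ on $V^*$. Moreover $\nabla\psi$ is an optimal transport map for the quadratic cost $|x-Tx|^2$ from Lebesgue measure on $V$ to the measure $\det\mathrm{Hess}\,\psi^*(y)\,dy$ on $V^*$, and $\nabla\psi^*$ is one from Lebesgue measure on $V^*$ to $\det\mathrm{Hess}\,\psi(x)\,dx$ on $V$. 3. *(Loss.)* The function $D(r,q)=\psi(\eta(r))+\psi^*(\eta^*(q))-\langle\eta(r),\eta^*(q)\rangle$ on $U\times U$ is nonnegative and vanishes exactly when $r=q$. 4. *(Optimal learning.)* For all $p,q\in U$ there is an optimal learning procedure from $p$ to $q$ for the loss $L=D(q,\cdot)$ with respect to the coordinates $e=\eta$, and one for the loss $L=D(\cdot,q)$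 with respect to $e=\eta^*$. Here an *optimal learning procedure* from $p$ to $q$ for $L$ with respect to $e$ is a smooth curve $\gamma:[0,1]\to U$ with $\gamma(0)=p$, $\gamma(1)=q$ such that (a) for every $t\in[0,1)$ the velocity $\dot\gamma(t)$ is a direction of steepest descent of $L$ for $g$: $dL(\dot\gamma(t))\le dL(v)$ for every tangent vector $v$ at $\gamma(t)$ with $g(v,v)\le g(\dot\gamma(t),\dot\gamma(t))$, and $dL(\dot\gamma(t))<0$ if $p\neq q$; (b) $\gamma$ minimizes the flat energy $\int_0^1|\tfrac{d}{dt}\,e(c(t))|^2\,dt$ among all $C^1$ curves $c:[0,1]\to U$ from $p$ to $q$. 5. *(Link with Kullback information.)* Whenever the points of $M$ are realized as probability distributions $P_r$ on a measurable space with densities $\exp(\langle\theta(r),T\rangle-\Psi(r))$ with respect to a fixed measure, where $T$ is a measurable $\mathbb R^n$-valued statistic, $\theta:M\to\mathbb R^n$ is a local diffeomorphism, $\nabla$-affine (its differential is $\nabla$-parallel), and $g$ is the Fisher metric of the family, the loss is the Kullback information: $D(r,q)=I(P_q,P_r)=\int\log\frac{dP_q}{dP_r}\,dP_q$ for all $r,q\in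 U$. -/

import Mathlib

open Set Filter MeasureTheory Bundle
open scoped Manifold ContDiff Topology ENNReal

noncomputable section

namespace DuallyFlat

/-- Coordinate space `ℝⁿ` with its Euclidean structure. -/
abbrev Coord (n : ℕ) : Type := EuclideanSpace ℝ (Fin n)

/-- The `i`-th standard basis vector of `ℝⁿ`. -/
def stdVec {n : ℕ} (i : Fin n) : Coord n := EuclideanSpace.single i (1 : ℝ)

/-! ### Monge–Ampère operators and optimal transport on `ℝⁿ` -/

/-- The Hessian matrix `(∂ᵢ∂ⱼ φ)(x)`. -/
def hessian {n : ℕ} (φ : Coord n → ℝ) (x : Coord n) : Matrix (Fin n) (Fin n) ℝ :=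
  Matrix.of fun i j => fderiv ℝ (fderiv ℝ φ) x (stdVec i) (stdVec j)

/-- The Monge–Ampère operator `φ ↦ det Hess φ`. -/
def mongeAmpere {n : ℕ} (φ : Coord n → ℝ) (x : Coord n) : ℝ := (hessian φ x).det

/-- `(V, φ)` is the geometric datum of the elliptic Monge–Ampère equation `det Hess φ = f`:
`V` is a bounded strictly convex domain, `φ` is a smooth strictly convex function on `V`,
`f` is positive on `V`, and the equation holds in `V`. For an open set, strict convexity is
a condition on the closed domain `closure V`. -/
structure SolvesMongeAmpere {n : ℕ} (V : Set (Coord n)) (φ f : Coord n → ℝ) : Prop where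
  isOpen : IsOpen V
  bounded : Bornology.IsBounded V
  convex : Convex ℝ V
  strictConvex_closure : StrictConvex ℝ (closure V)
  smooth : ContDiffOn ℝ ∞ φ V
  strictConvexOn : StrictConvexOn ℝ V φ
  pos : ∀ x ∈ V, 0 < f x
  equation : ∀ x ∈ V, mongeAmpere φ x = f x

/-- `T` is an optimal solution of the Monge problem between the mass distributions `μ` and `ν`
for the quadratic cost: it pushes `μ` forward to `ν`, and no other transport map is cheaper. -/
structure IsOptimalTransport {n : ℕ} (μ ν : Measure (Coord n)) (T : Coord n → Coord n) :
    Prop where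
  aemeasurable : AEMeasurable T μ
  map_eq : μ.map T = ν
  optimal : ∀ S : Coord n → Coord n, AEMeasurable S μ → μ.map S = ν →
    ∫⁻ x, ‖x - T x‖ₑ ^ 2 ∂μ ≤ ∫⁻ x, ‖x - S x‖ₑ ^ 2 ∂μ

/-! ### Dually flat manifolds -/

section Manifold

variable {n : ℕ} {M : Type*} [TopologicalSpace M] [ChartedSpace (Coord n) M]
  [IsManifold (𝓡 n) ∞ M]

/-- Smooth Riemannian metrics on `M`. -/
abbrev Metric (n : ℕ) (M : Type*) [TopologicalSpace M] [ChartedSpace (Coord n) M]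
    [IsManifold (𝓡 n) ∞ M] : Type _ :=
  ContMDiffRiemannianMetric (𝓡 n) ∞ (Coord n) (fun x : M => TangentSpace (𝓡 n) x)

/-- Affine connections on `M`, i.e. covariant derivatives on the tangent bundle;
`D σ x v` is `(∇_v σ)(x)`. -/
abbrev Connection (n : ℕ) (M : Type*) [TopologicalSpace M] [ChartedSpace (Coord n) M]
    [IsManifold (𝓡 n) ∞ M] : Type _ :=
  CovariantDerivative (𝓡 n) (Coord n) (fun x : M => TangentSpace (𝓡 n) x)

/-- A (not necessarily continuous) vector field on `M`. -/
abbrev VField (n : ℕ) (M : Type*) [TopologicalSpace M] [ChartedSpace (Coord n) M] : Type _ :=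
  ∀ x : M, TangentSpace (𝓡 n) x

/-- Smoothness of a vector field on `M`. -/
def SmoothField (X : VField n M) : Prop :=
  ContMDiff (𝓡 n) (𝓡 n).tangent ∞ (fun x => (⟨x, X x⟩ : TangentBundle (𝓡 n) M))

/-- The curvature `∇_X ∇_Y Z - ∇_Y ∇_X Z - ∇_[X,Y] Z`. -/
def curvature (D : Connection n M) (X Y Z : VField n M) : VField n M := fun x =>
  D (fun y => D Z y (Y y)) x (X x) - D (fun y => D Z y (X y)) x (Y x)
    - D Z x (VectorField.mlieBracket (𝓡 n) X Y x)

/-- A smooth torsion-free affine connection with vanishing curvature. -/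
structure IsFlatTorsionFree (D : Connection n M) : Prop where
  smooth : CovariantDerivative.ContMDiffCovariantDerivative D ∞
  torsion_eq_zero : D.torsion = 0
  curvature_eq_zero : ∀ X Y Z : VField n M, SmoothField X → SmoothField Y → SmoothField Z →
    curvature D X Y Z = 0

/-- `(M, g, ∇, ∇*)` is dually flat: `∇` and `∇*` are flat and torsion-free, and they are dual to
each other, `v ⟨X, Y⟩ = ⟨∇_v X, Y⟩ + ⟨X, ∇*_v Y⟩`. -/
structure IsDuallyFlat (g : Metric n M) (D Ds : Connection n M) : Prop where
  flat : IsFlatTorsionFree D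
  flat_star : IsFlatTorsionFree Ds
  dual : ∀ X Y : VField n M, SmoothField X → SmoothField Y →
    ∀ (x : M) (v : TangentSpace (𝓡 n) x),
      mvfderiv (𝓡 n) (fun y => g.inner y (X y) (Y y)) x v
        = g.inner x (D X x v) (Y x) + g.inner x (X x) (Ds Y x v)

/-! ### Dual coordinates and their potentials -/

/-- The coordinate vector field `∑ vⁱ ∂/∂eⁱ` of a coordinate system `e`. -/
def coordField (e : OpenPartialHomeomorph M (Coord n)) (v : Coord n) : VField n M :=
  fun y => mfderiv 𝓘(ℝ, Coord n) (𝓡 n) e.symm (e y) v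

/-- `e` is a smooth coordinate system whose coordinate vector fields are parallel for `∇`. -/
structure IsAffineCoord (D : Connection n M) (e : OpenPartialHomeomorph M (Coord n)) :
    Prop where
  mem_maximalAtlas : e ∈ IsManifold.maximalAtlas (𝓡 n) ∞ M
  parallel : ∀ v : Coord n, ∀ y ∈ e.source, D (coordField e v) y = 0

/-- The matrix `(g_ij)` of the metric in the coordinates `e`, at the point `y`. -/
def gram (g : Metric n M) (e : OpenPartialHomeomorph M (Coord n)) (y : M) :
    Matrix (Fin n) (Fin n) ℝ :=
  Matrix.of fun i j => g.inner y (coordField e (stdVec i) y) (coordField e (stdVec j) y)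

/-- Two coordinate systems `η`, `η*` on a domain of `M`, with functions `ψ(η)` and `ψ*(η*)`. -/
structure CoordPair (n : ℕ) (M : Type*) [TopologicalSpace M] where
  η : OpenPartialHomeomorph M (Coord n)
  ηs : OpenPartialHomeomorph M (Coord n)
  ψ : Coord n → ℝ
  ψs : Coord n → ℝ

/-- The common domain of the two coordinate systems. -/
def CoordPair.dom (C : CoordPair n M) : Set M := C.η.source

/-- `C` is a pair of mutually dual affine coordinate systems with Legendre dual potentials, and
these potentials solve a pair of elliptic Monge–Ampère equations whose right-hand sides are the
determinants of the metric. The two gradient maps are the optimal transports between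
the coordinate domains that the two Monge–Ampère operators prescribe. -/
structure IsDualMongeAmperePair (g : Metric n M) (D Ds : Connection n M) (C : CoordPair n M) :
    Prop where
  source_eq : C.ηs.source = C.dom
  affine : IsAffineCoord D C.η
  affine_star : IsAffineCoord Ds C.ηs
  biorthogonal : ∀ y ∈ C.dom, ∀ i j : Fin n,
    g.inner y (coordField C.η (stdVec i) y) (coordField C.ηs (stdVec j) y)
      = if i = j then 1 else 0
  hessian_eq : ∀ y ∈ C.dom, hessian C.ψ (C.η y) = gram g C.η y
  hessian_star_eq : ∀ y ∈ C.dom, hessian C.ψs (C.ηs y) = (gram g C.η y)⁻¹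
  gradient_eq : ∀ y ∈ C.dom, HasGradientAt C.ψ (C.ηs y) (C.η y)
  gradient_star_eq : ∀ y ∈ C.dom, HasGradientAt C.ψs (C.η y) (C.ηs y)
  legendre : ∀ y ∈ C.dom, C.ψ (C.η y) + C.ψs (C.ηs y) = inner ℝ (C.η y) (C.ηs y)
  solves : SolvesMongeAmpere C.η.target C.ψ fun z => (gram g C.η (C.η.symm z)).det
  solves_star : SolvesMongeAmpere C.ηs.target C.ψs fun z => (gram g C.ηs (C.ηs.symm z)).det
  transport : IsOptimalTransport (volume.restrict C.η.target)
    ((volume.restrict C.ηs.target).withDensity fun z => ENNReal.ofReal (mongeAmpere C.ψs z))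
    (gradient C.ψ)
  transport_star : IsOptimalTransport (volume.restrict C.ηs.target)
    ((volume.restrict C.η.target).withDensity fun z => ENNReal.ofReal (mongeAmpere C.ψ z))
    (gradient C.ψs)

/-- The canonical divergence `ψ(η(r)) + ψ*(η*(q)) - ⟨η(r), η*(q)⟩`. -/
def divergence (C : CoordPair n M) (r q : M) : ℝ :=
  C.ψ (C.η r) + C.ψs (C.ηs q) - inner ℝ (C.η r) (C.ηs q)

/-! ### Learning curves -/

/-- `γ` restricted to `[0, 1]` is a curve of class `C^k` from `p` to `q` in `U`. -/
structure IsCurve (k : ℕ∞ω) (U : Set M) (p q : M) (γ : ℝ → M) : Prop where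
  contMDiffOn : ContMDiffOn 𝓘(ℝ, ℝ) (𝓡 n) k γ (Icc 0 1)
  mapsTo : MapsTo γ (Icc 0 1) U
  start : γ 0 = p
  finish : γ 1 = q

/-- The velocity of a curve parametrised by `[0, 1]`. -/
def velocity (γ : ℝ → M) (t : ℝ) : TangentSpace (𝓡 n) (γ t) :=
  mfderivWithin 𝓘(ℝ, ℝ) (𝓡 n) γ (Icc 0 1) t (1 : ℝ)

/-- The energy of a curve for the flat metric `∑ (d eⁱ)²` of a coordinate system `e`. -/
def flatEnergy (e : OpenPartialHomeomorph M (Coord n)) (γ : ℝ → M) : ℝ :=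
  ∫ t in (0 : ℝ)..1, ‖derivWithin (fun s => e (γ s)) (Icc 0 1) t‖ ^ 2

/-- `γ` is an optimal learning procedure from `p` to `q` for the loss function `L`, in the domain
of the flat coordinate system `e`: it is a smooth curve from `p` to `q` that at each time moves
in the direction of steepest descent of `L` with respect to `g` (among all tangent vectors that
are not longer, the velocity decreases `L` fastest), along which `L` decreases strictly as long as
there is something to learn, and whose flat energy is minimal among all curves from `p` to `q`. -/
structure IsOptimalLearning (g : Metric n M) (e : OpenPartialHomeomorph M (Coord n))
    (L : M → ℝ) (p q : M) (γ : ℝ → M) : Prop where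
  curve : IsCurve (n := n) ∞ e.source p q γ
  steepest : ∀ t ∈ Ico (0 : ℝ) 1, ∀ v : TangentSpace (𝓡 n) (γ t),
    g.inner (γ t) v v ≤ g.inner (γ t) (velocity γ t) (velocity γ t) →
      mvfderiv (𝓡 n) L (γ t) (velocity γ t) ≤ mvfderiv (𝓡 n) L (γ t) v
  descent : p ≠ q → ∀ t ∈ Ico (0 : ℝ) 1, mvfderiv (𝓡 n) L (γ t) (velocity γ t) < 0
  energy_min : ∀ c : ℝ → M, IsCurve (n := n) 1 e.source p q c → flatEnergy e γ ≤ flatEnergy e c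

/-! ### Exponential families -/

/-- The measure with density `exp(⟨θ, T⟩ - a)` with respect to `ν`. -/
def expMeasure {Ω : Type*} [MeasurableSpace Ω] (ν : Measure Ω) (T : Ω → Coord n)
    (θ : Coord n) (a : ℝ) : Measure Ω :=
  ν.withDensity fun z => ENNReal.ofReal (Real.exp (inner ℝ θ (T z) - a))

/-- The points of `(M, g, ∇)` are the members of an exponential family: the point `r` is the
probability distribution with density `exp(⟨θ(r), T⟩ - Ψ(r))` with respect to `ν`, the canonical
parameters `θ` are local `∇`-affine coordinates of `M` (their differentials are parallel), and
`g` is the Fisher metric. -/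
structure IsExponentialFamily {Ω : Type*} [MeasurableSpace Ω] (g : Metric n M)
    (D : Connection n M) (ν : Measure Ω) (T : Ω → Coord n) (θ : M → Coord n) (Ψ : M → ℝ) :
    Prop where
  measurable : Measurable T
  normalized : ∀ r, IsProbabilityMeasure (expMeasure ν T (θ r) (Ψ r))
  coord : IsLocalDiffeomorph (𝓡 n) 𝓘(ℝ, Coord n) ∞ θ
  affine : ∀ X : VField n M, SmoothField X → ∀ (r : M) (v : TangentSpace (𝓡 n) r),
    mvfderiv (𝓡 n) (fun y => mvfderiv (𝓡 n) θ y (X y)) r v = mvfderiv (𝓡 n) θ r (D X r v)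
  fisher : ∀ (r : M) (v w : TangentSpace (𝓡 n) r),
    g.inner r v w = ∫ z, mvfderiv (𝓡 n) (fun s => inner ℝ (θ s) (T z) - Ψ s) r v
      * mvfderiv (𝓡 n) (fun s => inner ℝ (θ s) (T z) - Ψ s) r w ∂(expMeasure ν T (θ r) (Ψ r))

end Manifold

end DuallyFlat

end

/-!
Zero curvature is the Frobenius integrability condition for parallel fields, so both connections
have parallel frames, and absence of torsion makes these frames coordinate frames. In affine
coordinates of `∇`, duality with `∇*` makes the derivative of the metric totally symmetric; hence
the metric is a Hessian `D²ψ`, and `η* = ∇ψ(η)` are affine coordinates of `∇*` dual to `η`.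

The gradient map has to be restricted to a domain that is strictly convex together with its image.
A small ball works: its image is a sublevel set of the squared distance to the centre transported by
the inverse of the gradient map, and this function is strictly convex near its minimum.

The gradient map is optimal by Kantorovich duality, since `ψ(x) + ψ*(y) - ⟨x, y⟩` is nonnegative and
vanishes when `y = ∇ψ(x)`. Minus the Riemannian gradient of `D(q, ·)` at `r` is `η(q) - η(r)` in the
coordinates `η`, so the steepest descent curves are coordinate segments, which minimise the flat
energy. Along such a segment of an exponential family, `ψ` and the cumulant generating function of
the log-likelihood ratio both have the metric as second derivative, so that they have the same
Bregman divergence: the loss and the Kullback information.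
-/

noncomputable section

namespace DuallyFlat

set_option maxSynthPendingDepth 3

/-! ### Total differential equations -/

section TotalDifferentialEquation

variable {E F G : Type*} [NormedAddCommGroup E] [NormedSpace ℝ E]
  [NormedAddCommGroup F] [NormedSpace ℝ F] [NormedAddCommGroup G] [NormedSpace ℝ G]

theorem exists_hasDerivWithinAt_clm_apply [CompleteSpace F] (A : ℝ → F →L[ℝ] F)
    (hA : ContinuousOn A (Icc 0 1)) (hA_le : ∀ t ∈ Icc (0 : ℝ) 1, ‖A t‖ ≤ 1 / 2) (y₀ : F) :
    ∃ Y : ℝ → F, Y 0 = y₀ ∧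
      ∀ t ∈ Icc (0 : ℝ) 1, HasDerivWithinAt Y (A t (Y t)) (Icc 0 1) t := by
  have picard : IsPicardLindelof (fun t y => A t y) (tmin := 0) (tmax := 1) ⟨0, by simp⟩ y₀
      ‖y₀‖₊ 0 ‖y₀‖₊ 1 := by
    refine ⟨fun t ht => ?_, fun y _ => hA.clm_apply continuousOn_const, fun t ht y hy => ?_,
      by simp⟩
    · refine ((A t).lipschitz.weaken ?_).lipschitzOnWith
      exact_mod_cast (hA_le t ht).trans (by norm_num)
    · have norm_y : ‖y‖ ≤ 2 * ‖y₀‖ := by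
        linarith [norm_le_norm_add_norm_sub' y y₀, mem_closedBall_iff_norm.1 hy, coe_nnnorm y₀]
      calc ‖A t y‖ ≤ ‖A t‖ * ‖y‖ := (A t).le_opNorm y
        _ ≤ 1 / 2 * (2 * ‖y₀‖) := by gcongr; exact hA_le t ht
        _ = ‖y₀‖ := by ring
  exact picard.exists_eq_forall_mem_Icc_hasDerivWithinAt₀

theorem norm_sub_sub_fderiv_le_of_lipschitzOnWith {f : E → G} {s : Set E} {C : NNReal}
    (hs : Convex ℝ s) (hf : ∀ x ∈ s, DifferentiableAt ℝ f x)
    (hC : LipschitzOnWith C (fderiv ℝ f) s) {x w : E} (hx : x ∈ s) (hxw : x + w ∈ s) :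
    ‖f (x + w) - f x - fderiv ℝ f x w‖ ≤ C * ‖w‖ ^ 2 := by
  have hseg : segment ℝ x (x + w) ⊆ s := hs.segment_subset hx hxw
  have fderiv_sub_le : ∀ y ∈ segment ℝ x (x + w), ‖fderiv ℝ f y - fderiv ℝ f x‖ ≤ C * ‖w‖ := by
    intro y hy
    refine (hC.norm_sub_le (hseg hy) hx).trans ?_
    gcongr
    simpa using norm_sub_le_of_mem_segment hy
  calc ‖f (x + w) - f x - fderiv ℝ f x w‖ ≤ C * ‖w‖ * ‖w‖ := by
        simpa using (convex_segment x (x + w)).norm_image_sub_le_of_norm_fderiv_le' (𝕜 := ℝ)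
          (fun y hy => hf y (hseg hy)) fderiv_sub_le (left_mem_segment ℝ _ _)
          (right_mem_segment ℝ _ _)
    _ = C * ‖w‖ ^ 2 := by ring

theorem norm_smul_le_of_norm_le_one {c b : ℝ} {z : G} (hc : ‖c‖ ≤ 1) (hz : ‖z‖ ≤ b) :
    ‖c • z‖ ≤ b :=
  (norm_smul_le c z).trans ((mul_le_of_le_one_left (norm_nonneg z) hc).trans hz)

theorem add_smul_mem_ball {x₀ h : E} {r t : ℝ} (hh : ‖h‖ < r) (ht : t ∈ Icc (0 : ℝ) 1) :
    x₀ + t • h ∈ Metric.ball x₀ r := by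
  rw [mem_ball_iff_norm, add_sub_cancel_left]
  exact (norm_smul_le_of_norm_le_one (by rw [Real.norm_of_nonneg ht.1]; exact ht.2)
    le_rfl).trans_lt hh

variable {B : E → E →L[ℝ] F →L[ℝ] F} {x₀ p h v : E} {y : F} {t : ℝ} {Y Y' : ℝ → F}

/-- Frobenius' integrability condition at `x` for the total differential equation
`f' v = B v f`: the symmetry of the second derivative that the equation prescribes. -/
def FrobeniusCondition (B : E → E →L[ℝ] F →L[ℝ] F) (x : E) : Prop :=
  ∀ u v y, fderiv ℝ B x u v y + B x v (B x u y) = fderiv ℝ B x v u y + B x u (B x v y)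

/-- `Y` is the restriction to the segment from `x₀` to `x₀ + h`, parametrised by `[0, 1]`, of a
solution of `f' v = B v f`. -/
def IsRaySolution (B : E → E →L[ℝ] F →L[ℝ] F) (x₀ h : E) (Y : ℝ → F) : Prop :=
  ∀ t ∈ Icc (0 : ℝ) 1, HasDerivWithinAt Y (B (x₀ + t • h) h (Y t)) (Icc 0 1) t

/-- The first order variation of a ray solution in the direction `v` that the total differential
equation predicts. -/
def rayVariation (B : E → E →L[ℝ] F →L[ℝ] F) (x₀ h v : E) (Y : ℝ → F) (t : ℝ) : F :=
  Y t + t • B (x₀ + t • h) v (Y t)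

/-- The derivative of `rayVariation` at time `t`, in terms of `p = x₀ + t h` and `y = Y t`. -/
def rayVariationDeriv (B : E → E →L[ℝ] F →L[ℝ] F) (h v p : E) (y : F) (t : ℝ) : F :=
  B p h y + (t • (fderiv ℝ B p h v y + B p v (B p h y)) + B p v y)

theorem IsRaySolution.hasDerivWithinAt_rayVariation (hY : IsRaySolution B x₀ h Y)
    (ht : t ∈ Icc (0 : ℝ) 1) (hB : DifferentiableAt ℝ B (x₀ + t • h)) :
    HasDerivWithinAt (rayVariation B x₀ h v Y)
      (rayVariationDeriv B h v (x₀ + t • h) (Y t) t) (Icc 0 1) t := by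
  have ray : HasDerivAt (fun s : ℝ => x₀ + s • h) h t := by
    simpa using ((hasDerivAt_id t).smul_const h).const_add x₀
  have coeff_along_ray : HasDerivAt (fun s : ℝ => B (x₀ + s • h)) (fderiv ℝ B (x₀ + t • h) h) t :=
    hB.hasFDerivAt.comp_hasDerivAt t ray
  have coeff : HasDerivAt (fun s : ℝ => B (x₀ + s • h) v) (fderiv ℝ B (x₀ + t • h) h v) t := by
    simpa using coeff_along_ray.clm_apply (hasDerivAt_const t v)
  have transported := coeff.hasDerivWithinAt.clm_apply (hY t ht)
  refine ((hY t ht).add ((hasDerivWithinAt_id t (Icc 0 1)).smul transported)).congr_deriv ?_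
  simp [rayVariationDeriv]

theorem FrobeniusCondition.rayVariationDeriv_sub_eq (hp : FrobeniusCondition B p) :
    rayVariationDeriv B h v p y t - B (p + t • v) (h + v) (y + t • B p v y)
      = -(t • B p v (B p v y) + t • fderiv ℝ B p v v y
        + (t * t) • fderiv ℝ B p v (h + v) (B p v y)
        + (B (p + t • v) - B p - fderiv ℝ B p (t • v)) (h + v) (y + t • B p v y)) := by
  have swap : fderiv ℝ B p h v y
      = fderiv ℝ B p v h y + B p h (B p v y) - B p v (B p h y) := by
    rw [← hp h v y]; abel
  simp only [rayVariationDeriv, swap, sub_apply, map_add, map_smul, add_apply, smul_apply,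
    smul_add, smul_sub, mul_smul]
  abel

/-- The coefficient `B` and the radius `r` meet the bounds under which the rays through `x₀` carry
solutions and the error terms of `rayVariation` are under control. -/
structure RayBounds (B : E → E →L[ℝ] F →L[ℝ] F) (x₀ : E) (K : NNReal) (r : ℝ) : Prop where
  one_le : 1 ≤ K
  mul_le : K * r ≤ 1 / 2
  differentiableAt : ∀ x ∈ Metric.ball x₀ r, DifferentiableAt ℝ B x
  norm_le : ∀ x ∈ Metric.ball x₀ r, ‖B x‖ ≤ K
  norm_fderiv_le : ∀ x ∈ Metric.ball x₀ r, ‖fderiv ℝ B x‖ ≤ K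
  lipschitz : LipschitzOnWith K (fderiv ℝ B) (Metric.ball x₀ r)

namespace RayBounds

variable {K : NNReal} {r N : ℝ}

theorem norm_le_half (hB : RayBounds B x₀ K r) (hh : ‖h‖ < r) : ‖h‖ ≤ 1 / 2 := by
  have : (1 : ℝ) ≤ K := hB.one_le
  nlinarith [hB.mul_le, norm_nonneg h]

theorem norm_apply_le_half (hB : RayBounds B x₀ K r) (hp : p ∈ Metric.ball x₀ r) (hh : ‖h‖ < r) :
    ‖B p h‖ ≤ 1 / 2 :=
  calc ‖B p h‖ ≤ ‖B p‖ * ‖h‖ := (B p).le_opNorm h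
    _ ≤ K * r := by gcongr; exact hB.norm_le p hp
    _ ≤ 1 / 2 := hB.mul_le

theorem exists_isRaySolution [CompleteSpace F] (hB : RayBounds B x₀ K r) (hh : ‖h‖ < r) (y₀ : F) :
    ∃ Y : ℝ → F, Y 0 = y₀ ∧ IsRaySolution B x₀ h Y := by
  refine exists_hasDerivWithinAt_clm_apply (fun t => B (x₀ + t • h) h) (fun t ht => ?_)
    (fun t ht => hB.norm_apply_le_half (add_smul_mem_ball hh ht) hh) y₀
  have : ContinuousAt B (x₀ + t • h) :=
    (hB.differentiableAt _ (add_smul_mem_ball hh ht)).continuousAt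
  exact ((this.comp' (f := fun t : ℝ => x₀ + t • h) (by fun_prop)).clm_apply
    continuousAt_const).continuousWithinAt

theorem norm_rayVariationDeriv_sub_le (hB : RayBounds B x₀ K r)
    (hfrob : ∀ x ∈ Metric.ball x₀ r, FrobeniusCondition B x) (ht : t ∈ Icc (0 : ℝ) 1)
    (hh : ‖h‖ < r) (hhv : ‖h + v‖ < r) (hy : ‖y‖ ≤ N) :
    ‖rayVariationDeriv B h v (x₀ + t • h) y t
        - B (x₀ + t • (h + v)) (h + v) (y + t • B (x₀ + t • h) v y)‖
      ≤ 5 * K ^ 2 * N * ‖v‖ ^ 2 := by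
  have one_le_K : (1 : ℝ) ≤ K := hB.one_le
  have hhv_le : ‖h + v‖ ≤ 1 := by linarith [hB.norm_le_half hhv]
  have hv_le : ‖v‖ ≤ 1 := by
    linarith [norm_sub_le (h + v) h, hB.norm_le_half hhv, hB.norm_le_half hh,
      congrArg norm (add_sub_cancel_left h v)]
  have ht_le : ‖t‖ ≤ 1 := by rw [Real.norm_of_nonneg ht.1]; exact ht.2
  have N_nonneg : 0 ≤ N := (norm_nonneg y).trans hy
  have hp : x₀ + t • h ∈ Metric.ball x₀ r := add_smul_mem_ball hh ht
  have hq : x₀ + t • (h + v) ∈ Metric.ball x₀ r := add_smul_mem_ball hhv ht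
  rw [smul_add, ← add_assoc] at hq ⊢
  rw [(hfrob _ hp).rayVariationDeriv_sub_eq, norm_neg]
  set p := x₀ + t • h
  have norm_coeff (z : F) : ‖B p v z‖ ≤ K * ‖v‖ * ‖z‖ :=
    (B p).le_of_opNorm₂_le_of_le (hB.norm_le p hp) le_rfl le_rfl
  have norm_deriv (w : E) (z : F) : ‖fderiv ℝ B p v w z‖ ≤ K * ‖v‖ * ‖w‖ * ‖z‖ :=
    (fderiv ℝ B p v).le_of_opNorm₂_le_of_le
      ((fderiv ℝ B p).le_of_opNorm_le (hB.norm_fderiv_le p hp) v) le_rfl le_rfl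
  have norm_y' : ‖B p v y‖ ≤ K * ‖v‖ * N := (norm_coeff y).trans (by gcongr)
  have first : ‖t • B p v (B p v y)‖ ≤ K * ‖v‖ * (K * ‖v‖ * N) :=
    norm_smul_le_of_norm_le_one ht_le ((norm_coeff _).trans (by gcongr))
  have second : ‖t • fderiv ℝ B p v v y‖ ≤ K * ‖v‖ * ‖v‖ * N :=
    norm_smul_le_of_norm_le_one ht_le ((norm_deriv v y).trans (by gcongr))
  have third : ‖(t * t) • fderiv ℝ B p v (h + v) (B p v y)‖ ≤ K * ‖v‖ * 1 * (K * ‖v‖ * N) :=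
    norm_smul_le_of_norm_le_one ((norm_mul_le_of_le ht_le ht_le).trans_eq (mul_one 1))
      ((norm_deriv _ _).trans (by gcongr))
  have norm_tv : ‖t • v‖ ≤ ‖v‖ := norm_smul_le_of_norm_le_one ht_le le_rfl
  have variation : ‖y + t • B p v y‖ ≤ N + K * 1 * N :=
    norm_add_le_of_le hy (norm_smul_le_of_norm_le_one ht_le (norm_y'.trans (by gcongr)))
  have remainder := norm_sub_sub_fderiv_le_of_lipschitzOnWith (convex_ball x₀ r)
    hB.differentiableAt hB.lipschitz hp hq
  have fourth : ‖(B (p + t • v) - B p - fderiv ℝ B p (t • v)) (h + v) (y + t • B p v y)‖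
      ≤ K * ‖v‖ ^ 2 * 1 * (N + K * 1 * N) :=
    ContinuousLinearMap.le_of_opNorm₂_le_of_le _ (remainder.trans (by gcongr)) hhv_le variation
  refine (norm_add_le_of_le
    (norm_add_le_of_le (norm_add_le_of_le first second) third) fourth).trans ?_
  have : 0 ≤ (K : ℝ) * (K - 1) * N * ‖v‖ ^ 2 := by
    have := sub_nonneg.2 one_le_K
    positivity
  nlinarith

theorem norm_sub_rayVariation_le (hB : RayBounds B x₀ K r)
    (hfrob : ∀ x ∈ Metric.ball x₀ r, FrobeniusCondition B x) (hh : ‖h‖ < r) (hhv : ‖h + v‖ < r)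
    (hY : IsRaySolution B x₀ h Y) (hY' : IsRaySolution B x₀ (h + v) Y') (h0 : Y' 0 = Y 0)
    (hN : ∀ t ∈ Icc (0 : ℝ) 1, ‖Y t‖ ≤ N) :
    ‖Y' 1 - rayVariation B x₀ h v Y 1‖ ≤ 5 * K ^ 2 * N * (Real.exp 1 - 1) * ‖v‖ ^ 2 := by
  have right_deriv {f f' : ℝ → F} (hf : ∀ t ∈ Icc (0 : ℝ) 1, HasDerivWithinAt f (f' t) (Icc 0 1) t)
      (t : ℝ) (ht : t ∈ Ico (0 : ℝ) 1) : HasDerivWithinAt f (f' t) (Ici t) t :=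
    (hf t (Ico_subset_Icc_self ht)).mono_of_mem_nhdsWithin (Icc_mem_nhdsGE_of_mem ht)
  have hZ : ∀ t ∈ Icc (0 : ℝ) 1, HasDerivWithinAt (rayVariation B x₀ h v Y)
      (rayVariationDeriv B h v (x₀ + t • h) (Y t) t) (Icc 0 1) t := fun t ht =>
    hY.hasDerivWithinAt_rayVariation ht (hB.differentiableAt _ (add_smul_mem_ball hh ht))
  have lipschitz (t : ℝ) (ht : t ∈ Ico (0 : ℝ) 1) :
      LipschitzOnWith 1 (B (x₀ + t • (h + v)) (h + v)) univ :=
    ((B (x₀ + t • (h + v)) (h + v)).lipschitz.weaken (by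
      exact_mod_cast (hB.norm_apply_le_half (add_smul_mem_ball hhv (Ico_subset_Icc_self ht))
        hhv).trans (by norm_num))).lipschitzOnWith
  have gronwall := dist_le_of_approx_trajectories_ODE_of_mem (εf := 0) (δ := 0) lipschitz
    (fun t ht => (hY' t ht).continuousWithinAt) (right_deriv hY') (fun t _ => (dist_self _).le)
    (fun _ _ => mem_univ _) (fun t ht => (hZ t ht).continuousWithinAt) (right_deriv hZ)
    (fun t ht => (dist_eq_norm _ _).trans_le (hB.norm_rayVariationDeriv_sub_le hfrob
      (Ico_subset_Icc_self ht) hh hhv (hN t (Ico_subset_Icc_self ht))))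
    (fun _ _ => mem_univ _) (by simp [rayVariation, h0]) 1 (by simp)
  rw [← dist_eq_norm]
  refine gronwall.trans_eq ?_
  rw [NNReal.coe_one, gronwallBound_of_K_ne_0 one_ne_zero]
  simp only [zero_mul, zero_add, sub_zero, mul_one, div_one]
  ring

theorem hasFDerivAt_of_isRaySolution (hB : RayBounds B x₀ K r)
    (hfrob : ∀ x ∈ Metric.ball x₀ r, FrobeniusCondition B x) {Y : E → ℝ → F} {y₀ : F}
    (hY : ∀ h, ‖h‖ < r → Y h 0 = y₀ ∧ IsRaySolution B x₀ h (Y h)) {x : E}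
    (hx : x ∈ Metric.ball x₀ r) :
    HasFDerivAt (fun z => Y (z - x₀) 1) ((B x).flip (Y (x - x₀) 1)) x := by
  have hxr : ‖x - x₀‖ < r := mem_ball_iff_norm.1 hx
  obtain ⟨hY0, hYx⟩ := hY _ hxr
  obtain ⟨N, hN⟩ := isCompact_Icc.exists_bound_of_continuousOn
    fun t ht => (hYx t ht).continuousWithinAt
  rw [hasFDerivAt_iff_isLittleO_nhds_zero]
  refine Asymptotics.IsBigO.trans_isLittleO (g := fun v : E => ‖v‖ ^ 2) ?_
    (by simpa using Asymptotics.isLittleO_norm_pow_id one_lt_two)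
  refine .of_bound (5 * K ^ 2 * N * (Real.exp 1 - 1)) ?_
  have near : ∀ᶠ v in 𝓝 (0 : E), ‖x - x₀ + v‖ < r :=
    ContinuousAt.eventually_lt (by fun_prop) continuousAt_const (by simpa using hxr)
  filter_upwards [near] with v hv
  have estimate := hB.norm_sub_rayVariation_le hfrob hxr hv hYx (hY _ hv).2
    ((hY _ hv).1.trans hY0.symm) hN
  simpa [rayVariation, add_sub_right_comm, sub_sub] using estimate

end RayBounds

theorem exists_rayBounds (hB : ContDiffAt ℝ 2 B x₀) {P : E → Prop} (hP : ∀ᶠ x in 𝓝 x₀, P x) :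
    ∃ K, ∃ r > 0, RayBounds B x₀ K r ∧ ∀ x ∈ Metric.ball x₀ r, P x := by
  have hB' : ContDiffAt ℝ 1 (fderiv ℝ B) x₀ := hB.fderiv_right (by norm_num)
  obtain ⟨C, s, hs, hC⟩ := hB'.exists_lipschitzOnWith
  set K : NNReal := 1 + ‖B x₀‖₊ + ‖fderiv ℝ B x₀‖₊ + C
  have hK : (K : ℝ) = 1 + ‖B x₀‖ + ‖fderiv ℝ B x₀‖ + C := rfl
  have norm_le : ∀ᶠ x in 𝓝 x₀, ‖B x‖ < K :=
    hB.continuousAt.norm.eventually_lt continuousAt_const (by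
      linarith [norm_nonneg (fderiv ℝ B x₀), C.coe_nonneg])
  have norm_fderiv_le : ∀ᶠ x in 𝓝 x₀, ‖fderiv ℝ B x‖ < K :=
    hB'.continuousAt.norm.eventually_lt continuousAt_const (by
      linarith [norm_nonneg (B x₀), C.coe_nonneg])
  have differentiable : ∀ᶠ x in 𝓝 x₀, DifferentiableAt ℝ B x :=
    (hB.eventually (by simp)).mono fun x hx => hx.differentiableAt (by simp)
  obtain ⟨R, hR, hball⟩ := Metric.eventually_nhds_iff_ball.1
    (differentiable.and (norm_le.and (norm_fderiv_le.and (hP.and hs))))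
  have hsub : Metric.ball x₀ (min R (1 / (2 * K))) ⊆ Metric.ball x₀ R :=
    Metric.ball_subset_ball (min_le_left _ _)
  have K_pos : (0 : ℝ) < K := by positivity
  refine ⟨K, min R (1 / (2 * K)), by positivity, ⟨?_, ?_, fun x hx => (hball x (hsub hx)).1,
    fun x hx => (hball x (hsub hx)).2.1.le, fun x hx => (hball x (hsub hx)).2.2.1.le, ?_⟩,
    fun x hx => (hball x (hsub hx)).2.2.2.1⟩
  · simp [K, add_assoc]
  · calc K * min R (1 / (2 * K)) ≤ K * (1 / (2 * K)) := by gcongr; exact min_le_right _ _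
      _ = 1 / 2 := by field_simp
  · exact (hC.mono fun x hx => (hball x (hsub hx)).2.2.2.2).weaken (by simp [K])

theorem exists_hasFDerivAt_of_frobeniusCondition [CompleteSpace F] (hB : ContDiffAt ℝ 2 B x₀)
    (hfrob : ∀ᶠ x in 𝓝 x₀, FrobeniusCondition B x) :
    ∃ r > 0, ∀ y₀ : F, ∃ f : E → F, f x₀ = y₀ ∧
      ∀ x ∈ Metric.ball x₀ r, HasFDerivAt f ((B x).flip (f x)) x := by
  obtain ⟨K, r, r_pos, bounds, hfrob⟩ := exists_rayBounds hB hfrob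
  refine ⟨r, r_pos, fun y₀ => ?_⟩
  choose! Y hY using fun h (hh : ‖h‖ < r) => bounds.exists_isRaySolution hh y₀
  refine ⟨fun x => Y (x - x₀) 1, ?_, fun x hx => bounds.hasFDerivAt_of_isRaySolution hfrob hY hx⟩
  obtain ⟨hY0, hYsol⟩ := hY 0 (by simpa using r_pos)
  have constant := (convex_Icc (0 : ℝ) 1).is_const_of_fderivWithin_eq_zero
    (fun t ht => (hYsol t ht).differentiableWithinAt) (fun t ht => by
      simpa using (hYsol t ht).hasFDerivWithinAt.fderivWithin (uniqueDiffOn_Icc_zero_one t ht))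
    (x := 1) (y := 0) (by simp) (by simp)
  simpa using constant.trans hY0

theorem contDiffOn_of_hasFDerivAt_flip {s : Set E} (hs : IsOpen s) (hB : ContDiffOn ℝ ∞ B s)
    {f : E → F} (hf : ∀ x ∈ s, HasFDerivAt f ((B x).flip (f x)) x) : ContDiffOn ℝ ∞ f s := by
  rw [contDiffOn_infty]
  intro n
  induction n with
  | zero => exact contDiffOn_zero.2 fun x hx => (hf x hx).continuousAt.continuousWithinAt
  | succ n ih =>
    rw [Nat.cast_succ, contDiffOn_succ_iff_fderiv_of_isOpen hs]
    refine ⟨fun x hx => (hf x hx).differentiableAt.differentiableWithinAt, by simp, ?_⟩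
    have hBn : ContDiffOn ℝ n B s := hB.of_le (by exact_mod_cast le_top)
    have : ContDiffOn ℝ n (fun x => (B x).flip (f x)) s :=
      ((ContinuousLinearMap.flipₗᵢ ℝ E F F).contDiff.comp_contDiffOn hBn).clm_apply ih
    exact this.congr fun x hx => (hf x hx).fderiv

end TotalDifferentialEquation

/-! ### Vector fields and connections in a chart -/

theorem sum_smul_stdVec {n : ℕ} (v : Coord n) : ∑ j, v j • stdVec j = v := by
  simpa [stdVec] using (EuclideanSpace.basisFun (Fin n) ℝ).sum_repr v

theorem contDiffOn_of_forall_stdVec {n : ℕ} {F : Type*} [NormedAddCommGroup F] [NormedSpace ℝ F]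
    {s : Set (Coord n)} {A : Coord n → Coord n →L[ℝ] F}
    (h : ∀ j, ContDiffOn ℝ ∞ (fun z => A z (stdVec j)) s) : ContDiffOn ℝ ∞ A s := by
  have hsum : A = fun z => ∑ j, ContinuousLinearMap.smulRightL ℝ (Coord n) F
      (EuclideanSpace.proj j : Coord n →L[ℝ] ℝ) (A z (stdVec j)) := by
    funext z
    ext v
    conv_lhs => rw [← sum_smul_stdVec v]
    simp
  rw [hsum]
  exact ContDiffOn.sum fun j _ =>
    (ContinuousLinearMap.smulRightL ℝ (Coord n) F
      (EuclideanSpace.proj j : Coord n →L[ℝ] ℝ)).contDiff.comp_contDiffOn (h j)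

theorem hasFDerivAt_apply_apply {E F G H : Type*} [NormedAddCommGroup E] [NormedSpace ℝ E]
    [NormedAddCommGroup F] [NormedSpace ℝ F] [NormedAddCommGroup G] [NormedSpace ℝ G]
    [NormedAddCommGroup H] [NormedSpace ℝ H] {B : E → F →L[ℝ] G →L[ℝ] H}
    {B' : E →L[ℝ] F →L[ℝ] G →L[ℝ] H} {z : E} (hB : HasFDerivAt B B' z) (v : F) (w : G) :
    HasFDerivAt (fun z => B z v w) ((B'.flip v).flip w) z := by
  refine ((hB.clm_apply (hasFDerivAt_const v z)).clm_apply (hasFDerivAt_const w z)).congr_fderiv ?_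
  ext u
  simp

section Connection

variable {n : ℕ} {M : Type*} [TopologicalSpace M] [ChartedSpace (Coord n) M]

/-- The coordinate fields of `e` at `y`, as a linear map: `coordFrame e y v = coordField e v y`. -/
def coordFrame (e : OpenPartialHomeomorph M (Coord n)) (y : M) :
    Coord n →L[ℝ] TangentSpace (𝓡 n) y :=
  mfderiv 𝓘(ℝ, Coord n) (𝓡 n) e.symm (e y)

theorem coordField_eq (e : OpenPartialHomeomorph M (Coord n)) (v : Coord n) (y : M) :
    coordField e v y = coordFrame e y v := rfl

variable {e : OpenPartialHomeomorph M (Coord n)}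

theorem mdifferentiable_of_mem_maximalAtlas (he : e ∈ IsManifold.maximalAtlas (𝓡 n) ∞ M) :
    e.MDifferentiable (𝓡 n) 𝓘(ℝ, Coord n) :=
  ⟨(contMDiffOn_of_mem_maximalAtlas he).mdifferentiableOn (by simp),
    (contMDiffOn_symm_of_mem_maximalAtlas he).mdifferentiableOn (by simp)⟩

theorem contDiffAt_comp_symm {F : Type*} [NormedAddCommGroup F] [NormedSpace ℝ F]
    (he : e ∈ IsManifold.maximalAtlas (𝓡 n) ∞ M) {z : Coord n} (hz : z ∈ e.target) {f : M → F}
    (hf : ContMDiffAt (𝓡 n) 𝓘(ℝ, F) ∞ f (e.symm z)) : ContDiffAt ℝ ∞ (f ∘ e.symm) z :=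
  (hf.comp z (contMDiffAt_symm_of_mem_maximalAtlas he hz)).contDiffAt

theorem isInvertible_mfderiv_symm (he : e ∈ IsManifold.maximalAtlas (𝓡 n) ∞ M) {z : Coord n}
    (hz : z ∈ e.target) : (mfderiv 𝓘(ℝ, Coord n) (𝓡 n) e.symm z).IsInvertible :=
  ⟨(mdifferentiable_of_mem_maximalAtlas he).symm.mfderiv hz, rfl⟩

theorem mvfderiv_coordFrame (he : e ∈ IsManifold.maximalAtlas (𝓡 n) ∞ M) {y : M}
    (hy : y ∈ e.source) (v : Coord n) : mvfderiv (𝓡 n) e y (coordFrame e y v) = v := by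
  have h := (mdifferentiable_of_mem_maximalAtlas he).comp_symm_deriv (e.map_source hy)
  rw [e.left_inv hy] at h
  exact DFunLike.congr_fun h v

theorem coordFrame_mvfderiv (he : e ∈ IsManifold.maximalAtlas (𝓡 n) ∞ M) {y : M}
    (hy : y ∈ e.source) (v : TangentSpace (𝓡 n) y) :
    coordFrame e y (mvfderiv (𝓡 n) e y v) = v :=
  DFunLike.congr_fun ((mdifferentiable_of_mem_maximalAtlas he).symm_comp_deriv hy) v

theorem mvfderiv_coordFrame_apply {F : Type*} [NormedAddCommGroup F] [NormedSpace ℝ F]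
    (he : e ∈ IsManifold.maximalAtlas (𝓡 n) ∞ M) {y : M} (hy : y ∈ e.source) {f : M → F}
    (hf : MDifferentiableAt (𝓡 n) 𝓘(ℝ, F) f y) (v : Coord n) :
    mvfderiv (𝓡 n) f y (coordFrame e y v) = fderiv ℝ (f ∘ e.symm) (e y) v := by
  have chain_rule : mfderiv 𝓘(ℝ, Coord n) 𝓘(ℝ, F) (f ∘ e.symm) (e y)
      = (mfderiv (𝓡 n) 𝓘(ℝ, F) f (e.symm (e y))).comp
        (mfderiv 𝓘(ℝ, Coord n) (𝓡 n) e.symm (e y)) :=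
    mfderiv_comp (e y) (by rwa [e.left_inv hy])
      ((mdifferentiable_of_mem_maximalAtlas he).mdifferentiableAt_symm (e.map_source hy))
  rw [← mfderiv_eq_fderiv, chain_rule, e.left_inv hy]
  rfl

theorem mvfderiv_eq_fderiv_comp_symm {F : Type*} [NormedAddCommGroup F] [NormedSpace ℝ F]
    (he : e ∈ IsManifold.maximalAtlas (𝓡 n) ∞ M) {y : M} (hy : y ∈ e.source) {f : M → F}
    (hf : MDifferentiableAt (𝓡 n) 𝓘(ℝ, F) f y) (v : TangentSpace (𝓡 n) y) :
    mvfderiv (𝓡 n) f y v = fderiv ℝ (f ∘ e.symm) (e y) (mvfderiv (𝓡 n) e y v) := by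
  rw [← mvfderiv_coordFrame_apply he hy hf, coordFrame_mvfderiv he hy]

theorem mvfderiv_comp_chart {F : Type*} [NormedAddCommGroup F] [NormedSpace ℝ F]
    (he : e ∈ IsManifold.maximalAtlas (𝓡 n) ∞ M) {y : M} (hy : y ∈ e.source) {c : Coord n → F}
    (hc : DifferentiableAt ℝ c (e y)) (v : TangentSpace (𝓡 n) y) :
    mvfderiv (𝓡 n) (fun x => c (e x)) y v = fderiv ℝ c (e y) (mvfderiv (𝓡 n) e y v) := by
  have hcomp : MDifferentiableAt (𝓡 n) 𝓘(ℝ, F) (fun x => c (e x)) y :=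
    hc.mdifferentiableAt.comp y ((mdifferentiable_of_mem_maximalAtlas he).mdifferentiableAt hy)
  have heq : (fun x => c (e x)) ∘ e.symm =ᶠ[𝓝 (e y)] c := by
    filter_upwards [e.open_target.mem_nhds (e.map_source hy)] with z hz
    simp [e.right_inv hz]
  rw [mvfderiv_eq_fderiv_comp_symm he hy hcomp, heq.fderiv_eq]

theorem mpullback_symm_coordField (he : e ∈ IsManifold.maximalAtlas (𝓡 n) ∞ M) {z : Coord n}
    (hz : z ∈ e.target) (v : Coord n) :
    VectorField.mpullback 𝓘(ℝ, Coord n) (𝓡 n) e.symm (coordField e v) z = v := by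
  have hv : coordField e v (e.symm z) = mfderiv 𝓘(ℝ, Coord n) (𝓡 n) e.symm z v := by
    simp only [coordField]
    rw [e.right_inv hz]
  rw [VectorField.mpullback_apply, hv]
  exact (isInvertible_mfderiv_symm he hz).inverse_apply_self v

variable [IsManifold (𝓡 n) ∞ M]

theorem exists_smoothField_eventuallyEq [T2Space M] {U : Set M} (hU : IsOpen U) {y : M}
    (hy : y ∈ U) {X : VField n M} (hX : ContMDiffOn (𝓡 n) (𝓡 n).tangent ∞ (T% X) U) :
    ∃ Y : VField n M, SmoothField Y ∧ ∀ᶠ x in 𝓝 y, Y x = X x := by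
  obtain ⟨f, -, hf⟩ := (SmoothBumpFunction.nhds_basis_tsupport (I := 𝓡 n) y).mem_iff.1
    (hU.mem_nhds hy)
  refine ⟨(f : M → ℝ) • X, ContMDiffOn.smul_section_of_tsupport f.contMDiff.contMDiffOn hU hf hX,
    ?_⟩
  filter_upwards [f.eventuallyEq_one] with x hx
  simp [hx]

theorem connection_congr (D : Connection n M) {X Y : VField n M} {y : M}
    (hX : MDifferentiableAt (𝓡 n) (𝓡 n).tangent (T% X) y)
    (h : ∀ᶠ x in 𝓝 y, X x = Y x) : D X y = D Y y := by
  refine D.isCovariantDerivativeOnUniv.congr_of_eventuallyEq hX ?_ univ_mem h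
  refine hX.congr_of_eventuallyEq ?_
  filter_upwards [h] with x hx
  rw [hx]

theorem mdifferentiableAt_sum_smul {ι : Type*} (s : Finset ι) {f : ι → M → ℝ}
    {X : ι → VField n M} {y : M} (hf : ∀ i, MDifferentiableAt (𝓡 n) 𝓘(ℝ, ℝ) (f i) y)
    (hX : ∀ i, MDifferentiableAt (𝓡 n) (𝓡 n).tangent (T% (X i)) y) :
    MDifferentiableAt (𝓡 n) (𝓡 n).tangent (T% (∑ i ∈ s, f i • X i : VField n M)) y := by
  classical
  induction s using Finset.induction_on with
  | empty => exact mdifferentiableAt_zeroSection ..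
  | insert i s hi ih =>
    rw [Finset.sum_insert hi]
    exact mdifferentiableAt_add_section ((hf i).smul_section (hX i)) ih

theorem connection_sum_smul (D : Connection n M) {ι : Type*} (s : Finset ι) {f : ι → M → ℝ}
    {X : ι → VField n M} {y : M} (hf : ∀ i, MDifferentiableAt (𝓡 n) 𝓘(ℝ, ℝ) (f i) y)
    (hX : ∀ i, MDifferentiableAt (𝓡 n) (𝓡 n).tangent (T% (X i)) y) :
    D (∑ i ∈ s, f i • X i : VField n M) y
      = ∑ i ∈ s, (f i y • D (X i) y + (mvfderiv (𝓡 n) (f i) y).smulRight (X i y)) := by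
  classical
  induction s using Finset.induction_on with
  | empty => simp
  | insert i s hi ih =>
    rw [Finset.sum_insert hi, Finset.sum_insert hi, D.isCovariantDerivativeOnUniv.add
      ((hf i).smul_section (hX i)) (mdifferentiableAt_sum_smul s hf hX), ih,
      D.isCovariantDerivativeOnUniv.leibniz (hX i) (hf i)]

theorem SmoothField.connection {D : Connection n M}
    (hD : CovariantDerivative.ContMDiffCovariantDerivative D ∞) {X Y : VField n M}
    (hX : SmoothField X) (hY : SmoothField Y) : SmoothField fun y => D X y (Y y) := fun y =>
  ((hD.contMDiff.contMDiff (σ := X) (by simpa using hX.contMDiffOn)).contMDiffAt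
    univ_mem).clm_bundle_apply (hY y)

theorem SmoothField.inner (g : Metric n M) {X Y : VField n M} (hX : SmoothField X)
    (hY : SmoothField Y) : ContMDiff (𝓡 n) 𝓘(ℝ, ℝ) ∞ (fun x => g.inner x (X x) (Y x)) := fun y =>
  (Bundle.contMDiffAt_section (E := Bundle.Trivial M ℝ) y).1
    ((g.contMDiff y).clm_bundle_apply₂ (F₃ := ℝ) (E₃ := fun _ => ℝ) (hX y) (hY y))

theorem contMDiffOn_coordField (he : e ∈ IsManifold.maximalAtlas (𝓡 n) ∞ M) (v : Coord n) :
    ContMDiffOn (𝓡 n) (𝓡 n).tangent ∞ (T% (coordField e v)) e.source := by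
  have tangentMap_smooth : ContMDiffOn (𝓡 n).tangent (𝓡 n).tangent ∞
      (tangentMapWithin 𝓘(ℝ, Coord n) (𝓡 n) e.symm e.target)
      (TotalSpace.proj ⁻¹' e.target) :=
    (contMDiffOn_symm_of_mem_maximalAtlas he).contMDiffOn_tangentMapWithin (by simp)
      e.open_target.uniqueMDiffOn
  have const_smooth : ContMDiff 𝓘(ℝ, Coord n) (𝓡 n).tangent ∞
      (fun z => (⟨z, v⟩ : TangentBundle 𝓘(ℝ, Coord n) (Coord n))) :=
    contMDiff_vectorSpace_iff_contDiff.2 contDiff_const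
  refine (tangentMap_smooth.comp (const_smooth.comp_contMDiffOn
    (contMDiffOn_of_mem_maximalAtlas he)) fun y hy => e.map_source hy).congr fun y hy => ?_
  simp only [Function.comp, tangentMapWithin, mfderivWithin_of_isOpen e.open_target
    (e.map_source hy)]
  exact TotalSpace.ext (by simp [hy]) HEq.rfl

theorem mdifferentiableAt_coordField (he : e ∈ IsManifold.maximalAtlas (𝓡 n) ∞ M) {y : M}
    (hy : y ∈ e.source) (v : Coord n) :
    MDifferentiableAt (𝓡 n) (𝓡 n).tangent (T% (coordField e v)) y :=
  ((contMDiffOn_coordField he v).contMDiffAt (e.open_source.mem_nhds hy)).mdifferentiableAt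
    (by simp)

theorem exists_smoothField_eq_coordField [T2Space M]
    (he : e ∈ IsManifold.maximalAtlas (𝓡 n) ∞ M) {y : M} (hy : y ∈ e.source) (v : Coord n) :
    ∃ X : VField n M, SmoothField X ∧ ∀ᶠ x in 𝓝 y, X x = coordField e v x :=
  exists_smoothField_eventuallyEq e.open_source hy (contMDiffOn_coordField he v)

theorem contMDiffAt_mvfderiv_field (he : e ∈ IsManifold.maximalAtlas (𝓡 n) ∞ M) {y : M}
    (hy : y ∈ e.source) {X : VField n M}
    (hX : ContMDiffAt (𝓡 n) (𝓡 n).tangent ∞ (T% X) y) :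
    ContMDiffAt (𝓡 n) 𝓘(ℝ, Coord n) ∞ (fun x => mvfderiv (𝓡 n) e x (X x)) y := by
  have tangentMap_smooth : ContMDiffAt (𝓡 n).tangent (𝓡 n).tangent ∞
      (tangentMapWithin (𝓡 n) 𝓘(ℝ, Coord n) e e.source) (⟨y, X y⟩ : TangentBundle (𝓡 n) M) :=
    ((contMDiffOn_of_mem_maximalAtlas he).contMDiffOn_tangentMapWithin (by simp)
      e.open_source.uniqueMDiffOn).contMDiffAt ((e.open_source.preimage
        (FiberBundle.continuous_proj (Coord n) (TangentSpace (𝓡 n) : M → Type _))).mem_nhds hy)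
  refine ((contMDiff_snd_tangentBundle_modelSpace (Coord n) 𝓘(ℝ, Coord n)).contMDiffAt.comp
    y (tangentMap_smooth.comp y hX)).congr_of_eventuallyEq ?_
  filter_upwards [e.open_source.mem_nhds hy] with x hx
  simp only [Function.comp, tangentMapWithin, mfderivWithin_of_isOpen e.open_source hx]
  rfl

/-- The Christoffel symbols of a connection `D` in a chart `e`: `christoffel D e z u v` is the
coordinate expression of the derivative of the coordinate field of `v` in the direction `u`. -/
def christoffel (D : Connection n M) (e : OpenPartialHomeomorph M (Coord n)) (z : Coord n) :
    Coord n →L[ℝ] Coord n →L[ℝ] Coord n :=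
  (∑ j, (EuclideanSpace.proj j : Coord n →L[ℝ] ℝ).smulRight
    ((mvfderiv (𝓡 n) e (e.symm z)) ∘L (D (coordField e (stdVec j)) (e.symm z)) ∘L
      (coordFrame e (e.symm z)))).flip

theorem connection_coordFrame (D : Connection n M)
    (he : e ∈ IsManifold.maximalAtlas (𝓡 n) ∞ M) {y : M} (hy : y ∈ e.source)
    {c : Coord n → Coord n} (hc : DifferentiableAt ℝ c (e y)) (w : TangentSpace (𝓡 n) y) :
    D (fun x => coordFrame e x (c (e x))) y w
      = coordFrame e y (fderiv ℝ c (e y) (mvfderiv (𝓡 n) e y w)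
        + christoffel D e (e y) (mvfderiv (𝓡 n) e y w) (c (e y))) := by
  have expand : (fun x => coordFrame e x (c (e x)) : VField n M)
      = ∑ j, (fun x => c (e x) j) • coordField e (stdVec j) := by
    funext x
    conv_lhs => rw [← sum_smul_stdVec (c (e x))]
    simp [coordField_eq]
  have hcj (j : Fin n) : HasFDerivAt (fun z => c z j)
      ((EuclideanSpace.proj j : Coord n →L[ℝ] ℝ) ∘L fderiv ℝ c (e y)) (e y) :=
    (EuclideanSpace.proj j : Coord n →L[ℝ] ℝ).hasFDerivAt.comp _ hc.hasFDerivAt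
  have coeff_mdiff (j : Fin n) : MDifferentiableAt (𝓡 n) 𝓘(ℝ, ℝ) (fun x => c (e x) j) y :=
    (hcj j).differentiableAt.mdifferentiableAt.comp y
      ((mdifferentiable_of_mem_maximalAtlas he).mdifferentiableAt hy)
  have coeff_deriv (j : Fin n) : mvfderiv (𝓡 n) (fun x => c (e x) j) y w
      = (fderiv ℝ c (e y) (mvfderiv (𝓡 n) e y w)) j := by
    rw [mvfderiv_comp_chart he hy (hcj j).differentiableAt, (hcj j).fderiv]
    rfl
  have field_deriv (j : Fin n) : D (coordField e (stdVec j)) y w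
      = coordFrame e y (mvfderiv (𝓡 n) e y
        (D (coordField e (stdVec j)) y (coordFrame e y (mvfderiv (𝓡 n) e y w)))) := by
    rw [coordFrame_mvfderiv he hy, coordFrame_mvfderiv he hy]
  rw [expand, connection_sum_smul D Finset.univ coeff_mdiff
    fun j => mdifferentiableAt_coordField he hy _, map_add, sum_apply, christoffel, e.left_inv hy,
    ContinuousLinearMap.flip_apply]
  conv_rhs => rw [← sum_smul_stdVec (fderiv ℝ c (e y) (mvfderiv (𝓡 n) e y w))]
  simp only [add_apply, smul_apply, Finset.sum_add_distrib, sum_apply, map_sum,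
    map_smul, ContinuousLinearMap.smulRight_apply, coeff_deriv]
  rw [add_comm]
  congr 1
  refine Finset.sum_congr rfl fun j _ => ?_
  rw [field_deriv j]
  rfl

theorem connection_coordField (D : Connection n M)
    (he : e ∈ IsManifold.maximalAtlas (𝓡 n) ∞ M) {y : M} (hy : y ∈ e.source) (v : Coord n)
    (w : TangentSpace (𝓡 n) y) :
    D (coordField e v) y w
      = coordFrame e y (christoffel D e (e y) (mvfderiv (𝓡 n) e y w) v) := by
  have h := connection_coordFrame D he hy (c := fun _ => v) (by fun_prop) w
  simp only [fderiv_fun_const, Pi.zero_apply, zero_apply, zero_add] at h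
  exact h

theorem christoffel_apply (D : Connection n M) (he : e ∈ IsManifold.maximalAtlas (𝓡 n) ∞ M)
    {z : Coord n} (hz : z ∈ e.target) (u v : Coord n) :
    christoffel D e z u v
      = mvfderiv (𝓡 n) e (e.symm z)
        (D (coordField e v) (e.symm z) (coordField e u (e.symm z))) := by
  have hy := e.map_target hz
  rw [connection_coordField D he hy, mvfderiv_coordFrame he hy, coordField_eq,
    mvfderiv_coordFrame he hy, e.right_inv hz]

theorem contDiffOn_christoffel [T2Space M] {D : Connection n M}
    (hD : CovariantDerivative.ContMDiffCovariantDerivative D ∞)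
    (he : e ∈ IsManifold.maximalAtlas (𝓡 n) ∞ M) :
    ContDiffOn ℝ ∞ (christoffel D e) e.target := by
  refine contDiffOn_of_forall_stdVec fun i => contDiffOn_of_forall_stdVec fun j => ?_
  refine fun z hz => ContDiffAt.contDiffWithinAt ?_
  have hy := e.map_target hz
  obtain ⟨X, hX, hXe⟩ := exists_smoothField_eq_coordField he hy (stdVec j)
  obtain ⟨Y, hY, hYe⟩ := exists_smoothField_eq_coordField he hy (stdVec i)
  refine (contDiffAt_comp_symm he hz (contMDiffAt_mvfderiv_field he hy
    (hX.connection hD hY (e.symm z)))).congr_of_eventuallyEq ?_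
  have hc : ContinuousAt e.symm z := e.symm.continuousAt hz
  filter_upwards [e.open_target.mem_nhds hz, hc.eventually hXe.eventually_nhds,
    hc.eventually hYe] with w hw hXw hYw
  rw [christoffel_apply D he hw, Function.comp, hYw,
    connection_congr D (mdifferentiableAt_coordField he (e.map_target hw) _)
      (hXw.mono fun _ h => h.symm)]

theorem mlieBracket_const (u v z : Coord n) :
    VectorField.mlieBracket 𝓘(ℝ, Coord n) (fun _ => u : ∀ x, TangentSpace 𝓘(ℝ, Coord n) x)
      (fun _ => v) z = 0 := by
  let U : ∀ x : Coord n, TangentSpace 𝓘(ℝ, Coord n) x := fun _ => u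
  let V : ∀ x : Coord n, TangentSpace 𝓘(ℝ, Coord n) x := fun _ => v
  change VectorField.mlieBracket 𝓘(ℝ, Coord n) U V z = 0
  rw [← VectorField.mlieBracketWithin_univ, VectorField.mlieBracketWithin_eq_lieBracketWithin]
  change VectorField.lieBracketWithin ℝ (fun _ => u) (fun _ => v) univ z = 0
  simp [VectorField.lieBracketWithin]

theorem mlieBracket_coordField (he : e ∈ IsManifold.maximalAtlas (𝓡 n) ∞ M) {y : M}
    (hy : y ∈ e.source) (u v : Coord n) :
    VectorField.mlieBracket (𝓡 n) (coordField e u) (coordField e v) y = 0 := by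
  have hz := e.map_source hy
  have hpull (v : Coord n) : VectorField.mpullback 𝓘(ℝ, Coord n) (𝓡 n) e.symm (coordField e v)
      =ᶠ[𝓝 (e y)] fun _ => v :=
    eventually_of_mem (e.open_target.mem_nhds hz) fun z hz => mpullback_symm_coordField he hz v
  have two_le : minSmoothness ℝ 2 ≤ (∞ : ℕ∞ω) := by
    rw [minSmoothness_of_isRCLikeNormedField]
    exact WithTop.coe_le_coe.2 (le_top : (2 : ℕ∞) ≤ ⊤)
  have : IsManifold (𝓡 n) (minSmoothness ℝ 2) M := IsManifold.of_le (n := ∞) two_le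
  have hbracket := VectorField.mpullback_mlieBracket (x₀ := e y)
    (mdifferentiableAt_coordField he (e.map_target hz) u)
    (mdifferentiableAt_coordField he (e.map_target hz) v)
    (contMDiffAt_symm_of_mem_maximalAtlas he hz) two_le
  rw [Filter.EventuallyEq.mlieBracket_vectorField_eq (hpull u) (hpull v), mlieBracket_const,
    VectorField.mpullback_apply] at hbracket
  have h0 := (isInvertible_mfderiv_symm he hz).inverse.injective (hbracket.trans (map_zero _).symm)
  rwa [e.left_inv hy] at h0

theorem christoffel_symm {D : Connection n M} (hD : D.torsion = 0)
    (he : e ∈ IsManifold.maximalAtlas (𝓡 n) ∞ M) {z : Coord n} (hz : z ∈ e.target)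
    (u v : Coord n) : christoffel D e z u v = christoffel D e z v u := by
  have hy := e.map_target hz
  have htorsion := D.torsion_eq_zero_iff.1 hD (mdifferentiableAt_coordField he hy u)
    (mdifferentiableAt_coordField he hy v)
  rw [mlieBracket_coordField he hy, sub_eq_zero] at htorsion
  rw [christoffel_apply D he hz, christoffel_apply D he hz, htorsion]

theorem connection_connection_coordField [T2Space M] {D : Connection n M}
    (hD : CovariantDerivative.ContMDiffCovariantDerivative D ∞)
    (he : e ∈ IsManifold.maximalAtlas (𝓡 n) ∞ M) {z : Coord n} (hz : z ∈ e.target)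
    {Y Z : VField n M} {v w : Coord n} (hY : SmoothField Y)
    (hYe : ∀ᶠ x in 𝓝 (e.symm z), Y x = coordField e v x) (hZ : SmoothField Z)
    (hZe : ∀ᶠ x in 𝓝 (e.symm z), Z x = coordField e w x) (u : Coord n) :
    D (fun y => D Z y (Y y)) (e.symm z) (coordField e u (e.symm z))
      = coordFrame e (e.symm z) (fderiv ℝ (christoffel D e) z u v w
        + christoffel D e z u (christoffel D e z v w)) := by
  have hy := e.map_target hz
  have hez : e (e.symm z) = z := e.right_inv hz
  have hΓ : HasFDerivAt (fun z => christoffel D e z v w)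
      ((fderiv ℝ (christoffel D e) z).flip v |>.flip w) z :=
    hasFDerivAt_apply_apply (((contDiffOn_christoffel hD he).contDiffAt
      (e.open_target.mem_nhds hz)).differentiableAt (by simp)).hasFDerivAt v w
  have covariantDeriv_eq : ∀ᶠ x in 𝓝 (e.symm z),
      D Z x (Y x) = coordFrame e x (christoffel D e (e x) v w) := by
    filter_upwards [hYe, hZe.eventually_nhds, e.open_source.mem_nhds hy] with x hYx hZx hx
    rw [hYx, connection_congr D (hZ.mdifferentiableAt (by simp)) hZx,
      connection_coordField D he hx, coordField_eq, mvfderiv_coordFrame he hx]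
  rw [connection_congr D ((hZ.connection hD hY).mdifferentiableAt (by simp)) covariantDeriv_eq,
    connection_coordFrame D he hy (c := fun z => christoffel D e z v w)
      (by rw [hez]; exact hΓ.differentiableAt), coordField_eq, mvfderiv_coordFrame he hy, hez,
    hΓ.fderiv]
  rfl

theorem christoffel_curvature [T2Space M] {D : Connection n M} (hD : IsFlatTorsionFree D)
    (he : e ∈ IsManifold.maximalAtlas (𝓡 n) ∞ M) {z : Coord n} (hz : z ∈ e.target)
    (u v w : Coord n) :
    fderiv ℝ (christoffel D e) z u v w + christoffel D e z u (christoffel D e z v w)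
      = fderiv ℝ (christoffel D e) z v u w + christoffel D e z v (christoffel D e z u w) := by
  have hy := e.map_target hz
  obtain ⟨X, hX, hXe⟩ := exists_smoothField_eq_coordField he hy u
  obtain ⟨Y, hY, hYe⟩ := exists_smoothField_eq_coordField he hy v
  obtain ⟨Z, hZ, hZe⟩ := exists_smoothField_eq_coordField he hy w
  have hcurv := congrFun (hD.curvature_eq_zero X Y Z hX hY hZ) (e.symm z)
  rw [curvature, hXe.self_of_nhds, hYe.self_of_nhds,
    connection_connection_coordField hD.smooth he hz hY hYe hZ hZe,
    connection_connection_coordField hD.smooth he hz hX hXe hZ hZe,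
    Filter.EventuallyEq.mlieBracket_vectorField_eq hXe hYe, mlieBracket_coordField he hy,
    map_zero, sub_zero, Pi.zero_apply, sub_eq_zero] at hcurv
  have hcoord := congrArg (mvfderiv (𝓡 n) e (e.symm z)) hcurv
  rwa [mvfderiv_coordFrame he hy, mvfderiv_coordFrame he hy] at hcoord

/-- The metric in a chart: `coordMetric g e z u v = ∑ g_ij uⁱ vʲ` at the point with
coordinates `z`. -/
def coordMetric (g : Metric n M) (e : OpenPartialHomeomorph M (Coord n)) (z : Coord n) :
    Coord n →L[ℝ] Coord n →L[ℝ] ℝ :=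
  let B : Coord n →L[ℝ] Coord n →L[ℝ] ℝ := g.inner (e.symm z)
  let L : Coord n →L[ℝ] Coord n := coordFrame e (e.symm z)
  B.bilinearComp L L

theorem coordMetric_apply (g : Metric n M) (e : OpenPartialHomeomorph M (Coord n))
    (z u v : Coord n) : coordMetric g e z u v
      = g.inner (e.symm z) (coordField e u (e.symm z)) (coordField e v (e.symm z)) := rfl

theorem coordMetric_symm (g : Metric n M) (e : OpenPartialHomeomorph M (Coord n))
    (z u v : Coord n) : coordMetric g e z u v = coordMetric g e z v u := by
  rw [coordMetric_apply, coordMetric_apply, g.symm]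

theorem coordMetric_pos (g : Metric n M) (he : e ∈ IsManifold.maximalAtlas (𝓡 n) ∞ M)
    {z : Coord n} (hz : z ∈ e.target) {v : Coord n} (hv : v ≠ 0) : 0 < coordMetric g e z v v := by
  rw [coordMetric_apply]
  refine g.pos _ _ fun h => hv ?_
  rw [← mvfderiv_coordFrame he (e.map_target hz) v]
  exact (congrArg (mvfderiv (𝓡 n) e (e.symm z)) h).trans (map_zero _)

theorem inner_comp_symm_eventuallyEq (g : Metric n M) {z : Coord n} (hz : z ∈ e.target)
    {X Y : VField n M} {u v : Coord n} (hX : ∀ᶠ x in 𝓝 (e.symm z), X x = coordField e u x)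
    (hY : ∀ᶠ x in 𝓝 (e.symm z), Y x = coordField e v x) :
    (fun x => g.inner x (X x) (Y x)) ∘ e.symm =ᶠ[𝓝 z] fun z => coordMetric g e z u v := by
  have hc : ContinuousAt e.symm z := e.symm.continuousAt hz
  filter_upwards [hc.eventually hX, hc.eventually hY] with w hXw hYw
  rw [coordMetric_apply, Function.comp, hXw, hYw]

theorem contDiffOn_coordMetric [T2Space M] (g : Metric n M)
    (he : e ∈ IsManifold.maximalAtlas (𝓡 n) ∞ M) : ContDiffOn ℝ ∞ (coordMetric g e) e.target := by
  refine contDiffOn_of_forall_stdVec fun i => contDiffOn_of_forall_stdVec fun j => ?_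
  refine fun z hz => ContDiffAt.contDiffWithinAt ?_
  have hy := e.map_target hz
  obtain ⟨X, hX, hXe⟩ := exists_smoothField_eq_coordField he hy (stdVec i)
  obtain ⟨Y, hY, hYe⟩ := exists_smoothField_eq_coordField he hy (stdVec j)
  exact (contDiffAt_comp_symm he hz (hX.inner g hY _)).congr_of_eventuallyEq
    (inner_comp_symm_eventuallyEq g hz hXe hYe).symm

theorem fderiv_coordMetric [T2Space M] {g : Metric n M} {D Ds : Connection n M}
    (h : IsDuallyFlat g D Ds) (he : e ∈ IsManifold.maximalAtlas (𝓡 n) ∞ M) {z : Coord n}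
    (hz : z ∈ e.target) (u v w : Coord n) :
    fderiv ℝ (coordMetric g e) z u v w = coordMetric g e z (christoffel D e z u v) w
      + coordMetric g e z v (christoffel Ds e z u w) := by
  have hy := e.map_target hz
  have hez : e (e.symm z) = z := e.right_inv hz
  obtain ⟨X, hX, hXe⟩ := exists_smoothField_eq_coordField he hy v
  obtain ⟨Y, hY, hYe⟩ := exists_smoothField_eq_coordField he hy w
  have hG : HasFDerivAt (fun z => coordMetric g e z v w)
      ((fderiv ℝ (coordMetric g e) z).flip v |>.flip w) z :=
    hasFDerivAt_apply_apply (((contDiffOn_coordMetric g he).contDiffAt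
      (e.open_target.mem_nhds hz)).differentiableAt (by simp)).hasFDerivAt v w
  have hdual := h.dual X Y hX hY (e.symm z) (coordFrame e (e.symm z) u)
  rw [mvfderiv_coordFrame_apply he hy ((hX.inner g hY).mdifferentiableAt (by simp)), hez,
    (inner_comp_symm_eventuallyEq g hz hXe hYe).fderiv_eq, hG.fderiv,
    connection_congr D (hX.mdifferentiableAt (by simp)) hXe,
    connection_congr Ds (hY.mdifferentiableAt (by simp)) hYe, hXe.self_of_nhds, hYe.self_of_nhds,
    connection_coordField D he hy, connection_coordField Ds he hy,
    mvfderiv_coordFrame he hy, hez] at hdual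
  exact hdual

end Connection

/-! ### Affine coordinates of a flat connection -/

section FlatCoordinates

variable {E F : Type*} [NormedAddCommGroup E] [NormedSpace ℝ E]
  [NormedAddCommGroup F] [NormedSpace ℝ F]

theorem contDiffOn_infty_of_hasFDerivAt {f : E → F} {f' : E → E →L[ℝ] F} {s : Set E}
    (hs : IsOpen s) (hf : ∀ x ∈ s, HasFDerivAt f (f' x) x) (hf' : ContDiffOn ℝ ∞ f' s) :
    ContDiffOn ℝ ∞ f s :=
  (contDiffOn_infty_iff_fderiv_of_isOpen hs).2
    ⟨fun x hx => (hf x hx).differentiableAt.differentiableWithinAt,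
      hf'.congr fun x hx => (hf x hx).fderiv⟩

theorem exists_openPartialHomeomorph_of_contDiffOn [CompleteSpace E] {f : E → E} {U : Set E}
    (hU : IsOpen U) (hf : ContDiffOn ℝ ∞ f U) {x : E} (hx : x ∈ U)
    (hinv : (fderiv ℝ f x).IsInvertible) :
    ∃ h : OpenPartialHomeomorph E E, (h : E → E) = f ∧ x ∈ h.source ∧ h.source ⊆ U ∧
      ContDiffOn ℝ ∞ h.symm h.target ∧ ∀ z ∈ h.source, (fderiv ℝ f z).IsInvertible := by
  have smoothAt (z : E) (hz : z ∈ U) : ContDiffAt ℝ ∞ f z := hf.contDiffAt (hU.mem_nhds hz)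
  have hasFDerivAt (z : E) (hz : z ∈ U) : HasFDerivAt f (fderiv ℝ f z) z :=
    ((smoothAt z hz).differentiableAt (by simp)).hasFDerivAt
  obtain ⟨f', hf'⟩ := hinv
  have hx' : HasFDerivAt f (f' : E →L[ℝ] E) x := by rw [hf']; exact hasFDerivAt x hx
  let h₀ := (smoothAt x hx).toOpenPartialHomeomorph f hx' (by simp)
  have isOpen_invertible :
      IsOpen (U ∩ fderiv ℝ f ⁻¹' range ((↑) : (E ≃L[ℝ] E) → E →L[ℝ] E)) :=
    (hf.continuousOn_fderiv_of_isOpen hU (by simp)).isOpen_inter_preimage hU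
      ContinuousLinearEquiv.isOpen
  refine ⟨h₀.restrOpen _ isOpen_invertible, rfl,
    ⟨(smoothAt x hx).mem_toOpenPartialHomeomorph_source hx' (by simp), hx, f', hf'⟩,
    fun z hz => hz.2.1, fun z hz => ?_, fun z hz => hz.2.2⟩
  obtain ⟨hzU, f'', hf''⟩ := ((h₀.restrOpen _ isOpen_invertible).map_target hz).2
  refine (OpenPartialHomeomorph.contDiffAt_symm _ hz (f₀' := f'') ?_
    (smoothAt _ hzU)).contDiffWithinAt
  rw [hf'']
  exact hasFDerivAt _ hzU

theorem exists_dual_frame_of_flat [CompleteSpace F]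
    {Γ : E → E →L[ℝ] F →L[ℝ] F} {U : Set E} (hU : IsOpen U) (hΓ : ContDiffOn ℝ ∞ Γ U)
    (flat : ∀ z ∈ U, ∀ u v w,
      fderiv ℝ Γ z u v w + Γ z u (Γ z v w) = fderiv ℝ Γ z v u w + Γ z v (Γ z u w))
    {z₀ : E} (hz₀ : z₀ ∈ U) :
    ∃ r > 0, Metric.ball z₀ r ⊆ U ∧ ∃ α : E → F →L[ℝ] F, α z₀ = ContinuousLinearMap.id ℝ F ∧
      ContDiffOn ℝ ∞ α (Metric.ball z₀ r) ∧
      ∀ z ∈ Metric.ball z₀ r, ∀ u w, fderiv ℝ α z u w = α z (Γ z u w) := by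
  let compRight : (F →L[ℝ] F) →L[ℝ] (F →L[ℝ] F) →L[ℝ] F →L[ℝ] F :=
    (ContinuousLinearMap.compL ℝ F F F).flip
  let Φ : (E →L[ℝ] F →L[ℝ] F) →L[ℝ] E →L[ℝ] (F →L[ℝ] F) →L[ℝ] F →L[ℝ] F :=
    ContinuousLinearMap.compL ℝ E (F →L[ℝ] F) ((F →L[ℝ] F) →L[ℝ] F →L[ℝ] F) compRight
  have Φ_apply (A : E →L[ℝ] F →L[ℝ] F) (u : E) (p : F →L[ℝ] F) : Φ A u p = p ∘L A u := rfl
  have hB : ContDiffOn ℝ ∞ (fun z => Φ (Γ z)) U := Φ.contDiff.comp_contDiffOn hΓ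
  have frobenius : ∀ᶠ z in 𝓝 z₀, FrobeniusCondition (fun z => Φ (Γ z)) z := by
    filter_upwards [hU.mem_nhds hz₀] with z hz u v p
    have hΓz : HasFDerivAt Γ (fderiv ℝ Γ z) z :=
      ((hΓ.contDiffAt (hU.mem_nhds hz)).differentiableAt (by simp)).hasFDerivAt
    have hΦΓ : HasFDerivAt (fun z => Φ (Γ z)) (Φ ∘L fderiv ℝ Γ z) z :=
      Φ.hasFDerivAt.comp z hΓz
    rw [hΦΓ.fderiv]
    ext w
    simp only [ContinuousLinearMap.comp_apply, add_apply, Φ_apply, ← map_add, flat z hz]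
  obtain ⟨r, r_pos, hsol⟩ := exists_hasFDerivAt_of_frobeniusCondition
    ((hB.contDiffAt (hU.mem_nhds hz₀)).of_le (WithTop.coe_le_coe.2 le_top)) frobenius
  obtain ⟨α, hα₀, hα⟩ := hsol (ContinuousLinearMap.id ℝ F)
  obtain ⟨δ, δ_pos, hδ⟩ := Metric.isOpen_iff.1 hU z₀ hz₀
  have hball : Metric.ball z₀ (min r δ) ⊆ Metric.ball z₀ r :=
    Metric.ball_subset_ball (min_le_left _ _)
  have hballU : Metric.ball z₀ (min r δ) ⊆ U :=
    (Metric.ball_subset_ball (min_le_right _ _)).trans hδ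
  refine ⟨min r δ, lt_min r_pos δ_pos, hballU, α, hα₀, ?_, fun z hz u w => ?_⟩
  · exact contDiffOn_of_hasFDerivAt_flip Metric.isOpen_ball (hB.mono hballU)
      fun z hz => hα z (hball hz)
  · rw [(hα z (hball hz)).fderiv]
    rfl

theorem exists_flat_coordinates [CompleteSpace E] {Γ : E → E →L[ℝ] E →L[ℝ] E} {U : Set E}
    (hU : IsOpen U) (hΓ : ContDiffOn ℝ ∞ Γ U) (symm : ∀ z ∈ U, ∀ u v, Γ z u v = Γ z v u)
    (flat : ∀ z ∈ U, ∀ u v w,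
      fderiv ℝ Γ z u v w + Γ z u (Γ z v w) = fderiv ℝ Γ z v u w + Γ z v (Γ z u w))
    {z₀ : E} (hz₀ : z₀ ∈ U) :
    ∃ (h : OpenPartialHomeomorph E E) (α : E → E →L[ℝ] E), z₀ ∈ h.source ∧
      ContDiffOn ℝ ∞ h h.source ∧ ContDiffOn ℝ ∞ h.symm h.target ∧ ContDiffOn ℝ ∞ α h.source ∧
      ∀ z ∈ h.source, HasFDerivAt h (α z) z ∧ (α z).IsInvertible ∧
        ∀ u w, fderiv ℝ α z u w = α z (Γ z u w) := by
  obtain ⟨r, r_pos, hball, α, hα₀, hα, hαΓ⟩ := exists_dual_frame_of_flat hU hΓ flat hz₀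
  have closed : ∀ z ∈ Metric.ball z₀ r, ∀ u w, fderiv ℝ α z u w = fderiv ℝ α z w u :=
    fun z hz u w => by rw [hαΓ z hz, hαΓ z hz, symm z (hball hz)]
  obtain ⟨f, hf⟩ := (convex_ball z₀ r).exists_forall_hasFDerivAt_of_fderiv_symmetric
    Metric.isOpen_ball (hα.differentiableOn (by simp)) closed
  have f_smooth : ContDiffOn ℝ ∞ f (Metric.ball z₀ r) :=
    contDiffOn_infty_of_hasFDerivAt Metric.isOpen_ball hf hα
  have hz₀r := Metric.mem_ball_self (x := z₀) r_pos
  obtain ⟨h, rfl, hz, hsub, hsymm, hinv⟩ := exists_openPartialHomeomorph_of_contDiffOn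
    Metric.isOpen_ball f_smooth hz₀r
    (by rw [(hf z₀ hz₀r).fderiv, hα₀]; exact ⟨ContinuousLinearEquiv.refl ℝ E, rfl⟩)
  exact ⟨h, α, hz, f_smooth.mono hsub, hsymm, hα.mono hsub, fun z hz =>
    ⟨hf z (hsub hz), by simpa only [(hf z (hsub hz)).fderiv] using hinv z hz, hαΓ z (hsub hz)⟩⟩

theorem fderiv_inverse_apply_add_eq_zero [CompleteSpace F] {α : E → F →L[ℝ] F} {s : Set E}
    (hs : IsOpen s) (hα : ContDiffOn ℝ ∞ α s) (hinv : ∀ z ∈ s, (α z).IsInvertible)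
    {Γ : E →L[ℝ] F →L[ℝ] F} {z : E} (hz : z ∈ s)
    (hΓ : ∀ u w, fderiv ℝ α z u w = α z (Γ u w)) (v : F) :
    DifferentiableAt ℝ (fun z => (α z).inverse v) z ∧
      ∀ u, fderiv ℝ (fun z => (α z).inverse v) z u + Γ u ((α z).inverse v) = 0 := by
  have hαz : ContDiffAt ℝ ∞ α z := hα.contDiffAt (hs.mem_nhds hz)
  have hdiff : DifferentiableAt ℝ (fun z => (α z).inverse v) z :=
    ((((hinv z hz).contDiffAt_map_inverse (n := ∞)).comp z hαz).differentiableAt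
      (by simp)).clm_apply (differentiableAt_const v)
  refine ⟨hdiff, fun u => (hinv z hz).injective ?_⟩
  have hconst : (fun z => α z ((α z).inverse v)) =ᶠ[𝓝 z] fun _ => v :=
    eventually_of_mem (hs.mem_nhds hz) fun z hz => (hinv z hz).self_apply_inverse v
  have product_rule := (((hαz.differentiableAt (by simp)).hasFDerivAt.clm_apply
    hdiff.hasFDerivAt).congr_of_eventuallyEq hconst.symm).unique (hasFDerivAt_const v z)
  have hu := DFunLike.congr_fun product_rule u
  simp only [add_apply, ContinuousLinearMap.comp_apply, ContinuousLinearMap.flip_apply,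
    hΓ, zero_apply] at hu
  rw [map_add, hu, map_zero]

end FlatCoordinates

section AffineCoord

variable {n : ℕ} {M : Type*} [TopologicalSpace M] [ChartedSpace (Coord n) M]
  {e : OpenPartialHomeomorph M (Coord n)} {h : OpenPartialHomeomorph (Coord n) (Coord n)}

theorem trans_mem_maximalAtlas [IsManifold (𝓡 n) ∞ M]
    (he : e ∈ IsManifold.maximalAtlas (𝓡 n) ∞ M)
    (hh : ContDiffOn ℝ ∞ h h.source) (hs : ContDiffOn ℝ ∞ h.symm h.target) :
    e.trans h ∈ IsManifold.maximalAtlas (𝓡 n) ∞ M := by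
  rw [IsManifold.mem_maximalAtlas_iff_contMDiffOn]
  constructor
  · refine hh.contMDiffOn.comp ((contMDiffOn_of_mem_maximalAtlas he).mono fun y hy => ?_)
      fun y hy => ?_
    · exact (e.trans_source h ▸ hy).1
    · exact (e.trans_source h ▸ hy).2
  · refine (contMDiffOn_symm_of_mem_maximalAtlas he).comp (hs.contMDiffOn.mono fun z hz => ?_)
      fun z hz => ?_
    · exact (e.trans_target h ▸ hz).1
    · exact (e.trans_target h ▸ hz).2

theorem coordField_trans (he : e ∈ IsManifold.maximalAtlas (𝓡 n) ∞ M)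
    (hh : e.trans h ∈ IsManifold.maximalAtlas (𝓡 n) ∞ M) {y : M} (hy : y ∈ (e.trans h).source)
    {h' : Coord n →L[ℝ] Coord n} (hd : HasFDerivAt h h' (e y)) (hinv : h'.IsInvertible)
    (v : Coord n) : coordField (e.trans h) v y = coordFrame e y (h'.inverse v) := by
  have hye : y ∈ e.source := (e.trans_source h ▸ hy).1
  have hv := mvfderiv_comp_chart he hye hd.differentiableAt (coordField (e.trans h) v y)
  rw [hd.fderiv] at hv
  have hv' : h' (mvfderiv (𝓡 n) e y (coordField (e.trans h) v y)) = v :=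
    hv.symm.trans (mvfderiv_coordFrame hh hy v)
  have coords : h'.inverse v = mvfderiv (𝓡 n) e y (coordField (e.trans h) v y) := by
    rw [← congrArg h'.inverse hv', hinv.inverse_apply_self]
  rw [coords, coordFrame_mvfderiv he hye]

theorem exists_isAffineCoord [T2Space M] [IsManifold (𝓡 n) ∞ M] {D : Connection n M}
    (hD : IsFlatTorsionFree D) (x : M) :
    ∃ e : OpenPartialHomeomorph M (Coord n), x ∈ e.source ∧ IsAffineCoord D e := by
  let e₀ := chartAt (Coord n) x
  have he₀ : e₀ ∈ IsManifold.maximalAtlas (𝓡 n) ∞ M := IsManifold.chart_mem_maximalAtlas x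
  have hx : x ∈ e₀.source := mem_chart_source _ x
  obtain ⟨h, α, hz, h_smooth, hsymm, α_smooth, hα⟩ := exists_flat_coordinates e₀.open_target
    (contDiffOn_christoffel hD.smooth he₀)
    (fun z hz => christoffel_symm hD.torsion_eq_zero he₀ hz)
    (fun z hz => christoffel_curvature hD he₀ hz) (e₀.map_source hx)
  have he := trans_mem_maximalAtlas he₀ h_smooth hsymm
  have source_iff (y : M) : y ∈ (e₀.trans h).source ↔ y ∈ e₀.source ∧ e₀ y ∈ h.source := by
    simp
  refine ⟨e₀.trans h, (source_iff x).2 ⟨hx, hz⟩, he, fun v y hy => ?_⟩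
  obtain ⟨hy₀, hyh⟩ := (source_iff y).1 hy
  have field_eq : ∀ᶠ y in 𝓝 y,
      coordField (e₀.trans h) v y = coordFrame e₀ y ((α (e₀ y)).inverse v) := by
    filter_upwards [(e₀.trans h).open_source.mem_nhds hy] with y hy
    obtain ⟨hd, hinv, -⟩ := hα _ ((source_iff y).1 hy).2
    exact coordField_trans he₀ he hy hd hinv v
  obtain ⟨hdiff, parallel⟩ := fderiv_inverse_apply_add_eq_zero h.open_source α_smooth
    (fun z hz => (hα z hz).2.1) hyh (hα _ hyh).2.2 v
  ext w
  rw [connection_congr D (mdifferentiableAt_coordField he hy v) field_eq,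
    connection_coordFrame D he₀ hy₀ (c := fun z => (α z).inverse v) hdiff, parallel, map_zero]
  rfl

end AffineCoord

/-! ### Hessians and Legendre pairs -/

section Hessian

variable {E : Type*} [NormedAddCommGroup E] [NormedSpace ℝ E] {s : Set E} {f : E → ℝ}

theorem strictConvexOn_of_forall_lineMap (hs : Convex ℝ s)
    (h : ∀ x ∈ s, ∀ y ∈ s, x ≠ y →
      StrictConvexOn ℝ (Icc (0 : ℝ) 1) fun t => f (AffineMap.lineMap x y t)) :
    StrictConvexOn ℝ s f := by
  refine ⟨hs, fun x hx y hy hxy a b ha hb hab => ?_⟩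
  have hlt := (h x hx y hy hxy).2 (left_mem_Icc.2 zero_le_one) (right_mem_Icc.2 zero_le_one)
    zero_ne_one ha hb hab
  have point : AffineMap.lineMap x y (a • (0 : ℝ) + b • 1) = a • x + b • y := by
    rw [AffineMap.lineMap_apply_module, eq_sub_of_add_eq hab]
    simp
  simpa only [point, AffineMap.lineMap_apply_zero, AffineMap.lineMap_apply_one] using hlt

theorem strictConvexOn_of_hessian_pos {P : E → E →L[ℝ] ℝ} {G : E → E →L[ℝ] E →L[ℝ] ℝ}
    (hs : IsOpen s) (hc : Convex ℝ s) (hf : ∀ x ∈ s, HasFDerivAt f (P x) x)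
    (hP : ∀ x ∈ s, HasFDerivAt P (G x) x) (pos : ∀ x ∈ s, ∀ v, v ≠ 0 → 0 < G x v v) :
    StrictConvexOn ℝ s f := by
  refine strictConvexOn_of_forall_lineMap hc fun x hx y hy hxy => ?_
  let l : ℝ → E := AffineMap.lineMap x y
  have hl (t : ℝ) : HasDerivAt l (y - x) t := AffineMap.hasDerivAt_lineMap
  have l_mem (t : ℝ) (ht : t ∈ Icc (0 : ℝ) 1) : l t ∈ s := hc.lineMap_mem hx hy ht
  have hderiv (t : ℝ) (ht : l t ∈ s) : HasDerivAt (fun t => f (l t)) (P (l t) (y - x)) t :=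
    (hf _ ht).comp_hasDerivAt t (hl t)
  have hderiv₂ (t : ℝ) (ht : l t ∈ s) :
      HasDerivAt (fun t => P (l t) (y - x)) (G (l t) (y - x) (y - x)) t :=
    ((ContinuousLinearMap.apply ℝ ℝ (y - x)).hasFDerivAt.comp _ (hP _ ht)).comp_hasDerivAt t (hl t)
  refine strictConvexOn_of_deriv2_pos' (convex_Icc 0 1)
    (fun t ht => (hderiv t (l_mem t ht)).continuousAt.continuousWithinAt) fun t ht => ?_
  have deriv_eq : deriv (fun t => f (l t)) =ᶠ[𝓝 t] fun t => P (l t) (y - x) := by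
    filter_upwards [(hl t).continuousAt.eventually (hs.mem_nhds (l_mem t ht))] with t' ht'
      using (hderiv t' ht').deriv
  rw [Function.iterate_succ, Function.iterate_one, Function.comp_apply, deriv_eq.deriv_eq,
    (hderiv₂ t (l_mem t ht)).deriv]
  exact pos _ (l_mem t ht) _ (sub_ne_zero.2 hxy.symm)

theorem add_fderiv_le_of_convexOn (hf : ConvexOn ℝ s f) {x y : E} (hx : x ∈ s) (hy : y ∈ s)
    {f' : E →L[ℝ] ℝ} (hf' : HasFDerivAt f f' x) : f x + f' (y - x) ≤ f y := by
  have convex_line := hf.comp_affineMap (AffineMap.lineMap x y)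
  have hderiv : HasDerivAt (f ∘ AffineMap.lineMap x y) (f' (y - x)) (0 : ℝ) :=
    HasFDerivAt.comp_hasDerivAt 0 (by rwa [AffineMap.lineMap_apply_zero])
      AffineMap.hasDerivAt_lineMap
  have hslope := convex_line.le_slope_of_hasDerivAt (by simpa using hx) (by simpa using hy)
    one_pos hderiv
  simp only [slope_def_field, Function.comp_apply, AffineMap.lineMap_apply_zero,
    AffineMap.lineMap_apply_one, sub_zero, div_one] at hslope
  linarith

theorem add_fderiv_lt_of_strictConvexOn (hf : StrictConvexOn ℝ s f) {x y : E} (hx : x ∈ s)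
    (hy : y ∈ s) (hxy : x ≠ y) {f' : E →L[ℝ] ℝ} (hf' : HasFDerivAt f f' x) :
    f x + f' (y - x) < f y := by
  have midpoint_lt := hf.2 hx hy hxy one_half_pos one_half_pos (add_halves 1)
  have tangent_le := add_fderiv_le_of_convexOn hf.convexOn hx
    (hf.1 hx hy one_half_pos.le one_half_pos.le (add_halves 1)) hf'
  have half_way : (1 / 2 : ℝ) • x + (1 / 2 : ℝ) • y - x = (1 / 2 : ℝ) • (y - x) := by module
  rw [half_way, map_smul] at tangent_le
  simp only [smul_eq_mul] at midpoint_lt tangent_le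
  linarith

theorem eventually_nhds_forall_apply_apply_pos [FiniteDimensional ℝ E]
    {B₀ : E →L[ℝ] E →L[ℝ] ℝ} (pos : ∀ v, v ≠ 0 → 0 < B₀ v v) :
    ∀ᶠ B in 𝓝 B₀, ∀ v, v ≠ 0 → 0 < B v v := by
  have on_sphere : ∀ᶠ B in 𝓝 B₀, ∀ v ∈ Metric.sphere (0 : E) 1, 0 < B v v := by
    refine (isCompact_sphere 0 1).eventually_forall_of_forall_eventually fun v hv => ?_
    have hcont : Continuous fun p : (E →L[ℝ] E →L[ℝ] ℝ) × E => p.1 p.2 p.2 := by fun_prop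
    exact hcont.continuousAt.eventually (lt_mem_nhds (pos v (ne_zero_of_mem_unit_sphere ⟨v, hv⟩)))
  filter_upwards [on_sphere] with B hB v hv
  have normalized := hB (‖v‖⁻¹ • v) (by simp [norm_smul, hv])
  simp only [map_smul, smul_apply, smul_eq_mul] at normalized
  have : 0 < ‖v‖⁻¹ := by positivity
  exact pos_of_mul_pos_right (pos_of_mul_pos_right normalized this.le) this.le

theorem exists_strictConvexOn_ball [FiniteDimensional ℝ E] {x : E} (hf : ContDiffAt ℝ 2 f x)
    (pos : ∀ v, v ≠ 0 → 0 < fderiv ℝ (fderiv ℝ f) x v v) :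
    ∃ ε > 0, StrictConvexOn ℝ (Metric.ball x ε) f := by
  have smooth_near : ∀ᶠ y in 𝓝 x, ContDiffAt ℝ 2 f y := hf.eventually (by simp)
  have hdf (y : E) (hy : ContDiffAt ℝ 2 f y) : ContDiffAt ℝ 1 (fderiv ℝ f) y :=
    hy.fderiv_right (by norm_num [one_add_one_eq_two])
  have pos_near := ((hdf x hf).fderiv_right (m := 0) (by simp)).continuousAt.eventually
    (eventually_nhds_forall_apply_apply_pos pos)
  obtain ⟨ε, ε_pos, hε⟩ := Metric.eventually_nhds_iff_ball.1 (smooth_near.and pos_near)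
  exact ⟨ε, ε_pos, strictConvexOn_of_hessian_pos Metric.isOpen_ball (convex_ball _ _)
    (fun y hy => ((hε y hy).1.differentiableAt (by simp)).hasFDerivAt)
    (fun y hy => ((hdf y (hε y hy).1).differentiableAt (by simp)).hasFDerivAt)
    fun y hy => (hε y hy).2⟩

theorem exists_hasFDerivAt_of_codazzi {G : E → E →L[ℝ] E →L[ℝ] ℝ}
    (hs : Convex ℝ s) (hso : IsOpen s) (hG : DifferentiableOn ℝ G s)
    (symm : ∀ z ∈ s, ∀ u v, G z u v = G z v u)
    (codazzi : ∀ z ∈ s, ∀ u v w, fderiv ℝ G z u v w = fderiv ℝ G z v u w) :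
    ∃ (ψ : E → ℝ) (P : E → E →L[ℝ] ℝ),
      ∀ z ∈ s, HasFDerivAt ψ (P z) z ∧ HasFDerivAt P (G z) z := by
  obtain ⟨P, hP⟩ := hs.exists_forall_hasFDerivAt_of_fderiv_symmetric hso hG
    fun z hz u v => ContinuousLinearMap.ext (codazzi z hz u v)
  obtain ⟨ψ, hψ⟩ := hs.exists_forall_hasFDerivAt_of_fderiv_symmetric hso
    (fun z hz => (hP z hz).differentiableAt.differentiableWithinAt)
    fun z hz u v => by rw [(hP z hz).fderiv, symm z hz]
  exact ⟨ψ, P, fun z hz => ⟨hψ z hz, hP z hz⟩⟩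

end Hessian

section ConvexImage

variable {E F : Type*} [NormedAddCommGroup E] [NormedSpace ℝ E]
  [NormedAddCommGroup F] [InnerProductSpace ℝ F]

theorem fderiv_fderiv_sq_norm_sub_self {S : E → F} {w : E} (hS : ContDiffAt ℝ 2 S w) (u v : E) :
    fderiv ℝ (fderiv ℝ fun y => ‖S y - S w‖ ^ 2) w u v
      = 2 * inner ℝ (fderiv ℝ S w u) (fderiv ℝ S w v) := by
  let ip : F →L[ℝ] F →L[ℝ] ℝ := innerSL ℝ
  have ip_apply (a b : F) : ip a b = inner ℝ a b := rfl
  have hdS : HasFDerivAt S (fderiv ℝ S w) w := (hS.differentiableAt (by simp)).hasFDerivAt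
  have gradient_eq : (fderiv ℝ fun y => ‖S y - S w‖ ^ 2)
      =ᶠ[𝓝 w] fun y => (2 : ℝ) • ip (S y - S w) ∘L fderiv ℝ S y := by
    filter_upwards [hS.eventually (by simp)] with y hy
    rw [((hy.differentiableAt (by simp)).hasFDerivAt.sub_const (S w)).norm_sq.fderiv]
    ext v
    simp [ip_apply]
  have hdS₂ := ((hS.fderiv_right (m := 1)
    (by norm_num [one_add_one_eq_two])).differentiableAt (by simp)).hasFDerivAt
  have hderiv : HasFDerivAt (fun y => (2 : ℝ) • ip (S y - S w) ∘L fderiv ℝ S y) _ w :=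
    ((ip.hasFDerivAt.comp w (hdS.sub_const (S w))).clm_comp hdS₂).const_smul (2 : ℝ)
  rw [gradient_eq.fderiv_eq, hderiv.fderiv]
  simp [ip_apply]

theorem exists_strictConvexOn_sq_norm_sub [FiniteDimensional ℝ E] {S : E → F} {w : E}
    (hS : ContDiffAt ℝ 2 S w) (hinj : Function.Injective (fderiv ℝ S w)) :
    ∃ ε > 0, StrictConvexOn ℝ (Metric.ball w ε) fun y => ‖S y - S w‖ ^ 2 := by
  refine exists_strictConvexOn_ball ((hS.sub contDiffAt_const).norm_sq ℝ) fun v hv => ?_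
  rw [fderiv_fderiv_sq_norm_sub_self hS, real_inner_self_eq_norm_sq]
  have := norm_pos_iff.2 ((map_ne_zero_iff (fderiv ℝ S w) hinj).2 hv)
  positivity

theorem exists_strictConvex_image_closedBall [FiniteDimensional ℝ E]
    (h : OpenPartialHomeomorph F E) {z : F} (hz : z ∈ h.source)
    (hsymm : ContDiffAt ℝ 2 h.symm (h z)) (hinj : Function.Injective (fderiv ℝ h.symm (h z))) :
    ∃ ρ > 0, Metric.closedBall z ρ ⊆ h.source ∧ Convex ℝ (h '' Metric.ball z ρ) ∧
      StrictConvex ℝ (h '' Metric.closedBall z ρ) := by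
  obtain ⟨ε, ε_pos, hε⟩ := exists_strictConvexOn_sq_norm_sub hsymm hinj
  obtain ⟨δ, δ_pos, hδ⟩ := Metric.mem_nhds_iff.1 (h.open_target.mem_nhds (h.map_source hz))
  have hε := hε.subset (Metric.ball_subset_ball (min_le_left ε δ)) (convex_ball _ _)
  have ball_subset_target : Metric.ball (h z) (min ε δ) ⊆ h.target :=
    (Metric.ball_subset_ball (min_le_right _ _)).trans hδ
  rw [h.left_inv hz] at hε
  obtain ⟨ρ, ρ_pos, hρ⟩ := Metric.nhds_basis_closedBall.mem_iff.1 (Filter.inter_mem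
    (h.open_source.mem_nhds hz)
    ((h.continuousAt hz).preimage_mem_nhds (Metric.ball_mem_nhds _ (lt_min ε_pos δ_pos))))
  have combo_mem : (h '' Metric.closedBall z ρ).Pairwise fun x y => ∀ ⦃a b : ℝ⦄,
      0 < a → 0 < b → a + b = 1 → a • x + b • y ∈ h '' Metric.ball z ρ := by
    rintro _ ⟨x, hx, rfl⟩ _ ⟨y, hy, rfl⟩ hne a b ha hb hab
    have sq_le (x : F) (hx : x ∈ Metric.closedBall z ρ) : ‖h.symm (h x) - z‖ ^ 2 ≤ ρ ^ 2 := by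
      rw [h.left_inv (hρ hx).1]
      exact pow_le_pow_left₀ (norm_nonneg _) (mem_closedBall_iff_norm.1 hx) 2
    have hlt : ‖h.symm (a • h x + b • h y) - z‖ ^ 2 < ρ ^ 2 :=
      calc ‖h.symm (a • h x + b • h y) - z‖ ^ 2
          < a • ‖h.symm (h x) - z‖ ^ 2 + b • ‖h.symm (h y) - z‖ ^ 2 :=
            hε.2 (hρ hx).2 (hρ hy).2 hne ha hb hab
        _ ≤ a • ρ ^ 2 + b • ρ ^ 2 := add_le_add (smul_le_smul_of_nonneg_left (sq_le x hx) ha.le)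
            (smul_le_smul_of_nonneg_left (sq_le y hy) hb.le)
        _ = ρ ^ 2 := Convex.combo_self hab _
    exact ⟨_, mem_ball_iff_norm.2 (lt_of_pow_lt_pow_left₀ 2 ρ_pos.le hlt),
      h.right_inv (ball_subset_target (hε.1 (hρ hx).2 (hρ hy).2 ha.le hb.le hab))⟩
  have image_subset : h '' Metric.ball z ρ ⊆ h '' Metric.closedBall z ρ :=
    image_mono Metric.ball_subset_closedBall
  refine ⟨ρ, ρ_pos, fun x hx => (hρ hx).1, convex_iff_pairwise_pos.2 (combo_mem.mono image_subset),
    combo_mem.mono' fun x y hxy a b ha hb hab => ?_⟩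
  exact interior_maximal image_subset (h.isOpen_image_of_subset_source Metric.isOpen_ball
    fun x hx => (hρ (Metric.ball_subset_closedBall hx)).1) (hxy ha hb hab)

end ConvexImage

section Legendre

variable {E : Type*} [NormedAddCommGroup E] [InnerProductSpace ℝ E]

theorem fderiv_symm_fderiv_apply {h : OpenPartialHomeomorph E E} {z : E} (hz : z ∈ h.source)
    (hh : DifferentiableAt ℝ h z) (hs : DifferentiableAt ℝ h.symm (h z)) (v : E) :
    fderiv ℝ h.symm (h z) (fderiv ℝ h z v) = v := by
  have left_inverse :=
    (hasFDerivAt_id (𝕜 := ℝ) z).congr_of_eventuallyEq (h.eventually_left_inverse hz)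
  exact DFunLike.congr_fun ((hs.hasFDerivAt.comp z hh.hasFDerivAt).unique left_inverse) v

variable [CompleteSpace E]

/-- A smooth bounded potential `ψ` with gradient map `N` and positive definite Hessian, on a bounded
strictly convex domain `V`. Carrying `N` as a parameter, and not as `gradient ψ`, lets `N` be a
local diffeomorphism and its inverse in `LegendrePair`. -/
structure ConvexPotential (V : Set E) (ψ : E → ℝ) (N : E → E) : Prop where
  isOpen : IsOpen V
  bounded : Bornology.IsBounded V
  convex : Convex ℝ V
  strictConvex_closure : StrictConvex ℝ (closure V)
  smooth : ContDiffOn ℝ ∞ ψ V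
  smooth_gradient : ContDiffOn ℝ ∞ N V
  gradient : ∀ z ∈ V, HasGradientAt ψ (N z) z
  pos : ∀ z ∈ V, ∀ v, v ≠ 0 → 0 < inner ℝ (fderiv ℝ N z v) v
  bdd : ∃ C, ∀ z ∈ V, |ψ z| ≤ C

/-- Two convex potentials that are Legendre transforms of each other; their gradient maps are `h`
and `h.symm`. -/
structure LegendrePair (h : OpenPartialHomeomorph E E) (ψ ψs : E → ℝ) : Prop where
  left : ConvexPotential h.source ψ h
  right : ConvexPotential h.target ψs h.symm
  legendre : ∀ z ∈ h.source, ψ z + ψs (h z) = inner ℝ z (h z)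

namespace ConvexPotential

variable {V : Set E} {ψ : E → ℝ} {N : E → E}

theorem hasFDerivAt (H : ConvexPotential V ψ N) {z : E} (hz : z ∈ V) :
    HasFDerivAt ψ (innerSL ℝ (N z)) z :=
  hasGradientAt_iff_hasFDerivAt.1 (H.gradient z hz)

theorem hasFDerivAt_gradient (H : ConvexPotential V ψ N) {z : E} (hz : z ∈ V) :
    HasFDerivAt N (fderiv ℝ N z) z :=
  ((H.smooth_gradient.contDiffAt (H.isOpen.mem_nhds hz)).differentiableAt (by simp)).hasFDerivAt

theorem hasFDerivAt_innerSL (H : ConvexPotential V ψ N) {z : E} (hz : z ∈ V) :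
    HasFDerivAt (fun z => innerSL ℝ (N z))
      ((innerSL ℝ : E →L[ℝ] E →L[ℝ] ℝ) ∘L fderiv ℝ N z) z :=
  (innerSL ℝ : E →L[ℝ] E →L[ℝ] ℝ).hasFDerivAt.comp z (H.hasFDerivAt_gradient hz)

theorem fderiv_fderiv (H : ConvexPotential V ψ N) {z : E} (hz : z ∈ V) (u v : E) :
    fderiv ℝ (fderiv ℝ ψ) z u v = inner ℝ (fderiv ℝ N z u) v := by
  have fderiv_eq : fderiv ℝ ψ =ᶠ[𝓝 z] fun z => innerSL ℝ (N z) := by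
    filter_upwards [H.isOpen.mem_nhds hz] with y hy using (H.hasFDerivAt hy).fderiv
  rw [fderiv_eq.fderiv_eq, (H.hasFDerivAt_innerSL hz).fderiv]
  rfl

theorem inner_fderiv_symm (H : ConvexPotential V ψ N) {z : E} (hz : z ∈ V) (u v : E) :
    inner ℝ (fderiv ℝ N z u) v = inner ℝ (fderiv ℝ N z v) u := by
  rw [← H.fderiv_fderiv hz, ← H.fderiv_fderiv hz]
  exact ((H.smooth.contDiffAt (H.isOpen.mem_nhds hz)).isSymmSndFDerivAt (by
    rw [minSmoothness_of_isRCLikeNormedField]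
    exact WithTop.coe_le_coe.2 le_top)).eq u v

theorem strictConvexOn (H : ConvexPotential V ψ N) : StrictConvexOn ℝ V ψ :=
  strictConvexOn_of_hessian_pos H.isOpen H.convex (fun _ hz => H.hasFDerivAt hz)
    (fun _ hz => H.hasFDerivAt_innerSL hz) H.pos

theorem add_inner_lt (H : ConvexPotential V ψ N) {x y : E} (hx : x ∈ V) (hy : y ∈ V)
    (hxy : x ≠ y) : ψ x + inner ℝ (N x) (y - x) < ψ y :=
  add_fderiv_lt_of_strictConvexOn H.strictConvexOn hx hy hxy (H.hasFDerivAt hx)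

variable {h : OpenPartialHomeomorph E E}

theorem hasGradientAt_legendreTransform (H : ConvexPotential h.source ψ h)
    (hsymm : ContDiffOn ℝ ∞ h.symm h.target) {w : E} (hw : w ∈ h.target) :
    HasGradientAt (fun w => inner ℝ (h.symm w) w - ψ (h.symm w)) (h.symm w) w := by
  have hd : HasFDerivAt h.symm (fderiv ℝ h.symm w) w :=
    ((hsymm.contDiffAt (h.open_target.mem_nhds hw)).differentiableAt (by simp)).hasFDerivAt
  refine hasGradientAt_iff_hasFDerivAt.2 (((hd.inner ℝ (hasFDerivAt_id w)).sub
    ((H.hasFDerivAt (h.map_target hw)).comp w hd)).congr_fderiv ?_)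
  ext v
  simp [fderivInnerCLM_apply, h.right_inv hw, real_inner_comm]

theorem inner_fderiv_symm_pos (H : ConvexPotential h.source ψ h)
    (hsymm : ContDiffOn ℝ ∞ h.symm h.target) {w : E} (hw : w ∈ h.target) {v : E} (hv : v ≠ 0) :
    0 < inner ℝ (fderiv ℝ h.symm w v) v := by
  have hd := (hsymm.contDiffAt (h.open_target.mem_nhds hw)).differentiableAt (by simp)
  have right_inverse : fderiv ℝ h (h.symm w) (fderiv ℝ h.symm w v) = v :=
    fderiv_symm_fderiv_apply (h := h.symm) hw hd
      (H.hasFDerivAt_gradient (h.map_target hw)).differentiableAt v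
  have hne : fderiv ℝ h.symm w v ≠ 0 := fun h0 => hv (by rw [← right_inverse, h0, map_zero])
  simpa only [right_inverse, real_inner_comm] using H.pos _ (h.map_target hw) _ hne

theorem legendrePair (H : ConvexPotential h.source ψ h) (hsymm : ContDiffOn ℝ ∞ h.symm h.target)
    (bounded : Bornology.IsBounded h.target) (convex : Convex ℝ h.target)
    (strictConvex_closure : StrictConvex ℝ (closure h.target)) :
    LegendrePair h ψ fun w => inner ℝ (h.symm w) w - ψ (h.symm w) where
  left := H
  right :=
    { isOpen := h.open_target
      bounded := bounded
      convex := convex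
      strictConvex_closure := strictConvex_closure
      smooth := (hsymm.inner ℝ contDiffOn_id).sub (H.smooth.comp hsymm fun _ hw => h.map_target hw)
      smooth_gradient := hsymm
      gradient := fun _ hw => H.hasGradientAt_legendreTransform hsymm hw
      pos := fun _ hw _ hv => H.inner_fderiv_symm_pos hsymm hw hv
      bdd := by
        obtain ⟨C, hC⟩ := H.bdd
        obtain ⟨R, hR⟩ := H.bounded.exists_norm_le
        obtain ⟨R', hR'⟩ := bounded.exists_norm_le
        refine ⟨R * R' + C, fun w hw => ?_⟩
        have hz : h.symm w ∈ h.source := h.map_target hw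
        calc |inner ℝ (h.symm w) w - ψ (h.symm w)|
            ≤ |inner ℝ (h.symm w) w| + |ψ (h.symm w)| := abs_sub _ _
          _ ≤ ‖h.symm w‖ * ‖w‖ + C := add_le_add (abs_real_inner_le_norm _ _) (hC _ hz)
          _ ≤ R * R' + C := by
            gcongr
            exacts [(norm_nonneg _).trans (hR _ hz), hR _ hz, hR' w hw] }
  legendre := fun z hz => by rw [h.left_inv hz]; ring

end ConvexPotential

namespace LegendrePair

variable {h : OpenPartialHomeomorph E E} {ψ ψs : E → ℝ}

theorem symm (H : LegendrePair h ψ ψs) : LegendrePair h.symm ψs ψ where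
  left := H.right
  right := H.left
  legendre := fun w hw => by
    have := H.legendre _ (h.map_target hw)
    rw [h.right_inv hw] at this
    rw [real_inner_comm, ← this, add_comm]

theorem sub_pos_of_ne (H : LegendrePair h ψ ψs) {z z' : E} (hz : z ∈ h.source)
    (hz' : z' ∈ h.source) (hne : z ≠ z') : 0 < ψ z + ψs (h z') - inner ℝ z (h z') := by
  have legendre := H.legendre z' hz'
  have tangent_lt := H.left.add_inner_lt hz' hz hne.symm
  rw [inner_sub_right, real_inner_comm, real_inner_comm z'] at tangent_lt
  linarith

theorem inner_le (H : LegendrePair h ψ ψs) {z w : E} (hz : z ∈ h.source) (hw : w ∈ h.target) :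
    inner ℝ z w ≤ ψ z + ψs w := by
  have hw' := h.map_target hw
  rcases eq_or_ne z (h.symm w) with rfl | hne
  · simpa only [h.right_inv hw] using (H.legendre _ hw').ge
  · simpa only [h.right_inv hw, sub_nonneg] using (H.sub_pos_of_ne hz hw' hne).le

theorem fderiv_symm_fderiv (H : LegendrePair h ψ ψs) {z : E} (hz : z ∈ h.source) (v : E) :
    fderiv ℝ h.symm (h z) (fderiv ℝ h z v) = v :=
  fderiv_symm_fderiv_apply hz (H.left.hasFDerivAt_gradient hz).differentiableAt
    (H.right.hasFDerivAt_gradient (h.map_source hz)).differentiableAt v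

theorem fderiv_fderiv_symm (H : LegendrePair h ψ ψs) {z : E} (hz : z ∈ h.source) (v : E) :
    fderiv ℝ h z (fderiv ℝ h.symm (h z) v) = v := by
  have := H.symm.fderiv_symm_fderiv (h.map_source hz) v
  rwa [OpenPartialHomeomorph.symm_symm, h.left_inv hz] at this

end LegendrePair

variable [FiniteDimensional ℝ E]

omit [CompleteSpace E] in
theorem isInvertible_of_injective {A : E →L[ℝ] E} (hA : Function.Injective A) : A.IsInvertible :=
  ⟨(LinearEquiv.ofInjectiveEndo (A : E →ₗ[ℝ] E) hA).toContinuousLinearEquiv, by ext; rfl⟩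

theorem convexPotential_ball {U : Set E} {ψ : E → ℝ} {N : E → E} (hU : IsOpen U)
    (smooth : ContDiffOn ℝ ∞ N U) (gradient : ∀ z ∈ U, HasGradientAt ψ (N z) z)
    (pos : ∀ z ∈ U, ∀ v, v ≠ 0 → 0 < inner ℝ (fderiv ℝ N z v) v) {z : E} {ρ : ℝ} (ρ_pos : 0 < ρ)
    (hρ : Metric.closedBall z ρ ⊆ U) : ConvexPotential (Metric.ball z ρ) ψ N := by
  have hball : Metric.ball z ρ ⊆ U := Metric.ball_subset_closedBall.trans hρ
  have smooth_potential : ContDiffOn ℝ ∞ ψ U := contDiffOn_infty_of_hasFDerivAt hU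
    (fun z hz => hasGradientAt_iff_hasFDerivAt.1 (gradient z hz))
    ((innerSL ℝ : E →L[ℝ] E →L[ℝ] ℝ).contDiff.comp_contDiffOn smooth)
  exact
    { isOpen := Metric.isOpen_ball
      bounded := Metric.isBounded_ball
      convex := convex_ball z ρ
      strictConvex_closure := by
        rw [closure_ball z ρ_pos.ne']
        exact strictConvex_closedBall ℝ z ρ
      smooth := smooth_potential.mono hball
      smooth_gradient := smooth.mono hball
      gradient := fun z hz => gradient z (hball hz)
      pos := fun z hz => pos z (hball hz)
      bdd := by
        obtain ⟨C, hC⟩ := (isCompact_closedBall z ρ).exists_bound_of_continuousOn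
          (smooth_potential.continuousOn.mono hρ)
        exact ⟨C, fun z hz => hC z (Metric.ball_subset_closedBall hz)⟩ }

theorem exists_gradient_diffeomorph {G : E → E →L[ℝ] E →L[ℝ] ℝ} {U : Set E}
    (hU : IsOpen U) (hG : ContDiffOn ℝ ∞ G U) (symm : ∀ z ∈ U, ∀ u v, G z u v = G z v u)
    (codazzi : ∀ z ∈ U, ∀ u v w, fderiv ℝ G z u v w = fderiv ℝ G z v u w)
    (pos : ∀ z ∈ U, ∀ v, v ≠ 0 → 0 < G z v v) {z₀ : E} (hz₀ : z₀ ∈ U) :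
    ∃ (h : OpenPartialHomeomorph E E) (ψ : E → ℝ), z₀ ∈ h.source ∧ h.source ⊆ U ∧
      ContDiffOn ℝ ∞ h h.source ∧ ContDiffOn ℝ ∞ h.symm h.target ∧
      ∀ z ∈ h.source, HasGradientAt ψ (h z) z ∧ ∀ u v, inner ℝ (fderiv ℝ h z u) v = G z u v := by
  obtain ⟨r, r_pos, hr⟩ := Metric.isOpen_iff.1 hU z₀ hz₀
  have hz₀r : z₀ ∈ Metric.ball z₀ r := Metric.mem_ball_self r_pos
  obtain ⟨ψ, P, hψP⟩ := exists_hasFDerivAt_of_codazzi (convex_ball z₀ r) Metric.isOpen_ball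
    ((hG.mono hr).differentiableOn (by simp)) (fun z hz => symm z (hr hz))
    fun z hz => codazzi z (hr hz)
  let toDual : E ≃ₗᵢ[ℝ] StrongDual ℝ E := InnerProductSpace.toDual ℝ E
  let riesz : (E →L[ℝ] ℝ) →L[ℝ] E := toDual.symm.toContinuousLinearEquiv
  have inner_riesz (p : E →L[ℝ] ℝ) (v : E) : inner ℝ (riesz p) v = p v :=
    InnerProductSpace.toDual_symm_apply (𝕜 := ℝ)
  have hderiv (z : E) (hz : z ∈ Metric.ball z₀ r) :
      HasFDerivAt (fun z => riesz (P z)) (riesz ∘L G z) z :=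
    riesz.hasFDerivAt.comp z (hψP z hz).2
  have hess (z : E) (hz : z ∈ Metric.ball z₀ r) (u v : E) :
      inner ℝ (fderiv ℝ (fun z => riesz (P z)) z u) v = G z u v := by
    rw [(hderiv z hz).fderiv, ContinuousLinearMap.comp_apply, inner_riesz]
  have smooth : ContDiffOn ℝ ∞ (fun z => riesz (P z)) (Metric.ball z₀ r) :=
    riesz.contDiff.comp_contDiffOn (contDiffOn_infty_of_hasFDerivAt Metric.isOpen_ball
      (fun z hz => (hψP z hz).2) (hG.mono hr))
  have injective : Function.Injective (fderiv ℝ (fun z => riesz (P z)) z₀) := by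
    refine (injective_iff_map_eq_zero _).2 fun v hv => by_contra fun hne => ?_
    have := pos z₀ hz₀ v hne
    rw [← hess z₀ hz₀r, hv, inner_zero_left] at this
    exact this.false
  obtain ⟨h, h_eq, hz, hsub, hsymm, -⟩ := exists_openPartialHomeomorph_of_contDiffOn
    Metric.isOpen_ball smooth hz₀r (isInvertible_of_injective injective)
  refine ⟨h, ψ, hz, hsub.trans hr, h_eq ▸ smooth.mono hsub, hsymm, fun z hz => ⟨?_, ?_⟩⟩
  · rw [h_eq, hasGradientAt_iff_hasFDerivAt]
    refine (hψP z (hsub hz)).1.congr_fderiv ?_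
    ext v
    exact (inner_riesz _ v).symm
  · rw [h_eq]
    exact hess z (hsub hz)

theorem exists_legendrePair {G : E → E →L[ℝ] E →L[ℝ] ℝ} {U : Set E}
    (hU : IsOpen U) (hG : ContDiffOn ℝ ∞ G U) (symm : ∀ z ∈ U, ∀ u v, G z u v = G z v u)
    (codazzi : ∀ z ∈ U, ∀ u v w, fderiv ℝ G z u v w = fderiv ℝ G z v u w)
    (pos : ∀ z ∈ U, ∀ v, v ≠ 0 → 0 < G z v v) {z₀ : E} (hz₀ : z₀ ∈ U) :
    ∃ (h : OpenPartialHomeomorph E E) (ψ ψs : E → ℝ), LegendrePair h ψ ψs ∧ z₀ ∈ h.source ∧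
      h.source ⊆ U ∧ ∀ z ∈ h.source, ∀ u v, inner ℝ (fderiv ℝ h z u) v = G z u v := by
  obtain ⟨h, ψ, hz, hsub, smooth, hsymm, hψ⟩ :=
    exists_gradient_diffeomorph hU hG symm codazzi pos hz₀
  have hdiff : DifferentiableAt ℝ h.symm.symm (h.symm (h z₀)) := by
    rw [h.left_inv hz, h.symm_symm]
    exact (smooth.contDiffAt (h.open_source.mem_nhds hz)).differentiableAt (by simp)
  have hsymmAt := hsymm.contDiffAt (h.open_target.mem_nhds (h.map_source hz))
  have injective : Function.Injective (fderiv ℝ h.symm (h z₀)) :=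
    Function.LeftInverse.injective (fderiv_symm_fderiv_apply (h := h.symm) (h.map_source hz)
      (hsymmAt.differentiableAt (by simp)) hdiff)
  obtain ⟨ρ, ρ_pos, hρ, convex_image, strictConvex_image⟩ :=
    exists_strictConvex_image_closedBall h hz (hsymmAt.of_le (WithTop.coe_le_coe.2 le_top))
      injective
  let k := h.restrOpen (Metric.ball z₀ ρ) Metric.isOpen_ball
  have source_eq : k.source = Metric.ball z₀ ρ :=
    inter_eq_right.2 (Metric.ball_subset_closedBall.trans hρ)
  have target_eq : k.target = h '' Metric.ball z₀ ρ := by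
    rw [← k.image_source_eq_target, source_eq]
    rfl
  have closure_eq : h '' Metric.closedBall z₀ ρ = closure (h '' Metric.ball z₀ ρ) := by
    rw [← closure_ball z₀ ρ_pos.ne'] at hρ ⊢
    exact image_closure_of_isCompact
      (closure_ball z₀ ρ_pos.ne' ▸ isCompact_closedBall z₀ ρ) (h.continuousOn.mono hρ)
  have potential : ConvexPotential k.source ψ k := source_eq ▸ convexPotential_ball h.open_source
    smooth (fun z hz => (hψ z hz).1)
    (fun z hz v hv => (hψ z hz).2 v v ▸ pos z (hsub hz) v hv) ρ_pos hρ
  refine ⟨k, ψ, _, potential.legendrePair (hsymm.mono inter_subset_left) ?_ ?_ ?_,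
    source_eq ▸ Metric.mem_ball_self ρ_pos, inter_subset_left.trans hsub, fun z hz => (hψ z hz.1).2⟩
  · rw [target_eq]
    exact (((isCompact_closedBall z₀ ρ).image_of_continuousOn (h.continuousOn.mono hρ)).isBounded
      |>.subset (image_mono Metric.ball_subset_closedBall))
  · rwa [target_eq]
  · rwa [target_eq, ← closure_eq]

end Legendre

/-! ### Monge–Ampère equations and optimal transport -/

section PosDef

variable {n : ℕ}

theorem inner_stdVec (v : Coord n) (i : Fin n) : inner ℝ v (stdVec i) = v i := by
  simp [stdVec, EuclideanSpace.inner_single_right]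

theorem posDef_of_bilinear {A : Matrix (Fin n) (Fin n) ℝ} {B : Coord n →L[ℝ] Coord n →L[ℝ] ℝ}
    (hA : ∀ i j, A i j = B (stdVec i) (stdVec j)) (symm : ∀ u v, B u v = B v u)
    (pos : ∀ v, v ≠ 0 → 0 < B v v) : A.PosDef := by
  refine Matrix.PosDef.of_dotProduct_mulVec_pos ?_ fun x hx => ?_
  · ext i j
    simp [hA, symm (stdVec j)]
  · have pos_toLp := pos (WithLp.toLp 2 x) (by simpa using hx)
    rw [← sum_smul_stdVec (WithLp.toLp 2 x)] at pos_toLp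
    simp only [map_sum, map_smul, sum_apply, smul_apply, smul_eq_mul] at pos_toLp
    refine pos_toLp.trans_eq ?_
    simp only [dotProduct, Matrix.mulVec, hA, Finset.mul_sum, star_trivial]
    rw [Finset.sum_comm]
    exact Finset.sum_congr rfl fun i _ => Finset.sum_congr rfl fun j _ => by ring

end PosDef

namespace ConvexPotential

variable {n : ℕ} {V : Set (Coord n)} {ψ : Coord n → ℝ} {N : Coord n → Coord n}

theorem hessian_apply (H : ConvexPotential V ψ N) {z : Coord n} (hz : z ∈ V) (i j : Fin n) :
    hessian ψ z i j = inner ℝ (fderiv ℝ N z (stdVec i)) (stdVec j) :=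
  H.fderiv_fderiv hz _ _

theorem hessian_eq_toMatrix (H : ConvexPotential V ψ N) {z : Coord n} (hz : z ∈ V) :
    hessian ψ z = LinearMap.toMatrix (EuclideanSpace.basisFun (Fin n) ℝ).toBasis
      (EuclideanSpace.basisFun (Fin n) ℝ).toBasis (fderiv ℝ N z : Coord n →ₗ[ℝ] Coord n) := by
  ext i j
  rw [H.hessian_apply hz, H.inner_fderiv_symm hz, inner_stdVec, LinearMap.toMatrix_apply]
  simp [stdVec]

theorem mongeAmpere_eq_det (H : ConvexPotential V ψ N) {z : Coord n} (hz : z ∈ V) :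
    mongeAmpere ψ z = (fderiv ℝ N z).det := by
  rw [mongeAmpere, H.hessian_eq_toMatrix hz, LinearMap.det_toMatrix]

theorem mongeAmpere_pos (H : ConvexPotential V ψ N) {z : Coord n} (hz : z ∈ V) :
    0 < mongeAmpere ψ z :=
  (posDef_of_bilinear (B := (innerSL ℝ : Coord n →L[ℝ] Coord n →L[ℝ] ℝ) ∘L fderiv ℝ N z)
    (fun i j => H.hessian_apply hz i j) (fun u v => H.inner_fderiv_symm hz u v)
    (fun v hv => H.pos z hz v hv)).det_pos

theorem solvesMongeAmpere (H : ConvexPotential V ψ N) {f : Coord n → ℝ}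
    (hf : ∀ z ∈ V, mongeAmpere ψ z = f z) : SolvesMongeAmpere V ψ f where
  isOpen := H.isOpen
  bounded := H.bounded
  convex := H.convex
  strictConvex_closure := H.strictConvex_closure
  smooth := H.smooth
  strictConvexOn := H.strictConvexOn
  pos := fun z hz => hf z hz ▸ H.mongeAmpere_pos hz
  equation := hf

theorem integrable_sq_norm_sub (H : ConvexPotential V ψ N) {μ : Measure (Coord n)}
    [IsFiniteMeasure μ] (hμ : μ ≪ volume.restrict V) :
    Integrable (fun z => ‖z‖ ^ 2 - 2 * ψ z) μ := by
  obtain ⟨C, hC⟩ := H.bdd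
  obtain ⟨R, hR⟩ := H.bounded.exists_norm_le
  refine Integrable.of_bound (C := R ^ 2 + 2 * C) ((ContinuousOn.aestronglyMeasurable
    ((continuous_norm.pow 2).continuousOn.sub (continuousOn_const.mul H.smooth.continuousOn))
      H.isOpen.measurableSet).mono_ac hμ) ?_
  filter_upwards [hμ.ae_le (ae_restrict_mem H.isOpen.measurableSet)] with z hz
  have sq_norm_le : ‖z‖ ^ 2 ≤ R ^ 2 := pow_le_pow_left₀ (norm_nonneg _) (hR z hz) 2
  have potential_le := abs_le.1 (hC z hz)
  rw [Real.norm_eq_abs, abs_le]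
  constructor <;> nlinarith [sq_nonneg ‖z‖]

end ConvexPotential

section Kantorovich

theorem ofReal_integral_le_lintegral_ofReal {α : Type*} [MeasurableSpace α] {μ : Measure α}
    {f : α → ℝ} (hf : Integrable f μ) :
    ENNReal.ofReal (∫ x, f x ∂μ) ≤ ∫⁻ x, ENNReal.ofReal (f x) ∂μ := by
  rw [integral_eq_lintegral_pos_part_sub_lintegral_neg_part hf]
  exact ENNReal.ofReal_le_of_le_toReal (sub_le_self _ ENNReal.toReal_nonneg)

/-- Weak Kantorovich duality: the integral of `a z + b (S z)` depends on the marginals only, bounds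
the cost of `S` from below, and is the cost of `T`. -/
theorem isOptimalTransport_of_dual_potentials {n : ℕ} {μ ν : Measure (Coord n)}
    {T : Coord n → Coord n} {a b : Coord n → ℝ} {V W : Set (Coord n)} (hT : AEMeasurable T μ)
    (map_eq : μ.map T = ν) (hV : ∀ᵐ z ∂μ, z ∈ V) (hW : ∀ᵐ w ∂ν, w ∈ W) (ha : Integrable a μ)
    (hb : Integrable b ν) (add_le : ∀ z ∈ V, ∀ w ∈ W, a z + b w ≤ ‖z - w‖ ^ 2)
    (add_eq : ∀ᵐ z ∂μ, a z + b (T z) = ‖z - T z‖ ^ 2) : IsOptimalTransport μ ν T := by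
  have ofReal_sq_norm (v : Coord n) : ENNReal.ofReal (‖v‖ ^ 2) = ‖v‖ₑ ^ 2 := by
    rw [ENNReal.ofReal_pow (norm_nonneg _), ofReal_norm]
  have integrable_comp {S : Coord n → Coord n} (hS : AEMeasurable S μ) (hSν : μ.map S = ν) :
      Integrable (fun z => b (S z)) μ := by
    subst hSν
    exact hb.comp_aemeasurable hS
  have integral_add_comp {S : Coord n → Coord n} (hS : AEMeasurable S μ) (hSν : μ.map S = ν) :
      ∫ z, (a z + b (S z)) ∂μ = ∫ z, a z ∂μ + ∫ w, b w ∂ν := by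
    rw [integral_add ha (integrable_comp hS hSν), ← hSν,
      integral_map hS (hSν ▸ hb.aestronglyMeasurable)]
  refine ⟨hT, map_eq, fun S hS hSν => ?_⟩
  have hSW : ∀ᵐ z ∂μ, S z ∈ W := ae_of_ae_map hS (hSν ▸ hW)
  calc ∫⁻ z, ‖z - T z‖ₑ ^ 2 ∂μ
      = ∫⁻ z, ENNReal.ofReal (a z + b (T z)) ∂μ := by
        refine lintegral_congr_ae ?_
        filter_upwards [add_eq] with z hz
        rw [hz, ofReal_sq_norm]
    _ = ENNReal.ofReal (∫ z, (a z + b (T z)) ∂μ) := by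
        refine (ofReal_integral_eq_lintegral_ofReal (ha.add (integrable_comp hT map_eq)) ?_).symm
        filter_upwards [add_eq] with z hz
        exact hz.ge.trans' (sq_nonneg _)
    _ = ENNReal.ofReal (∫ z, (a z + b (S z)) ∂μ) := by
        rw [integral_add_comp hT map_eq, integral_add_comp hS hSν]
    _ ≤ ∫⁻ z, ENNReal.ofReal (a z + b (S z)) ∂μ :=
        ofReal_integral_le_lintegral_ofReal (ha.add (integrable_comp hS hSν))
    _ ≤ ∫⁻ z, ‖z - S z‖ₑ ^ 2 ∂μ := by
        refine lintegral_mono_ae ?_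
        filter_upwards [hV, hSW] with z hz hSz
        exact (ENNReal.ofReal_le_ofReal (add_le z hz _ hSz)).trans_eq (ofReal_sq_norm _)

/-- The measure `det Hess φ · dz` on `V`, the image of Lebesgue measure under the inverse of the
gradient map of a convex potential `φ` on `V`. -/
def mongeAmpereMeasure {n : ℕ} (V : Set (Coord n)) (φ : Coord n → ℝ) : Measure (Coord n) :=
  (volume.restrict V).withDensity fun z => ENNReal.ofReal (mongeAmpere φ z)

theorem mongeAmpereMeasure_absolutelyContinuous {n : ℕ} (V : Set (Coord n)) (φ : Coord n → ℝ) :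
    mongeAmpereMeasure V φ ≪ volume.restrict V :=
  withDensity_absolutelyContinuous _ _

theorem ae_mem_mongeAmpereMeasure {n : ℕ} {V : Set (Coord n)} (hV : MeasurableSet V)
    (φ : Coord n → ℝ) : ∀ᵐ z ∂mongeAmpereMeasure V φ, z ∈ V :=
  (mongeAmpereMeasure_absolutelyContinuous V φ).ae_le (ae_restrict_mem hV)

end Kantorovich

namespace LegendrePair

variable {n : ℕ} {h : OpenPartialHomeomorph (Coord n) (Coord n)} {ψ ψs : Coord n → ℝ}

theorem hessian_star_eq_inv (H : LegendrePair h ψ ψs) {z : Coord n} (hz : z ∈ h.source) :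
    hessian ψs (h z) = (hessian ψ z)⁻¹ := by
  refine (Matrix.inv_eq_left_inv ?_).symm
  rw [H.left.hessian_eq_toMatrix hz, H.right.hessian_eq_toMatrix (h.map_source hz),
    ← LinearMap.toMatrix_comp,
    ← LinearMap.toMatrix_id (EuclideanSpace.basisFun (Fin n) ℝ).toBasis]
  congr 1
  ext1 v
  exact H.fderiv_symm_fderiv hz v

theorem map_symm_mongeAmpereMeasure (H : LegendrePair h ψ ψs) :
    (mongeAmpereMeasure h.target ψs).map h.symm = volume.restrict h.source := by
  have change_of_variables := map_withDensity_abs_det_fderiv_eq_addHaar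
    (μ := (volume : Measure (Coord n))) (f := h.symm) (f' := fderiv ℝ h.symm)
    h.open_target.measurableSet.nullMeasurableSet
    (fun w hw => (H.right.hasFDerivAt_gradient hw).hasFDerivWithinAt) h.symm.injOn
  rw [h.symm_image_target_eq_source] at change_of_variables
  rw [← change_of_variables, mongeAmpereMeasure]
  congr 1
  refine withDensity_congr_ae ?_
  filter_upwards [ae_restrict_mem h.open_target.measurableSet] with w hw
  rw [← H.right.mongeAmpere_eq_det hw, abs_of_pos (H.right.mongeAmpere_pos hw)]

theorem map_restrict_source (H : LegendrePair h ψ ψs) :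
    (volume.restrict h.source).map h = mongeAmpereMeasure h.target ψs := by
  have hh : AEMeasurable h (volume.restrict h.source) :=
    h.continuousOn.aemeasurable h.open_source.measurableSet
  have hsymm : AEMeasurable h.symm (mongeAmpereMeasure h.target ψs) :=
    (h.continuousOn_symm.aemeasurable h.open_target.measurableSet).mono_ac
      (mongeAmpereMeasure_absolutelyContinuous _ _)
  rw [← H.map_symm_mongeAmpereMeasure] at hh ⊢
  rw [AEMeasurable.map_map_of_aemeasurable hh hsymm]
  conv_rhs => rw [← Measure.map_id (μ := mongeAmpereMeasure h.target ψs)]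
  refine Measure.map_congr ?_
  filter_upwards [ae_mem_mongeAmpereMeasure h.open_target.measurableSet ψs] with w hw
    using h.right_inv hw

theorem isOptimalTransport_gradient (H : LegendrePair h ψ ψs) :
    IsOptimalTransport (volume.restrict h.source) (mongeAmpereMeasure h.target ψs)
      (gradient ψ) := by
  have mem_source : ∀ᵐ z ∂volume.restrict h.source, z ∈ h.source :=
    ae_restrict_mem h.open_source.measurableSet
  have gradient_eq : gradient ψ =ᵐ[volume.restrict h.source] h := by
    filter_upwards [mem_source] with z hz using (H.left.gradient z hz).gradient
  have : IsFiniteMeasure (volume.restrict h.source) :=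
    isFiniteMeasure_restrict.2 H.left.bounded.measure_lt_top.ne
  have : IsFiniteMeasure (mongeAmpereMeasure h.target ψs) := by
    rw [← H.map_restrict_source]
    infer_instance
  refine isOptimalTransport_of_dual_potentials
    ((h.continuousOn.aemeasurable h.open_source.measurableSet).congr gradient_eq.symm)
    ((Measure.map_congr gradient_eq).trans H.map_restrict_source) mem_source
    (ae_mem_mongeAmpereMeasure h.open_target.measurableSet ψs)
    (H.left.integrable_sq_norm_sub Measure.AbsolutelyContinuous.rfl)
    (H.right.integrable_sq_norm_sub (mongeAmpereMeasure_absolutelyContinuous _ _))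
    (fun z hz w hw => ?_) ?_
  · linarith [norm_sub_sq_real z w, H.inner_le hz hw]
  · filter_upwards [mem_source, gradient_eq] with z hz hgrad
    rw [hgrad]
    linarith [norm_sub_sq_real z (h z), H.legendre z hz]

end LegendrePair

/-! ### Dual affine coordinates -/

section DualCoordinates

variable {n : ℕ} {M : Type*} [TopologicalSpace M] [ChartedSpace (Coord n) M]
  [IsManifold (𝓡 n) ∞ M]

theorem coordMetric_apply_self (g : Metric n M) {e : OpenPartialHomeomorph M (Coord n)} {y : M}
    (hy : y ∈ e.source) (u v : Coord n) :
    coordMetric g e (e y) u v = g.inner y (coordField e u y) (coordField e v y) := by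
  rw [coordMetric_apply, e.left_inv hy]

theorem differentiableAt_coordMetric [T2Space M] (g : Metric n M)
    {e : OpenPartialHomeomorph M (Coord n)} (he : e ∈ IsManifold.maximalAtlas (𝓡 n) ∞ M)
    {z : Coord n} (hz : z ∈ e.target) : DifferentiableAt ℝ (coordMetric g e) z :=
  ((contDiffOn_coordMetric g he).contDiffAt (e.open_target.mem_nhds hz)).differentiableAt (by simp)

theorem fderiv_coordMetric_symm [T2Space M] (g : Metric n M)
    {e : OpenPartialHomeomorph M (Coord n)} (he : e ∈ IsManifold.maximalAtlas (𝓡 n) ∞ M)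
    {z : Coord n} (hz : z ∈ e.target) (u v w : Coord n) :
    fderiv ℝ (coordMetric g e) z u v w = fderiv ℝ (coordMetric g e) z u w v := by
  have hd (v w : Coord n) :=
    hasFDerivAt_apply_apply (differentiableAt_coordMetric g he hz).hasFDerivAt v w
  have hwv := (hd w v).congr_of_eventuallyEq (f₁ := fun z => coordMetric g e z v w)
    (.of_forall fun z => coordMetric_symm g e z v w)
  exact DFunLike.congr_fun ((hd v w).unique hwv) u

namespace IsAffineCoord

variable {g : Metric n M} {D Ds : Connection n M} {e : OpenPartialHomeomorph M (Coord n)}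

theorem christoffel_eq_zero (he : IsAffineCoord D e) {z : Coord n} (hz : z ∈ e.target)
    (u v : Coord n) : christoffel D e z u v = 0 := by
  rw [christoffel_apply D he.mem_maximalAtlas hz, he.parallel v _ (e.map_target hz)]
  exact map_zero _

theorem fderiv_coordMetric [T2Space M] (he : IsAffineCoord D e) (h : IsDuallyFlat g D Ds)
    {z : Coord n} (hz : z ∈ e.target) (u v w : Coord n) :
    fderiv ℝ (coordMetric g e) z u v w = coordMetric g e z v (christoffel Ds e z u w) := by
  rw [DuallyFlat.fderiv_coordMetric h he.mem_maximalAtlas hz, he.christoffel_eq_zero hz, map_zero,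
    zero_apply, zero_add]

theorem codazzi [T2Space M] (he : IsAffineCoord D e) (h : IsDuallyFlat g D Ds)
    {z : Coord n} (hz : z ∈ e.target) (u v w : Coord n) :
    fderiv ℝ (coordMetric g e) z u v w = fderiv ℝ (coordMetric g e) z v u w := by
  have ha := he.mem_maximalAtlas
  rw [fderiv_coordMetric_symm g ha hz, he.fderiv_coordMetric h hz,
    christoffel_symm h.flat_star.torsion_eq_zero ha hz, ← he.fderiv_coordMetric h hz,
    fderiv_coordMetric_symm g ha hz]

/-- A field whose products with the `D`-parallel coordinate fields are constant is parallel for the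
dual connection. -/
theorem fderiv_add_christoffel_dual_eq_zero [T2Space M] (he : IsAffineCoord D e)
    (h : IsDuallyFlat g D Ds) {z : Coord n} (hz : z ∈ e.target) {c : Coord n → Coord n}
    (hc : DifferentiableAt ℝ c z)
    (hconst : ∀ a, fderiv ℝ (fun z => coordMetric g e z a (c z)) z = 0) (u : Coord n) :
    fderiv ℝ c z u + christoffel Ds e z u (c z) = 0 := by
  have ha := he.mem_maximalAtlas
  have orthogonal (a : Coord n) :
      coordMetric g e z a (fderiv ℝ c z u + christoffel Ds e z u (c z)) = 0 := by
    have product_rule := (((differentiableAt_coordMetric g ha hz).hasFDerivAt.clm_apply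
      (hasFDerivAt_const a z)).clm_apply hc.hasFDerivAt).fderiv
    have := DFunLike.congr_fun ((hconst a).symm.trans product_rule) u
    simp only [add_apply, ContinuousLinearMap.comp_apply, ContinuousLinearMap.flip_apply,
      zero_apply, map_zero, zero_add, he.fderiv_coordMetric h hz] at this
    rw [map_add, ← this]
  by_contra hne
  exact (coordMetric_pos g ha hz hne).ne' (orthogonal _)

end IsAffineCoord

/-- Affine coordinates `η` on which the metric is the Hessian of `ψ`, with the coordinates `ηs` and
the potential `ψs` given by the Legendre transform `h`. -/
structure IsLegendreChart (g : Metric n M) (D : Connection n M) (C : CoordPair n M)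
    (h : OpenPartialHomeomorph (Coord n) (Coord n)) : Prop where
  pair : LegendrePair h C.ψ C.ψs
  affine : IsAffineCoord D C.η
  target_eq : C.η.target = h.source
  star_eq : C.ηs = C.η.trans h
  metric_eq : ∀ z ∈ h.source, ∀ u v,
    inner ℝ (fderiv ℝ h z u) v = coordMetric g C.η z u v

theorem exists_isLegendreChart [T2Space M] {g : Metric n M} {D Ds : Connection n M}
    (hflat : IsDuallyFlat g D Ds) (x : M) :
    ∃ (C : CoordPair n M) (h : OpenPartialHomeomorph (Coord n) (Coord n)),
      x ∈ C.dom ∧ IsLegendreChart g D C h := by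
  obtain ⟨e, hx, he⟩ := exists_isAffineCoord hflat.flat x
  obtain ⟨h, ψ, ψs, H, hz, hsub, hG⟩ := exists_legendrePair e.open_target
    (contDiffOn_coordMetric g he.mem_maximalAtlas) (fun z _ => coordMetric_symm g e z)
    (fun z hz => he.codazzi hflat hz)
    (fun z hz v hv => coordMetric_pos g he.mem_maximalAtlas hz hv) (e.map_source hx)
  let i := OpenPartialHomeomorph.ofSet h.source h.open_source
  refine ⟨⟨e.trans i, (e.trans i).trans h, ψ, ψs⟩, h, ⟨hx, hz⟩, H,
    ⟨trans_mem_maximalAtlas he.mem_maximalAtlas contDiffOn_id contDiffOn_id,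
      fun v y hy => he.parallel v y hy.1⟩, ?_, rfl, hG⟩
  exact inter_eq_left.2 hsub

namespace IsLegendreChart

variable {g : Metric n M} {D : Connection n M} {C : CoordPair n M}
  {h : OpenPartialHomeomorph (Coord n) (Coord n)}

theorem map_mem (H : IsLegendreChart g D C h) {y : M} (hy : y ∈ C.dom) : C.η y ∈ h.source :=
  H.target_eq ▸ C.η.map_source hy

theorem star_apply (H : IsLegendreChart g D C h) (y : M) : C.ηs y = h (C.η y) := by
  rw [H.star_eq]
  rfl

theorem star_source (H : IsLegendreChart g D C h) : C.ηs.source = C.dom := by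
  rw [H.star_eq]
  exact inter_eq_left.2 fun y hy => H.map_mem hy

theorem star_target (H : IsLegendreChart g D C h) : C.ηs.target = h.target := by
  rw [H.star_eq]
  exact inter_eq_left.2 fun w hw => by
    rw [mem_preimage, H.target_eq]
    exact h.map_target hw

theorem star_mem_maximalAtlas (H : IsLegendreChart g D C h) :
    C.ηs ∈ IsManifold.maximalAtlas (𝓡 n) ∞ M := by
  rw [H.star_eq]
  exact trans_mem_maximalAtlas H.affine.mem_maximalAtlas H.pair.left.smooth_gradient
    H.pair.right.smooth_gradient

theorem mvfderiv_star (H : IsLegendreChart g D C h) {y : M} (hy : y ∈ C.dom)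
    (w : TangentSpace (𝓡 n) y) :
    mvfderiv (𝓡 n) C.ηs y w = fderiv ℝ h (C.η y) (mvfderiv (𝓡 n) C.η y w) := by
  rw [H.star_eq]
  exact mvfderiv_comp_chart H.affine.mem_maximalAtlas hy
    (H.pair.left.hasFDerivAt_gradient (H.map_mem hy)).differentiableAt w

theorem coordField_star (H : IsLegendreChart g D C h) {y : M} (hy : y ∈ C.dom) (v : Coord n) :
    coordField C.ηs v y = coordFrame C.η y (fderiv ℝ h.symm (h (C.η y)) v) := by
  have mvfderiv_eq : mvfderiv (𝓡 n) C.η y (coordField C.ηs v y)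
      = fderiv ℝ h.symm (h (C.η y)) v := by
    rw [← H.pair.fderiv_symm_fderiv (H.map_mem hy) (mvfderiv (𝓡 n) C.η y _), ← H.mvfderiv_star hy,
      coordField_eq, mvfderiv_coordFrame H.star_mem_maximalAtlas (H.star_source ▸ hy)]
  rw [← mvfderiv_eq, coordFrame_mvfderiv H.affine.mem_maximalAtlas hy]

theorem inner_coordFrame (H : IsLegendreChart g D C h) {y : M} (hy : y ∈ C.dom) (u v : Coord n) :
    g.inner y (coordFrame C.η y u) (coordFrame C.η y v) = inner ℝ (fderiv ℝ h (C.η y) u) v := by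
  rw [H.metric_eq _ (H.map_mem hy), coordMetric_apply_self g hy]
  rfl

theorem inner_eq (H : IsLegendreChart g D C h) {y : M} (hy : y ∈ C.dom)
    (v w : TangentSpace (𝓡 n) y) :
    g.inner y v w = inner ℝ (mvfderiv (𝓡 n) C.ηs y v) (mvfderiv (𝓡 n) C.η y w) := by
  rw [H.mvfderiv_star hy, ← H.inner_coordFrame hy,
    coordFrame_mvfderiv H.affine.mem_maximalAtlas hy,
    coordFrame_mvfderiv H.affine.mem_maximalAtlas hy]

theorem inner_coordField_star (H : IsLegendreChart g D C h) {y : M} (hy : y ∈ C.dom)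
    (u v : Coord n) :
    g.inner y (coordField C.η u y) (coordField C.ηs v y) = inner ℝ u v := by
  rw [H.coordField_star hy, coordField_eq, H.inner_coordFrame hy,
    H.pair.left.inner_fderiv_symm (H.map_mem hy), H.pair.fderiv_fderiv_symm (H.map_mem hy),
    real_inner_comm]

theorem hessian_eq_gram (H : IsLegendreChart g D C h) {y : M} (hy : y ∈ C.dom) :
    hessian C.ψ (C.η y) = gram g C.η y := by
  ext i j
  rw [H.pair.left.hessian_apply (H.map_mem hy), ← H.inner_coordFrame hy]
  rfl

theorem hessian_star_eq_gram (H : IsLegendreChart g D C h) {y : M} (hy : y ∈ C.dom) :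
    hessian C.ψs (C.ηs y) = gram g C.ηs y := by
  ext i j
  have hm := H.map_mem hy
  rw [gram, Matrix.of_apply, H.coordField_star hy, H.coordField_star hy, H.inner_coordFrame hy,
    H.pair.fderiv_fderiv_symm hm, H.star_apply, H.pair.right.hessian_apply (h.map_source hm),
    H.pair.right.inner_fderiv_symm (h.map_source hm), real_inner_comm]

theorem coordMetric_fderiv_symm (H : IsLegendreChart g D C h) {z : Coord n} (hz : z ∈ h.source)
    (a v : Coord n) : coordMetric g C.η z a (fderiv ℝ h.symm (h z) v) = inner ℝ v a := by
  rw [← H.metric_eq z hz, H.pair.left.inner_fderiv_symm hz, H.pair.fderiv_fderiv_symm hz]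

theorem affine_star [T2Space M] {Ds : Connection n M} (H : IsLegendreChart g D C h)
    (hflat : IsDuallyFlat g D Ds) : IsAffineCoord Ds C.ηs := by
  refine ⟨H.star_mem_maximalAtlas, fun v y hy => ?_⟩
  have hyη : y ∈ C.dom := H.star_source ▸ hy
  have hz := H.map_mem hyη
  let c : Coord n → Coord n := fun z => fderiv ℝ h.symm (h z) v
  have hc : DifferentiableAt ℝ c (C.η y) := by
    have hsymm := H.pair.right.smooth_gradient.fderiv_of_isOpen h.open_target (m := ∞) (by simp)
    exact (((hsymm.contDiffAt (h.open_target.mem_nhds (h.map_source hz))).differentiableAt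
      (by simp)).comp (C.η y) (H.pair.left.hasFDerivAt_gradient hz).differentiableAt).clm_apply
        (differentiableAt_const v)
  have field_eq : ∀ᶠ x in 𝓝 y, coordField C.ηs v x = coordFrame C.η x (c (C.η x)) := by
    filter_upwards [C.η.open_source.mem_nhds hyη] with x hx using H.coordField_star hx v
  have product_const (a : Coord n) :
      fderiv ℝ (fun z => coordMetric g C.η z a (c z)) (C.η y) = 0 := by
    have : (fun z => coordMetric g C.η z a (c z)) =ᶠ[𝓝 (C.η y)] fun _ => inner ℝ v a := by
      filter_upwards [h.open_source.mem_nhds hz] with z hz using H.coordMetric_fderiv_symm hz a v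
    rw [this.fderiv_eq, fderiv_fun_const, Pi.zero_apply]
  ext w
  rw [connection_congr Ds (mdifferentiableAt_coordField H.star_mem_maximalAtlas hy v) field_eq,
    connection_coordFrame Ds H.affine.mem_maximalAtlas hyη hc,
    H.affine.fderiv_add_christoffel_dual_eq_zero hflat (C.η.map_source hyη) hc product_const,
    map_zero, zero_apply]

theorem mongeAmpere_eq_det_gram (H : IsLegendreChart g D C h) {z : Coord n} (hz : z ∈ h.source) :
    mongeAmpere C.ψ z = (gram g C.η (C.η.symm z)).det := by
  have hz' : z ∈ C.η.target := H.target_eq ▸ hz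
  rw [mongeAmpere, ← H.hessian_eq_gram (C.η.map_target hz'), C.η.right_inv hz']

theorem mongeAmpere_star_eq_det_gram (H : IsLegendreChart g D C h) {w : Coord n}
    (hw : w ∈ h.target) : mongeAmpere C.ψs w = (gram g C.ηs (C.ηs.symm w)).det := by
  have hw' : w ∈ C.ηs.target := H.star_target ▸ hw
  rw [mongeAmpere, ← H.hessian_star_eq_gram (H.star_source ▸ C.ηs.map_target hw'),
    C.ηs.right_inv hw']

theorem isDualMongeAmperePair [T2Space M] {Ds : Connection n M} (H : IsLegendreChart g D C h)
    (hflat : IsDuallyFlat g D Ds) : IsDualMongeAmperePair g D Ds C where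
  source_eq := H.star_source
  affine := H.affine
  affine_star := H.affine_star hflat
  biorthogonal := fun y hy i j => by
    rw [H.inner_coordField_star hy, inner_stdVec]
    simp [stdVec, eq_comm]
  hessian_eq := fun y hy => H.hessian_eq_gram hy
  hessian_star_eq := fun y hy => by
    rw [H.star_apply, H.pair.hessian_star_eq_inv (H.map_mem hy), H.hessian_eq_gram hy]
  gradient_eq := fun y hy => by
    rw [H.star_apply]
    exact H.pair.left.gradient _ (H.map_mem hy)
  gradient_star_eq := fun y hy => by
    have hz := H.map_mem hy
    simpa only [h.left_inv hz, H.star_apply] using H.pair.right.gradient _ (h.map_source hz)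
  legendre := fun y hy => by
    rw [H.star_apply]
    exact H.pair.legendre _ (H.map_mem hy)
  solves := by
    rw [H.target_eq]
    exact H.pair.left.solvesMongeAmpere fun z hz => H.mongeAmpere_eq_det_gram hz
  solves_star := by
    rw [H.star_target]
    exact H.pair.right.solvesMongeAmpere fun w hw => H.mongeAmpere_star_eq_det_gram hw
  transport := by
    rw [H.target_eq, H.star_target]
    exact H.pair.isOptimalTransport_gradient
  transport_star := by
    rw [H.target_eq, H.star_target]
    exact H.pair.symm.isOptimalTransport_gradient

theorem divergence_pos (H : IsLegendreChart g D C h) {r q : M} (hr : r ∈ C.dom) (hq : q ∈ C.dom)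
    (hne : r ≠ q) : 0 < divergence C r q := by
  rw [divergence, H.star_apply]
  exact H.pair.sub_pos_of_ne (H.map_mem hr) (H.map_mem hq) fun heq => hne (C.η.injOn hr hq heq)

theorem divergence_self (H : IsLegendreChart g D C h) {r : M} (hr : r ∈ C.dom) :
    divergence C r r = 0 := by
  rw [divergence, H.star_apply, H.pair.legendre _ (H.map_mem hr), sub_self]

end IsLegendreChart

end DualCoordinates

/-! ### Optimal learning -/

theorem sq_norm_sub_le_integral_sq_norm_derivWithin {E : Type*} [NormedAddCommGroup E]
    [InnerProductSpace ℝ E] [CompleteSpace E] {u : ℝ → E} (hu : ContDiffOn ℝ 1 u (Icc 0 1)) :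
    ‖u 1 - u 0‖ ^ 2 ≤ ∫ t in (0 : ℝ)..1, ‖derivWithin u (Icc 0 1) t‖ ^ 2 := by
  set u' := derivWithin u (Icc 0 1)
  set d := u 1 - u 0
  have hu' : ContinuousOn u' (uIcc 0 1) := by
    rw [uIcc_of_le zero_le_one]
    exact hu.continuousOn_derivWithin (uniqueDiffOn_Icc one_pos) le_rfl
  have hinner : IntervalIntegrable (fun t => inner ℝ d (u' t)) volume 0 1 :=
    (continuousOn_const.inner hu').intervalIntegrable
  have integral_inner : ∫ t in (0 : ℝ)..1, inner ℝ d (u' t) = ‖d‖ ^ 2 := by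
    have integral_eq : ∫ t in (0 : ℝ)..1, u' t = d :=
      intervalIntegral.integral_derivWithin_Icc_of_contDiffOn_Icc hu zero_le_one
    rw [← real_inner_self_eq_norm_sq]
    exact ((innerSL ℝ d).intervalIntegral_comp_comm hu'.intervalIntegrable).trans
      (congrArg (inner ℝ d) integral_eq)
  calc ‖d‖ ^ 2 = ∫ t in (0 : ℝ)..1, (2 * inner ℝ d (u' t) - ‖d‖ ^ 2) := by
        rw [intervalIntegral.integral_sub (hinner.const_mul 2) intervalIntegrable_const,
          intervalIntegral.integral_const_mul, integral_inner, intervalIntegral.integral_const]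
        simp only [sub_zero, one_smul]
        ring
    _ ≤ ∫ t in (0 : ℝ)..1, ‖u' t‖ ^ 2 := by
        refine intervalIntegral.integral_mono_on zero_le_one
          ((hinner.const_mul 2).sub intervalIntegrable_const)
          (hu'.norm.pow 2).intervalIntegrable fun t _ => ?_
        linarith [norm_sub_sq_real d (u' t), sq_nonneg ‖d - u' t‖]

section CoordSegment

variable {n : ℕ} {M : Type*} [TopologicalSpace M] {e : OpenPartialHomeomorph M (Coord n)} {p q : M}

/-- The segment from `p` to `q` in the coordinates `e`. -/
def coordSegment (e : OpenPartialHomeomorph M (Coord n)) (p q : M) (t : ℝ) : M :=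
  e.symm (AffineMap.lineMap (e p) (e q) t)

theorem lineMap_mem_target (hconv : Convex ℝ e.target) (hp : p ∈ e.source) (hq : q ∈ e.source)
    {t : ℝ} (ht : t ∈ Icc (0 : ℝ) 1) : AffineMap.lineMap (e p) (e q) t ∈ e.target :=
  hconv.lineMap_mem (e.map_source hp) (e.map_source hq) ht

theorem eventually_lineMap_mem_target {t : ℝ} (ht : AffineMap.lineMap (e p) (e q) t ∈ e.target) :
    ∀ᶠ s in 𝓝 t, AffineMap.lineMap (e p) (e q) s ∈ e.target :=
  AffineMap.hasDerivAt_lineMap.continuousAt.eventually_mem (e.open_target.mem_nhds ht)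

theorem coordSegment_one (hq : q ∈ e.source) : coordSegment e p q 1 = q := by
  rw [coordSegment, AffineMap.lineMap_apply_one, e.left_inv hq]

theorem apply_coordSegment (hconv : Convex ℝ e.target) (hp : p ∈ e.source) (hq : q ∈ e.source)
    {t : ℝ} (ht : t ∈ Icc (0 : ℝ) 1) :
    e (coordSegment e p q t) = AffineMap.lineMap (e p) (e q) t :=
  e.right_inv (lineMap_mem_target hconv hp hq ht)

theorem derivWithin_apply_coordSegment (hconv : Convex ℝ e.target) (hp : p ∈ e.source)
    (hq : q ∈ e.source) {t : ℝ} (ht : t ∈ Icc (0 : ℝ) 1) :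
    derivWithin (fun s => e (coordSegment e p q s)) (Icc 0 1) t = e q - e p := by
  rw [derivWithin_congr (fun s hs => apply_coordSegment hconv hp hq hs)
    (apply_coordSegment hconv hp hq ht)]
  exact AffineMap.hasDerivWithinAt_lineMap.derivWithin (uniqueDiffOn_Icc one_pos t ht)

theorem flatEnergy_coordSegment (hconv : Convex ℝ e.target) (hp : p ∈ e.source)
    (hq : q ∈ e.source) : flatEnergy e (coordSegment e p q) = ‖e q - e p‖ ^ 2 := by
  have energy_density : EqOn
      (fun t => ‖derivWithin (fun s => e (coordSegment e p q s)) (Icc 0 1) t‖ ^ 2)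
      (fun _ => ‖e q - e p‖ ^ 2) (uIcc 0 1) := by
    intro t ht
    rw [uIcc_of_le zero_le_one] at ht
    simp only [derivWithin_apply_coordSegment hconv hp hq ht]
  rw [flatEnergy, intervalIntegral.integral_congr energy_density, intervalIntegral.integral_const,
    sub_zero, one_smul]

variable [ChartedSpace (Coord n) M]

theorem isCurve_coordSegment (he : e ∈ IsManifold.maximalAtlas (𝓡 n) ∞ M)
    (hconv : Convex ℝ e.target) (hp : p ∈ e.source) (hq : q ∈ e.source) :
    IsCurve (n := n) ∞ e.source p q (coordSegment e p q) where
  contMDiffOn := (contMDiffOn_symm_of_mem_maximalAtlas he).comp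
    (AffineMap.contDiff_lineMap (e p) (e q)).contMDiff.contMDiffOn
    fun _ ht => lineMap_mem_target hconv hp hq ht
  mapsTo := fun _ ht => e.map_target (lineMap_mem_target hconv hp hq ht)
  start := by rw [coordSegment, AffineMap.lineMap_apply_zero, e.left_inv hp]
  finish := coordSegment_one hq

namespace IsCurve

variable {k : ℕ∞ω} {γ : ℝ → M}

theorem contDiffOn_coord (hγ : IsCurve (n := n) k e.source p q γ)
    (he : e ∈ IsManifold.maximalAtlas (𝓡 n) ∞ M) (hk : k ≤ (∞ : ℕ∞ω)) :
    ContDiffOn ℝ k (fun t => e (γ t)) (Icc 0 1) :=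
  contMDiffOn_iff_contDiffOn.1
    (((contMDiffOn_of_mem_maximalAtlas he).of_le hk).comp hγ.contMDiffOn hγ.mapsTo)

theorem mvfderiv_velocity (hγ : IsCurve (n := n) k e.source p q γ)
    (he : e ∈ IsManifold.maximalAtlas (𝓡 n) ∞ M) (hk : k ≠ 0) {t : ℝ} (ht : t ∈ Icc (0 : ℝ) 1) :
    mvfderiv (𝓡 n) e (γ t) (velocity γ t) = derivWithin (fun s => e (γ s)) (Icc 0 1) t := by
  have chain_rule := mfderiv_comp_mfderivWithin t
    ((mdifferentiable_of_mem_maximalAtlas he).mdifferentiableAt (hγ.mapsTo ht))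
    ((hγ.contMDiffOn t ht).mdifferentiableWithinAt hk)
    (uniqueDiffOn_Icc one_pos t ht).uniqueMDiffWithinAt
  rw [mfderivWithin_eq_fderivWithin] at chain_rule
  exact (DFunLike.congr_fun chain_rule (1 : ℝ)).symm

theorem sq_norm_sub_le_flatEnergy (hγ : IsCurve (n := n) 1 e.source p q γ)
    (he : e ∈ IsManifold.maximalAtlas (𝓡 n) ∞ M) : ‖e q - e p‖ ^ 2 ≤ flatEnergy e γ := by
  have energy_le := sq_norm_sub_le_integral_sq_norm_derivWithin
    (hγ.contDiffOn_coord he (WithTop.coe_le_coe.2 (le_top : (1 : ℕ∞) ≤ ⊤)))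
  rwa [hγ.start, hγ.finish] at energy_le

end IsCurve

variable [IsManifold (𝓡 n) ∞ M]

theorem inner_le_inner_self (g : Metric n M) {y : M} {v w : TangentSpace (𝓡 n) y}
    (h : g.inner y v v ≤ g.inner y w w) : g.inner y v w ≤ g.inner y w w := by
  have inner_sub_self_nonneg : 0 ≤ g.inner y (v - w) (v - w) := by
    rcases eq_or_ne (v - w) 0 with h0 | h0
    · rw [h0, map_zero]
    · exact (g.pos _ _ h0).le
  rw [map_sub, map_sub, sub_apply, sub_apply, g.symm _ w v] at inner_sub_self_nonneg
  linarith

/-- The hypothesis says that `-grad L`, at `r`, is the vector that points to `q` in the coordinates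
`e`. -/
theorem isOptimalLearning_coordSegment (g : Metric n M)
    (he : e ∈ IsManifold.maximalAtlas (𝓡 n) ∞ M) (hconv : Convex ℝ e.target)
    (hp : p ∈ e.source) (hq : q ∈ e.source) {L : M → ℝ}
    (hL : ∀ r ∈ e.source, ∀ v w : TangentSpace (𝓡 n) r,
      mvfderiv (𝓡 n) e r w = e q - e r → mvfderiv (𝓡 n) L r v = -g.inner r v w) :
    IsOptimalLearning g e L p q (coordSegment e p q) := by
  set γ := coordSegment e p q
  have hγ : IsCurve (n := n) ∞ e.source p q γ := isCurve_coordSegment he hconv hp hq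
  have velocity_eq {t : ℝ} (ht : t ∈ Icc (0 : ℝ) 1) :
      mvfderiv (𝓡 n) e (γ t) (velocity (n := n) γ t) = e q - e p :=
    (hγ.mvfderiv_velocity he (by simp) ht).trans (derivWithin_apply_coordSegment hconv hp hq ht)
  have differential_eq {t : ℝ} (ht : t ∈ Icc (0 : ℝ) 1) (v : TangentSpace (𝓡 n) (γ t)) :
      mvfderiv (𝓡 n) L (γ t) v = -((1 - t) * g.inner (γ t) v (velocity (n := n) γ t)) := by
    rw [hL _ (hγ.mapsTo ht) v ((1 - t) • velocity γ t) ?_, map_smul, smul_eq_mul]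
    rw [map_smul, velocity_eq ht, apply_coordSegment hconv hp hq ht, AffineMap.lineMap_apply_module]
    module
  refine ⟨hγ, fun t ht v hv => ?_, fun hpq t ht => ?_, fun c hc => ?_⟩
  · rw [differential_eq (Ico_subset_Icc_self ht), differential_eq (Ico_subset_Icc_self ht)]
    exact neg_le_neg (mul_le_mul_of_nonneg_left (inner_le_inner_self g hv) (sub_nonneg.2 ht.2.le))
  · rw [differential_eq (Ico_subset_Icc_self ht), neg_lt_zero]
    refine mul_pos (sub_pos.2 ht.2) (g.pos (γ t) _ fun h0 => hpq ?_)
    have velocity_zero := velocity_eq (Ico_subset_Icc_self ht)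
    rw [h0, map_zero] at velocity_zero
    exact e.injOn hp hq (sub_eq_zero.1 velocity_zero.symm).symm
  · exact (flatEnergy_coordSegment hconv hp hq).trans_le (hc.sq_norm_sub_le_flatEnergy he)

end CoordSegment

namespace IsLegendreChart

variable {n : ℕ} {M : Type*} [TopologicalSpace M] [ChartedSpace (Coord n) M]
  [IsManifold (𝓡 n) ∞ M] {g : Metric n M} {D : Connection n M} {C : CoordPair n M}
  {h : OpenPartialHomeomorph (Coord n) (Coord n)} {p q : M}

theorem mvfderiv_divergence_right (H : IsLegendreChart g D C h) {r : M} (hr : r ∈ C.dom)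
    (v : TangentSpace (𝓡 n) r) :
    mvfderiv (𝓡 n) (fun s => divergence C q s) r v
      = -inner ℝ (mvfderiv (𝓡 n) C.ηs r v) (C.η q - C.η r) := by
  have hz := H.map_mem hr
  have hd : HasFDerivAt (fun w => C.ψ (C.η q) + C.ψs w - inner ℝ (C.η q) w)
      (innerSL ℝ (h.symm (C.ηs r)) - innerSL ℝ (C.η q)) (C.ηs r) := by
    rw [H.star_apply]
    exact ((H.pair.right.hasFDerivAt (h.map_source hz)).const_add _).sub
      (innerSL ℝ (C.η q)).hasFDerivAt
  refine (mvfderiv_comp_chart H.star_mem_maximalAtlas (H.star_source ▸ hr)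
    hd.differentiableAt v).trans ?_
  rw [hd.fderiv, sub_apply, innerSL_apply_apply, innerSL_apply_apply, H.star_apply r,
    h.left_inv hz, inner_sub_right, real_inner_comm, real_inner_comm (C.η q)]
  ring

theorem mvfderiv_divergence_left (H : IsLegendreChart g D C h) {r : M} (hr : r ∈ C.dom)
    (v : TangentSpace (𝓡 n) r) :
    mvfderiv (𝓡 n) (fun s => divergence C s q) r v
      = -inner ℝ (C.ηs q - C.ηs r) (mvfderiv (𝓡 n) C.η r v) := by
  have hd : HasFDerivAt (fun z => C.ψ z + C.ψs (C.ηs q) - inner ℝ z (C.ηs q))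
      (innerSL ℝ (h (C.η r)) - innerSL ℝ (C.ηs q)) (C.η r) := by
    simp only [real_inner_comm (C.ηs q)]
    exact ((H.pair.left.hasFDerivAt (H.map_mem hr)).add_const _).sub
      (innerSL ℝ (C.ηs q)).hasFDerivAt
  refine (mvfderiv_comp_chart H.affine.mem_maximalAtlas hr hd.differentiableAt v).trans ?_
  rw [hd.fderiv, sub_apply, innerSL_apply_apply, innerSL_apply_apply, inner_sub_left,
    H.star_apply r]
  ring

theorem isOptimalLearning (H : IsLegendreChart g D C h) (hp : p ∈ C.dom) (hq : q ∈ C.dom) :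
    IsOptimalLearning g C.η (fun r => divergence C q r) p q (coordSegment C.η p q) := by
  refine isOptimalLearning_coordSegment g H.affine.mem_maximalAtlas
    (H.target_eq ▸ H.pair.left.convex) hp hq fun r hr v w hw => ?_
  rw [H.mvfderiv_divergence_right hr, H.inner_eq hr, hw]

theorem isOptimalLearning_star (H : IsLegendreChart g D C h) (hp : p ∈ C.dom) (hq : q ∈ C.dom) :
    IsOptimalLearning g C.ηs (fun r => divergence C r q) p q (coordSegment C.ηs p q) := by
  refine isOptimalLearning_coordSegment g H.star_mem_maximalAtlas
    (H.star_target ▸ H.pair.right.convex) (H.star_source ▸ hp) (H.star_source ▸ hq)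
    fun r hr v w hw => ?_
  rw [H.star_source] at hr
  rw [H.mvfderiv_divergence_left hr, g.symm, H.inner_eq hr, hw]

end IsLegendreChart

/-! ### Exponential families and the Kullback divergence -/

section PartitionFunctionBound

variable {n : ℕ}

theorem norm_le_card_mul_of_abs_apply_le {y : Coord n} {c : ℝ} (hc : ∀ i, |y i| ≤ c) :
    ‖y‖ ≤ n * c := by
  calc ‖y‖ = ‖∑ i, y i • (stdVec i : Coord n)‖ := by rw [sum_smul_stdVec]
    _ ≤ ∑ i, ‖y i • (stdVec i : Coord n)‖ := norm_sum_le _ _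
    _ ≤ ∑ _i : Fin n, c := Finset.sum_le_sum fun i _ => by
        rw [norm_smul, stdVec, PiLp.norm_single, norm_one, mul_one]
        exact hc i
    _ = n * c := by simp

theorem mul_exp_self_le_exp_two_mul (x : ℝ) : x * Real.exp x ≤ Real.exp (2 * x) := by
  rw [two_mul, Real.exp_add]
  exact mul_le_mul_of_nonneg_right (by linarith [Real.add_one_le_exp x]) (Real.exp_pos x).le

theorem norm_mul_exp_norm_le {δ : ℝ} (hδ : 0 < δ) (y : Coord n) :
    ‖y‖ * Real.exp (δ / (2 * (n + 1)) * ‖y‖) ≤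
      2 * (n + 1) / δ * ∑ i, (Real.exp (δ * y i) + Real.exp (-(δ * y i))) := by
  rcases isEmpty_or_nonempty (Fin n) with hn | hn
  · have y_eq_zero : y = 0 := by ext i; exact isEmptyElim i
    simp [y_eq_zero]
  obtain ⟨i, hi⟩ := Finite.exists_max fun i => |y i|
  set ε := δ / (2 * (n + 1)) with hε
  have hε0 : 0 < ε := by positivity
  have norm_le : 2 * (ε * ‖y‖) ≤ |δ * y i| := by
    calc 2 * (ε * ‖y‖) ≤ 2 * (ε * ((n + 1) * |y i|)) := by
          have := norm_le_card_mul_of_abs_apply_le hi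
          gcongr
          linarith [abs_nonneg (y i)]
      _ = |δ * y i| := by
          rw [abs_mul, abs_of_pos hδ, hε]
          field_simp
  have inv_eq : 2 * ((n : ℝ) + 1) / δ = ε⁻¹ := by rw [hε, inv_div]
  rw [inv_eq, ← div_eq_inv_mul, le_div_iff₀ hε0]
  calc ‖y‖ * Real.exp (ε * ‖y‖) * ε = ε * ‖y‖ * Real.exp (ε * ‖y‖) := by ring
    _ ≤ Real.exp (2 * (ε * ‖y‖)) := mul_exp_self_le_exp_two_mul _
    _ ≤ Real.exp |δ * y i| := Real.exp_le_exp.2 norm_le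
    _ ≤ Real.exp (δ * y i) + Real.exp (-(δ * y i)) := Real.exp_abs_le _
    _ ≤ ∑ i, (Real.exp (δ * y i) + Real.exp (-(δ * y i))) :=
        Finset.single_le_sum (f := fun i => Real.exp (δ * y i) + Real.exp (-(δ * y i)))
          (fun j _ => by positivity) (Finset.mem_univ i)

theorem exp_inner_mul_norm_le {δ : ℝ} (hδ : 0 < δ) {s s₀ : Coord n}
    (hs : ‖s - s₀‖ ≤ δ / (2 * (n + 1))) (y : Coord n) :
    Real.exp (inner ℝ s y) * ‖y‖ ≤ 2 * (n + 1) / δ *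
      ∑ i, (Real.exp (inner ℝ (s₀ + δ • stdVec i) y)
        + Real.exp (inner ℝ (s₀ - δ • stdVec i) y)) := by
  set ε := δ / (2 * ((n : ℝ) + 1))
  have inner_le : inner ℝ s y ≤ inner ℝ s₀ y + ε * ‖y‖ := by
    rw [← sub_le_iff_le_add', ← inner_sub_left]
    exact (real_inner_le_norm _ _).trans (mul_le_mul_of_nonneg_right hs (norm_nonneg y))
  have inner_smul_stdVec (i : Fin n) : inner ℝ (δ • stdVec i) y = δ * y i := by
    rw [real_inner_smul_left, real_inner_comm, inner_stdVec]
  calc Real.exp (inner ℝ s y) * ‖y‖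
      ≤ Real.exp (inner ℝ s₀ y + ε * ‖y‖) * ‖y‖ := by gcongr
    _ = Real.exp (inner ℝ s₀ y) * (‖y‖ * Real.exp (ε * ‖y‖)) := by
        rw [Real.exp_add]
        ring
    _ ≤ Real.exp (inner ℝ s₀ y) * (2 * (n + 1) / δ *
          ∑ i, (Real.exp (δ * y i) + Real.exp (-(δ * y i)))) :=
        mul_le_mul_of_nonneg_left (norm_mul_exp_norm_le hδ y) (Real.exp_pos _).le
    _ = _ := by
        rw [mul_left_comm, Finset.mul_sum]
        simp only [mul_add (Real.exp _), ← Real.exp_add, ← sub_eq_add_neg, inner_add_left,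
          inner_sub_left, inner_smul_stdVec]

end PartitionFunctionBound

section ExponentialMeasure

variable {n : ℕ} {Ω : Type*} [MeasurableSpace Ω] {ν : Measure Ω} {T : Ω → Coord n}

theorem measurable_inner_statistic (hT : Measurable T) (s : Coord n) :
    Measurable fun z => (inner ℝ s (T z) : ℝ) :=
  (measurable_const (a := s)).inner hT

theorem measurable_exp_inner_sub (hT : Measurable T) (s : Coord n) (α : ℝ) :
    Measurable fun z => Real.exp (inner ℝ s (T z) - α) :=
  ((measurable_inner_statistic hT s).sub_const α).exp

theorem lintegral_exp_inner_sub_eq_one {s : Coord n} {α : ℝ}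
    (hP : IsProbabilityMeasure (expMeasure ν T s α)) :
    ∫⁻ z, ENNReal.ofReal (Real.exp (inner ℝ s (T z) - α)) ∂ν = 1 := by
  have total_mass := hP.measure_univ
  rwa [expMeasure, withDensity_apply _ MeasurableSet.univ, Measure.restrict_univ] at total_mass

theorem exp_inner_eq_mul_exp_inner_sub (s : Coord n) (α : ℝ) (y : Coord n) :
    Real.exp (inner ℝ s y) = Real.exp α * Real.exp (inner ℝ s y - α) := by
  rw [← Real.exp_add, add_sub_cancel]

theorem integrable_exp_inner (hT : Measurable T) {s : Coord n} {α : ℝ}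
    (hP : IsProbabilityMeasure (expMeasure ν T s α)) :
    Integrable (fun z => Real.exp (inner ℝ s (T z))) ν := by
  simp only [exp_inner_eq_mul_exp_inner_sub s α]
  refine Integrable.const_mul ⟨(measurable_exp_inner_sub hT s α).aestronglyMeasurable, ?_⟩ _
  rw [hasFiniteIntegral_iff_ofReal (ae_of_all _ fun z => (Real.exp_pos _).le),
    lintegral_exp_inner_sub_eq_one hP]
  exact ENNReal.one_lt_top

theorem integral_exp_inner (hT : Measurable T) {s : Coord n} {α : ℝ}
    (hP : IsProbabilityMeasure (expMeasure ν T s α)) :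
    ∫ z, Real.exp (inner ℝ s (T z)) ∂ν = Real.exp α := by
  simp only [exp_inner_eq_mul_exp_inner_sub s α]
  rw [integral_const_mul, integral_eq_lintegral_of_nonneg_ae
    (ae_of_all _ fun z => (Real.exp_pos _).le)
    (measurable_exp_inner_sub hT s α).aestronglyMeasurable, lintegral_exp_inner_sub_eq_one hP,
    ENNReal.toReal_one, mul_one]

theorem expMeasure_expMeasure (hT : Measurable T) (s u : Coord n) (α β : ℝ) :
    expMeasure (expMeasure ν T s α) T u β = expMeasure ν T (s + u) (α + β) := by
  have measurable_density (s : Coord n) (α : ℝ) :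
      Measurable fun z => ENNReal.ofReal (Real.exp (inner ℝ s (T z) - α)) :=
    (measurable_exp_inner_sub hT s α).ennreal_ofReal
  rw [expMeasure, expMeasure, expMeasure,
    ← withDensity_mul _ (measurable_density s α) (measurable_density u β)]
  congr 1
  funext z
  rw [Pi.mul_apply, ← ENNReal.ofReal_mul (Real.exp_pos _).le, ← Real.exp_add, inner_add_left]
  ring_nf

theorem expMeasure_eq_tilted (hT : Measurable T) {u : Coord n} {β : ℝ}
    (hP : IsProbabilityMeasure (expMeasure ν T u β)) :
    expMeasure ν T u β = ν.tilted fun z => inner ℝ u (T z) := by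
  rw [expMeasure, Measure.tilted, integral_exp_inner hT hP]
  simp only [Real.exp_sub]

theorem expMeasure_smul_eq_tilted_mul (hT : Measurable T) {u : Coord n} {t β : ℝ}
    (hP : IsProbabilityMeasure (expMeasure ν T (t • u) β)) :
    expMeasure ν T (t • u) β = ν.tilted fun z => t * inner ℝ u (T z) := by
  simp only [expMeasure_eq_tilted hT hP, real_inner_smul_left]

theorem mem_integrableExpSet_inner (hT : Measurable T) {u : Coord n} {t β : ℝ}
    (hP : IsProbabilityMeasure (expMeasure ν T (t • u) β)) :
    t ∈ ProbabilityTheory.integrableExpSet (fun z => inner ℝ u (T z)) ν := by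
  have integrable_exp := integrable_exp_inner hT hP
  simp only [real_inner_smul_left] at integrable_exp
  exact integrable_exp

theorem cgf_inner_eq (hT : Measurable T) {u : Coord n} {t β : ℝ}
    (hP : IsProbabilityMeasure (expMeasure ν T (t • u) β)) :
    ProbabilityTheory.cgf (fun z => inner ℝ u (T z)) ν t = β := by
  have integral_exp := integral_exp_inner hT hP
  simp only [real_inner_smul_left] at integral_exp
  rw [ProbabilityTheory.cgf, ProbabilityTheory.mgf, integral_exp, Real.log_exp]

theorem klDiv_expMeasure [IsProbabilityMeasure ν] (hT : Measurable T) {u : Coord n} {β : ℝ}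
    (hP : IsProbabilityMeasure (expMeasure ν T u β))
    (hi : Integrable (fun z => (inner ℝ u (T z) : ℝ)) ν) :
    InformationTheory.klDiv ν (expMeasure ν T u β)
      = ENNReal.ofReal (β - ∫ z, inner ℝ u (T z) ∂ν) := by
  have integrable_exp := integrable_exp_inner hT hP
  have integrable_llr_self : Integrable (llr ν ν) ν :=
    (integrable_congr (llr_self ν)).2 (integrable_zero _ _ _)
  have absolutelyContinuous : ν ≪ expMeasure ν T u β := by
    rw [expMeasure_eq_tilted hT hP]
    exact absolutelyContinuous_tilted integrable_exp
  have integrable_llr : Integrable (llr ν (expMeasure ν T u β)) ν := by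
    rw [expMeasure_eq_tilted hT hP]
    exact integrable_llr_tilted_right .rfl hi integrable_llr_self integrable_exp
  have integral_llr : ∫ z, llr ν (expMeasure ν T u β) z ∂ν = β - ∫ z, inner ℝ u (T z) ∂ν := by
    rw [expMeasure_eq_tilted hT hP,
      integral_llr_tilted_right .rfl hi integrable_exp integrable_llr_self,
      integral_exp_inner hT hP, Real.log_exp, integral_congr_ae (llr_self ν)]
    simp only [Pi.zero_apply, integral_zero]
    ring
  rw [InformationTheory.klDiv_of_ac_of_integrable absolutelyContinuous integrable_llr,
    integral_llr]
  simp

theorem differentiableAt_partitionFunction (hT : Measurable T) {S : Set (Coord n)}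
    (hi : ∀ s ∈ S, Integrable (fun z => Real.exp (inner ℝ s (T z))) ν) {s₀ : Coord n}
    (hS : S ∈ 𝓝 s₀) :
    DifferentiableAt ℝ (fun s => ∫ z, Real.exp (inner ℝ s (T z)) ∂ν) s₀ := by
  obtain ⟨δ, hδ, hball⟩ := Metric.nhds_basis_closedBall.mem_iff.1 hS
  have hmeas (s : Coord n) : AEStronglyMeasurable (fun z => Real.exp (inner ℝ s (T z))) ν :=
    (measurable_inner_statistic hT s).exp.aestronglyMeasurable
  refine (hasFDerivAt_integral_of_dominated_of_fderiv_le (𝕜 := ℝ)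
    (F' := fun s z => Real.exp (inner ℝ s (T z)) • innerSL ℝ (T z))
    (bound := fun z => 2 * (n + 1) / δ * ∑ i, (Real.exp (inner ℝ (s₀ + δ • stdVec i) (T z))
      + Real.exp (inner ℝ (s₀ - δ • stdVec i) (T z))))
    (Metric.ball_mem_nhds s₀ (by positivity : 0 < δ / (2 * ((n : ℝ) + 1))))
    (Eventually.of_forall hmeas) (hi s₀ (mem_of_mem_nhds hS)) ?_ ?_ ?_ ?_).differentiableAt
  · exact (hmeas s₀).smul ((innerSL ℝ).continuous.measurable.comp hT).aestronglyMeasurable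
  · refine ae_of_all _ fun z s hs => ?_
    rw [norm_smul, innerSL_apply_norm, Real.norm_eq_abs, abs_of_pos (Real.exp_pos _)]
    exact exp_inner_mul_norm_le hδ (mem_ball_iff_norm.1 hs).le (T z)
  · have norm_smul_stdVec (i : Fin n) : ‖δ • (stdVec i : Coord n)‖ = δ := by
      rw [norm_smul, stdVec, PiLp.norm_single, norm_one, mul_one, Real.norm_eq_abs,
        abs_of_pos hδ]
    refine Integrable.const_mul (integrable_finsetSum _ fun i _ => ?_) _
    refine (hi _ (hball ?_)).add (hi _ (hball ?_))
    · rw [mem_closedBall_iff_norm, add_sub_cancel_left, norm_smul_stdVec]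
    · rw [mem_closedBall_iff_norm, sub_sub_cancel_left, norm_neg, norm_smul_stdVec]
  · refine ae_of_all _ fun z s _ => ?_
    simp only [real_inner_comm (T z)]
    exact (innerSL ℝ (T z)).hasFDerivAt.exp

end ExponentialMeasure

section VanishingSecondDerivative

variable {E F : Type*} [NormedAddCommGroup E] [NormedSpace ℝ E] [NormedAddCommGroup F]
  [NormedSpace ℝ F]

theorem eq_add_of_hasDerivAt_of_hasDerivAt_zero {f f' : ℝ → F}
    (hf : ∀ t ∈ Icc (0 : ℝ) 1, HasDerivAt f (f' t) t)
    (hf' : ∀ t ∈ Icc (0 : ℝ) 1, HasDerivAt f' 0 t) : f 1 = f 0 + f' 0 := by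
  have eq_of_hasDerivAt_zero {u : ℝ → F} (hu : ∀ t ∈ Icc (0 : ℝ) 1, HasDerivAt u 0 t) :
      ∀ t ∈ Icc (0 : ℝ) 1, u t = u 0 :=
    constant_of_has_deriv_right_zero (fun t ht => (hu t ht).continuousAt.continuousWithinAt)
      fun t ht => (hu t (Ico_subset_Icc_self ht)).hasDerivWithinAt
  have hasDerivAt_sub : ∀ t ∈ Icc (0 : ℝ) 1, HasDerivAt (fun t => f t - t • f' 0) 0 t := by
    intro t ht
    have hasDerivAt := (hf t ht).sub ((hasDerivAt_id t).smul_const (f' 0))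
    rwa [eq_of_hasDerivAt_zero hf' t ht, one_smul, sub_self] at hasDerivAt
  have eq_at_one := eq_of_hasDerivAt_zero hasDerivAt_sub 1 (right_mem_Icc.2 zero_le_one)
  rwa [one_smul, zero_smul, sub_zero, sub_eq_iff_eq_add] at eq_at_one

theorem eq_add_of_hasFDerivAt_of_hasFDerivAt_zero {U : Set E} (hU : Convex ℝ U) {f : E → F}
    {f' : E → E →L[ℝ] F} (hf : ∀ x ∈ U, HasFDerivAt f (f' x) x)
    (hf' : ∀ x ∈ U, HasFDerivAt f' (0 : E →L[ℝ] E →L[ℝ] F) x) {x y : E} (hx : x ∈ U) (hy : y ∈ U) :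
    f y = f x + f' x (y - x) := by
  have hline : ∀ t ∈ Icc (0 : ℝ) 1, AffineMap.lineMap x y t ∈ U := fun t ht =>
    hU.lineMap_mem hx hy ht
  have taylor := eq_add_of_hasDerivAt_of_hasDerivAt_zero
    (f := fun t => f (AffineMap.lineMap x y t))
    (f' := fun t => f' (AffineMap.lineMap x y t) (y - x))
    (fun t ht => (hf _ (hline t ht)).comp_hasDerivAt t AffineMap.hasDerivAt_lineMap)
    (fun t ht => by
      simpa using ((hf' _ (hline t ht)).comp_hasDerivAt t AffineMap.hasDerivAt_lineMap).clm_apply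
        (hasDerivAt_const t (y - x)))
  simpa only [AffineMap.lineMap_apply_one, AffineMap.lineMap_apply_zero] using taylor

end VanishingSecondDerivative

/-- The cumulant generating function, under the member `q` of an exponential family, of the
statistic `⟨θ(r) - θ(q), T⟩`: up to a constant, the log-likelihood ratio of `r` to `q`. -/
def likelihoodRatioCgf {n : ℕ} {M Ω : Type*} [MeasurableSpace Ω] (ν : Measure Ω)
    (T : Ω → Coord n) (θ : M → Coord n) (Ψ : M → ℝ) (q r : M) : ℝ → ℝ :=
  ProbabilityTheory.cgf (fun z => inner ℝ (θ r - θ q) (T z)) (expMeasure ν T (θ q) (Ψ q))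

namespace IsExponentialFamily

variable {n : ℕ} {M : Type*} [TopologicalSpace M] [ChartedSpace (Coord n) M]
  [IsManifold (𝓡 n) ∞ M] {g : Metric n M} {D : Connection n M}
  {Ω : Type*} [MeasurableSpace Ω] {ν : Measure Ω} {T : Ω → Coord n} {θ : M → Coord n} {Ψ : M → ℝ}

theorem mdifferentiable_parameter (F : IsExponentialFamily g D ν T θ Ψ) :
    MDifferentiable (𝓡 n) 𝓘(ℝ, Coord n) θ :=
  F.coord.mdifferentiable (by simp)

theorem logPartition_eq_log_integral (F : IsExponentialFamily g D ν T θ Ψ) (r : M) :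
    Ψ r = Real.log (∫ z, Real.exp (inner ℝ (θ r) (T z)) ∂ν) := by
  rw [integral_exp_inner F.measurable (F.normalized r), Real.log_exp]

theorem mdifferentiable_logPartition (F : IsExponentialFamily g D ν T θ Ψ) :
    MDifferentiable (𝓡 n) 𝓘(ℝ, ℝ) Ψ := by
  intro r
  have differentiableAt_partition :
      DifferentiableAt ℝ (fun s => ∫ z, Real.exp (inner ℝ s (T z)) ∂ν) (θ r) :=
    differentiableAt_partitionFunction F.measurable (S := range θ)
      (forall_mem_range.2 fun r' => integrable_exp_inner F.measurable (F.normalized r'))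
      (F.coord.isOpen_range.mem_nhds (mem_range_self r))
  have partition_ne_zero : ∫ z, Real.exp (inner ℝ (θ r) (T z)) ∂ν ≠ 0 := by
    rw [integral_exp_inner F.measurable (F.normalized r)]
    exact (Real.exp_pos _).ne'
  rw [funext F.logPartition_eq_log_integral]
  exact (differentiableAt_partition.log partition_ne_zero).mdifferentiableAt.comp r
    (F.mdifferentiable_parameter r)

theorem mdifferentiableAt_logLikelihood (F : IsExponentialFamily g D ν T θ Ψ) (z : Ω) (y : M) :
    MDifferentiableAt (𝓡 n) 𝓘(ℝ, ℝ) (fun s => inner ℝ (θ s) (T z) - Ψ s) y := by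
  have mdifferentiableAt_inner :
      MDifferentiableAt (𝓡 n) 𝓘(ℝ, ℝ) (fun s => (inner ℝ (θ s) (T z) : ℝ)) y := by
    simp only [real_inner_comm (T z)]
    exact ((innerSL ℝ (T z)).differentiableAt (x := θ y)).mdifferentiableAt.comp y
      (F.mdifferentiable_parameter y)
  exact mdifferentiableAt_inner.sub (F.mdifferentiable_logPartition y)

section ParameterAffine

variable {e : OpenPartialHomeomorph M (Coord n)}

theorem contDiffOn_parameter (F : IsExponentialFamily g D ν T θ Ψ)
    (he : e ∈ IsManifold.maximalAtlas (𝓡 n) ∞ M) : ContDiffOn ℝ ∞ (θ ∘ e.symm) e.target :=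
  fun _ hz => (contDiffAt_comp_symm he hz (F.coord.contMDiff _)).contDiffWithinAt

theorem hasFDerivAt_parameter (F : IsExponentialFamily g D ν T θ Ψ)
    (he : e ∈ IsManifold.maximalAtlas (𝓡 n) ∞ M) {z : Coord n} (hz : z ∈ e.target) :
    HasFDerivAt (θ ∘ e.symm) (fderiv ℝ (θ ∘ e.symm) z) z :=
  (((F.contDiffOn_parameter he).contDiffAt (e.open_target.mem_nhds hz)).differentiableAt
    (by simp)).hasFDerivAt

theorem differentiableAt_fderiv_parameter (F : IsExponentialFamily g D ν T θ Ψ)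
    (he : e ∈ IsManifold.maximalAtlas (𝓡 n) ∞ M) {z : Coord n} (hz : z ∈ e.target) :
    DifferentiableAt ℝ (fderiv ℝ (θ ∘ e.symm)) z :=
  (((F.contDiffOn_parameter he).fderiv_of_isOpen (m := ∞) e.open_target (by simp)).contDiffAt
    (e.open_target.mem_nhds hz)).differentiableAt (by simp)

theorem fderiv_fderiv_parameter [T2Space M] (F : IsExponentialFamily g D ν T θ Ψ)
    (he : IsAffineCoord D e) {z : Coord n} (hz : z ∈ e.target) :
    fderiv ℝ (fderiv ℝ (θ ∘ e.symm)) z = 0 := by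
  have ha := he.mem_maximalAtlas
  ext1 u
  ext1 d
  set y := e.symm z
  have hy : y ∈ e.source := e.map_target hz
  have apply_y : e y = z := e.right_inv hz
  obtain ⟨X, hX, hXe⟩ := exists_smoothField_eq_coordField ha hy d
  have parallel : D X y = 0 := by
    rw [← he.parallel d y hy]
    exact (connection_congr D (mdifferentiableAt_coordField ha hy d)
      (hXe.mono fun _ h => h.symm)).symm
  have mvfderiv_parameter : (fun x => mvfderiv (𝓡 n) θ x (X x))
      =ᶠ[𝓝 y] fun x => fderiv ℝ (θ ∘ e.symm) (e x) d := by
    filter_upwards [hXe, e.open_source.mem_nhds hy] with x hx hxs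
    rw [hx, coordField_eq, mvfderiv_coordFrame_apply ha hxs (F.mdifferentiable_parameter x)]
  have hasFDerivAt_fderiv_apply : HasFDerivAt (fun z => fderiv ℝ (θ ∘ e.symm) z d)
      ((fderiv ℝ (fderiv ℝ (θ ∘ e.symm)) z).flip d) (e y) := by
    rw [apply_y]
    simpa using
      (F.differentiableAt_fderiv_parameter ha hz).hasFDerivAt.clm_apply (hasFDerivAt_const d z)
  calc fderiv ℝ (fderiv ℝ (θ ∘ e.symm)) z u d
      = mvfderiv (𝓡 n) (fun x => fderiv ℝ (θ ∘ e.symm) (e x) d) y (coordFrame e y u) := by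
        rw [mvfderiv_comp_chart ha hy hasFDerivAt_fderiv_apply.differentiableAt,
          hasFDerivAt_fderiv_apply.fderiv, mvfderiv_coordFrame ha hy,
          ContinuousLinearMap.flip_apply]
    _ = mvfderiv (𝓡 n) (fun x => mvfderiv (𝓡 n) θ x (X x)) y (coordFrame e y u) :=
        (DFunLike.congr_fun mvfderiv_parameter.mfderiv_eq (coordFrame e y u)).symm
    _ = mvfderiv (𝓡 n) θ y (D X y (coordFrame e y u)) := F.affine X hX y (coordFrame e y u)
    _ = 0 := by
        rw [parallel]
        exact map_zero _

theorem parameter_symm_eq_add [T2Space M] (F : IsExponentialFamily g D ν T θ Ψ)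
    (he : IsAffineCoord D e) (hc : Convex ℝ e.target) {z z' : Coord n} (hz : z ∈ e.target)
    (hz' : z' ∈ e.target) :
    θ (e.symm z') = θ (e.symm z) + fderiv ℝ (θ ∘ e.symm) z (z' - z) :=
  eq_add_of_hasFDerivAt_of_hasFDerivAt_zero hc
    (fun _ hw => F.hasFDerivAt_parameter he.mem_maximalAtlas hw)
    (fun _ hw => F.fderiv_fderiv_parameter he hw ▸
      (F.differentiableAt_fderiv_parameter he.mem_maximalAtlas hw).hasFDerivAt) hz hz'

end ParameterAffine

section CoordSegment

variable [T2Space M] {e : OpenPartialHomeomorph M (Coord n)} {q r : M} {t : ℝ}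
  (F : IsExponentialFamily g D ν T θ Ψ) (he : IsAffineCoord D e) (hc : Convex ℝ e.target)
  (hq : q ∈ e.source) (hr : r ∈ e.source) (ht : AffineMap.lineMap (e q) (e r) t ∈ e.target)

include F he hc hq hr ht

theorem parameter_coordSegment :
    θ (coordSegment e q r t) = θ q + t • (θ r - θ q) := by
  have parameter_eq {z : Coord n} (hz : z ∈ e.target) :=
    F.parameter_symm_eq_add he hc (e.map_source hq) hz
  rw [e.left_inv hq] at parameter_eq
  rw [coordSegment, parameter_eq ht, AffineMap.lineMap_apply_module', add_sub_cancel_right,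
    map_smul, ← sub_eq_iff_eq_add'.2 (parameter_eq (e.map_source hr)), e.left_inv hr]

theorem expMeasure_coordSegment :
    expMeasure ν T (θ (coordSegment e q r t)) (Ψ (coordSegment e q r t))
      = expMeasure (expMeasure ν T (θ q) (Ψ q)) T (t • (θ r - θ q))
          (Ψ (coordSegment e q r t) - Ψ q) := by
  rw [expMeasure_expMeasure F.measurable, F.parameter_coordSegment he hc hq hr ht, add_sub_cancel]

theorem isProbabilityMeasure_coordSegment :
    IsProbabilityMeasure (expMeasure (expMeasure ν T (θ q) (Ψ q)) T (t • (θ r - θ q))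
      (Ψ (coordSegment e q r t) - Ψ q)) :=
  F.expMeasure_coordSegment he hc hq hr ht ▸ F.normalized _

theorem likelihoodRatioCgf_eq :
    likelihoodRatioCgf ν T θ Ψ q r t = Ψ (coordSegment e q r t) - Ψ q :=
  cgf_inner_eq F.measurable (F.isProbabilityMeasure_coordSegment he hc hq hr ht)

theorem mem_interior_integrableExpSet :
    t ∈ interior (ProbabilityTheory.integrableExpSet (fun z => inner ℝ (θ r - θ q) (T z))
      (expMeasure ν T (θ q) (Ψ q))) :=
  mem_interior_iff_mem_nhds.2 <| (eventually_lineMap_mem_target ht).mono fun _ hs =>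
    mem_integrableExpSet_inner F.measurable (F.isProbabilityMeasure_coordSegment he hc hq hr hs)

theorem hasDerivAt_likelihoodRatioCgf :
    HasDerivAt (likelihoodRatioCgf ν T θ Ψ q r)
      (deriv (likelihoodRatioCgf ν T θ Ψ q r) t) t :=
  (ProbabilityTheory.analyticAt_cgf
    (F.mem_interior_integrableExpSet he hc hq hr ht)).differentiableAt.hasDerivAt

theorem mvfderiv_logLikelihood_coordSegment (z : Ω) :
    mvfderiv (𝓡 n) (fun s => inner ℝ (θ s) (T z) - Ψ s) (coordSegment e q r t)
        (coordFrame e (coordSegment e q r t) (e r - e q))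
      = inner ℝ (θ r - θ q) (T z)
        - deriv (likelihoodRatioCgf ν T θ Ψ q r) t := by
  have ha := he.mem_maximalAtlas
  set X : ℝ := inner ℝ (θ r - θ q) (T z)
  set K := likelihoodRatioCgf ν T θ Ψ q r
  set ℓ : M → ℝ := fun s => inner ℝ (θ s) (T z) - Ψ s
  have hy : coordSegment e q r t ∈ e.source := e.map_target ht
  have mdifferentiableAt := F.mdifferentiableAt_logLikelihood z (coordSegment e q r t)
  have differentiableAt : DifferentiableAt ℝ (ℓ ∘ e.symm) (AffineMap.lineMap (e q) (e r) t) :=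
    (mdifferentiableAt.comp (AffineMap.lineMap (e q) (e r) t)
      ((mdifferentiable_of_mem_maximalAtlas ha).mdifferentiableAt_symm ht)).differentiableAt
  have eventually_eq : (fun s => ℓ (coordSegment e q r s))
      =ᶠ[𝓝 t] fun s => inner ℝ (θ q) (T z) + s * X - (K s + Ψ q) := by
    filter_upwards [eventually_lineMap_mem_target ht] with s hs
    simp only [ℓ, K, X, F.likelihoodRatioCgf_eq he hc hq hr hs,
      F.parameter_coordSegment he hc hq hr hs, inner_add_left, real_inner_smul_left]
    ring
  have hasDerivAt_line : HasDerivAt (fun s => inner ℝ (θ q) (T z) + s * X - (K s + Ψ q))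
      (1 * X - deriv K t) t :=
    (((hasDerivAt_id t).mul_const X).const_add _).sub
      ((F.hasDerivAt_likelihoodRatioCgf he hc hq hr ht).add_const _)
  rw [mvfderiv_coordFrame_apply ha hy mdifferentiableAt, coordSegment, e.right_inv ht,
    ← one_mul X]
  exact (differentiableAt.hasFDerivAt.comp_hasDerivAt t AffineMap.hasDerivAt_lineMap).unique
    (hasDerivAt_line.congr_of_eventuallyEq eventually_eq)

/-- Both sides are the variance of the score: the Fisher metric by definition, the second
derivative of the cumulant generating function by tilting. -/
theorem iteratedDeriv_two_likelihoodRatioCgf :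
    iteratedDeriv 2 (likelihoodRatioCgf ν T θ Ψ q r) t
      = coordMetric g e (AffineMap.lineMap (e q) (e r) t) (e r - e q) (e r - e q) := by
  set y := coordSegment e q r t with hy
  have mem_interior := F.mem_interior_integrableExpSet he hc hq hr ht
  have tilted : expMeasure ν T (θ y) (Ψ y) = (expMeasure ν T (θ q) (Ψ q)).tilted
      fun z => t * inner ℝ (θ r - θ q) (T z) := by
    rw [hy, F.expMeasure_coordSegment he hc hq hr ht]
    exact expMeasure_smul_eq_tilted_mul F.measurable
      (F.isProbabilityMeasure_coordSegment he hc hq hr ht)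
  have coordMetric_eq :
      coordMetric g e (AffineMap.lineMap (e q) (e r) t) (e r - e q) (e r - e q)
        = g.inner y (coordFrame e y (e r - e q)) (coordFrame e y (e r - e q)) := rfl
  rw [likelihoodRatioCgf, coordMetric_eq, F.fisher, tilted,
    ← ProbabilityTheory.variance_tilted_mul mem_interior,
    ProbabilityTheory.variance_eq_integral
      (measurable_inner_statistic F.measurable (θ r - θ q)).aemeasurable,
    ProbabilityTheory.integral_tilted_mul_self mem_interior]
  simp only [y, F.mvfderiv_logLikelihood_coordSegment he hc hq hr ht, likelihoodRatioCgf, ← sq]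

theorem hasDerivAt_deriv_likelihoodRatioCgf :
    HasDerivAt (deriv (likelihoodRatioCgf ν T θ Ψ q r))
      (coordMetric g e (AffineMap.lineMap (e q) (e r) t) (e r - e q) (e r - e q)) t := by
  rw [← F.iteratedDeriv_two_likelihoodRatioCgf he hc hq hr ht, iteratedDeriv_succ,
    iteratedDeriv_one]
  exact (ProbabilityTheory.analyticAt_cgf
    (F.mem_interior_integrableExpSet he hc hq hr ht)).deriv.differentiableAt.hasDerivAt

end CoordSegment

theorem klDiv_eq_ofReal (F : IsExponentialFamily g D ν T θ Ψ) {q r : M}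
    (h0 : (0 : ℝ) ∈ interior (ProbabilityTheory.integrableExpSet
      (fun z => inner ℝ (θ r - θ q) (T z)) (expMeasure ν T (θ q) (Ψ q)))) :
    InformationTheory.klDiv (expMeasure ν T (θ q) (Ψ q)) (expMeasure ν T (θ r) (Ψ r))
      = ENNReal.ofReal (Ψ r - Ψ q - deriv (likelihoodRatioCgf ν T θ Ψ q r) 0) := by
  have := F.normalized q
  have change_base : expMeasure ν T (θ r) (Ψ r)
      = expMeasure (expMeasure ν T (θ q) (Ψ q)) T (θ r - θ q) (Ψ r - Ψ q) := by
    rw [expMeasure_expMeasure F.measurable, add_sub_cancel, add_sub_cancel]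
  rw [likelihoodRatioCgf, ProbabilityTheory.deriv_cgf_zero h0, probReal_univ, div_one, change_base]
  exact klDiv_expMeasure F.measurable (change_base ▸ F.normalized r)
    (ProbabilityTheory.integrable_of_mem_interior_integrableExpSet h0)

end IsExponentialFamily

namespace IsLegendreChart

variable {n : ℕ} {M : Type*} [TopologicalSpace M] [ChartedSpace (Coord n) M]
  [IsManifold (𝓡 n) ∞ M] {g : Metric n M} {D : Connection n M} {C : CoordPair n M}
  {h : OpenPartialHomeomorph (Coord n) (Coord n)} {q r : M}

theorem divergence_eq_bregman (H : IsLegendreChart g D C h) (hq : q ∈ C.dom) :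
    divergence C r q = C.ψ (C.η r) - C.ψ (C.η q) - inner ℝ (C.ηs q) (C.η r - C.η q) := by
  have legendre := H.pair.legendre _ (H.map_mem hq)
  rw [divergence, inner_sub_right, H.star_apply, real_inner_comm (C.η q),
    real_inner_comm (C.η r)]
  linarith

variable {Ω : Type*} [MeasurableSpace Ω] {ν : Measure Ω} {T : Ω → Coord n} {θ : M → Coord n}
  {Ψ : M → ℝ}

theorem hasDerivAt_potential_lineMap (H : IsLegendreChart g D C h) {z w : Coord n} {t : ℝ}
    (ht : AffineMap.lineMap z w t ∈ C.η.target) :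
    HasDerivAt (fun s => C.ψ (AffineMap.lineMap z w s))
      (inner ℝ (h (AffineMap.lineMap z w t)) (w - z)) t :=
  (H.pair.left.hasFDerivAt (H.target_eq ▸ ht)).comp_hasDerivAt t AffineMap.hasDerivAt_lineMap

theorem hasDerivAt_inner_gradient_lineMap (H : IsLegendreChart g D C h) {z w : Coord n} {t : ℝ}
    (ht : AffineMap.lineMap z w t ∈ C.η.target) :
    HasDerivAt (fun s => (inner ℝ (h (AffineMap.lineMap z w s)) (w - z) : ℝ))
      (coordMetric g C.η (AffineMap.lineMap z w t) (w - z) (w - z)) t := by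
  have hz : AffineMap.lineMap z w t ∈ h.source := H.target_eq ▸ ht
  rw [← H.metric_eq _ hz]
  simpa using ((H.pair.left.hasFDerivAt_gradient hz).comp_hasDerivAt t
    AffineMap.hasDerivAt_lineMap).inner ℝ (hasDerivAt_const t (w - z))

/-- Along the coordinate segment from `q` to `r`, the cumulant generating function of the
log-likelihood ratio and the potential `ψ` have the same second derivative, the metric. -/
theorem logPartition_bregman_eq [T2Space M] (H : IsLegendreChart g D C h)
    (F : IsExponentialFamily g D ν T θ Ψ) (hq : q ∈ C.dom) (hr : r ∈ C.dom) :
    Ψ r - Ψ q - deriv (likelihoodRatioCgf ν T θ Ψ q r) 0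
      = C.ψ (C.η r) - C.ψ (C.η q) - inner ℝ (C.ηs q) (C.η r - C.η q) := by
  have hconv : Convex ℝ C.η.target := H.target_eq ▸ H.pair.left.convex
  have hline : ∀ t ∈ Icc (0 : ℝ) 1, AffineMap.lineMap (C.η q) (C.η r) t ∈ C.η.target :=
    fun _ ht => lineMap_mem_target hconv hq hr ht
  have taylor := eq_add_of_hasDerivAt_of_hasDerivAt_zero
    (fun t ht => (F.hasDerivAt_likelihoodRatioCgf H.affine hconv hq hr (hline t ht)).sub
      (H.hasDerivAt_potential_lineMap (hline t ht)))
    (fun t ht => by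
      simpa using
        (F.hasDerivAt_deriv_likelihoodRatioCgf H.affine hconv hq hr (hline t ht)).fun_sub
          (H.hasDerivAt_inner_gradient_lineMap (hline t ht)))
  have cgf_one : likelihoodRatioCgf ν T θ Ψ q r 1 = Ψ r - Ψ q := by
    rw [F.likelihoodRatioCgf_eq H.affine hconv hq hr (hline 1 (right_mem_Icc.2 zero_le_one)),
      coordSegment_one hr]
  have cgf_zero : likelihoodRatioCgf ν T θ Ψ q r 0 = 0 := by
    have := F.normalized q
    exact ProbabilityTheory.cgf_zero
  simp only [Pi.sub_apply, AffineMap.lineMap_apply_one, AffineMap.lineMap_apply_zero, cgf_one,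
    cgf_zero, ← H.star_apply] at taylor
  linarith

theorem klDiv_eq_divergence [T2Space M] (H : IsLegendreChart g D C h)
    (F : IsExponentialFamily g D ν T θ Ψ) (hr : r ∈ C.dom) (hq : q ∈ C.dom) :
    InformationTheory.klDiv (expMeasure ν T (θ q) (Ψ q)) (expMeasure ν T (θ r) (Ψ r))
      = ENNReal.ofReal (divergence C r q) := by
  have hconv : Convex ℝ C.η.target := H.target_eq ▸ H.pair.left.convex
  rw [H.divergence_eq_bregman hq, ← H.logPartition_bregman_eq F hq hr]
  exact F.klDiv_eq_ofReal (F.mem_interior_integrableExpSet H.affine hconv hq hr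
    (lineMap_mem_target hconv hq hr (left_mem_Icc.2 zero_le_one)))

end IsLegendreChart

end DuallyFlat

end

theorem corollaryC {n : ℕ} {M : Type*} [TopologicalSpace M] [T2Space M]
    [ChartedSpace (DuallyFlat.Coord n) M] [IsManifold (𝓡 n) ∞ M]
    (g : DuallyFlat.Metric n M) (D Ds : DuallyFlat.Connection n M)
    (hflat : DuallyFlat.IsDuallyFlat g D Ds) (x : M) :
    ∃ C : DuallyFlat.CoordPair n M,
      x ∈ C.dom ∧
      DuallyFlat.IsDualMongeAmperePair g D Ds C ∧
      (∀ r ∈ C.dom, ∀ q ∈ C.dom, 0 ≤ DuallyFlat.divergence C r q ∧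
        (DuallyFlat.divergence C r q = 0 ↔ r = q)) ∧
      (∀ p ∈ C.dom, ∀ q ∈ C.dom,
        (∃ γ : ℝ → M, DuallyFlat.IsOptimalLearning g C.η
          (fun r => DuallyFlat.divergence C q r) p q γ) ∧
        (∃ γ : ℝ → M, DuallyFlat.IsOptimalLearning g C.ηs
          (fun r => DuallyFlat.divergence C r q) p q γ)) ∧
      (∀ (Ω : Type*) [MeasurableSpace Ω] (ν : Measure Ω) (T : Ω → DuallyFlat.Coord n)
        (θ : M → DuallyFlat.Coord n) (Ψ : M → ℝ),
        DuallyFlat.IsExponentialFamily g D ν T θ Ψ →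
        ∀ r ∈ C.dom, ∀ q ∈ C.dom,
          InformationTheory.klDiv (DuallyFlat.expMeasure ν T (θ q) (Ψ q))
              (DuallyFlat.expMeasure ν T (θ r) (Ψ r))
            = ENNReal.ofReal (DuallyFlat.divergence C r q)) := by
  obtain ⟨C, h, hx, H⟩ := DuallyFlat.exists_isLegendreChart hflat x
  refine ⟨C, hx, H.isDualMongeAmperePair hflat, fun r hr q hq => ?_,
    fun p hp q hq => ⟨⟨_, H.isOptimalLearning hp hq⟩, ⟨_, H.isOptimalLearning_star hp hq⟩⟩,
    fun Ω _ ν T θ Ψ F r hr q hq => H.klDiv_eq_divergence F hr hq⟩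
  rcases eq_or_ne r q with rfl | hne
  · exact ⟨(H.divergence_self hr).ge, fun _ => rfl, fun _ => H.divergence_self hr⟩
  · have hpos := H.divergence_pos hr hq hne
    exact ⟨hpos.le, fun h0 => absurd h0 hpos.ne', fun h0 => absurd h0 hne⟩
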